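/- **Model.** Fix a disk $A$ of radius $r_A>0$. For $\lambda=\lambda^{(p)}$, the primary and secondary nodes form independent Poisson point processes on $A$ with densities $\lambda^{(p)}$ and $\lambda^{(s)}=(\lambda^{(p)})^{\beta}$, where $0<\beta<1$. Let $R_r^{(p)}=K_p\sqrt{\log\lambda^{(p)}/\lambda^{(p)}}$, $R_I^{(p)}=\sqrt{1+l_p}\,R_r^{(p)}$, $R_r^{(s)}=K_s\sqrt{\log\lambda^{(s)}/\lambda^{(s)}}$, $R_I^{(s)}=\sqrt{1+l_s}\,R_r^{(s)}$ and $R_I^{(sp)}=\rho R_I^{(s)}$, with constants $K_p,K_s>0$, $l_p,l_s\ge 0$, $\rho\ge 1$. Each primary node picks a destination uniformly at random among the other primary nodes. Time is slotted. Each primary node has a first-in-first-out queue. In slot $0$ each queue holds one packet of the node itself, and whenever a queue becomes empty the node generates a new packet for its destination. In every slot each primary node, independently, initiates a transmission of its head packet with probability $q^{(p)}$. If the packet's destination is within $R_r^{(p)}$, the receiver is the destination; otherwise it is chosen, afresh in each slot, uniformly among the other primary nodes in the half-disk of radius $R_r^{(p)}$ centred at the node and oriented towards the destination. A secondary node transmits,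 with probability $q^{(s)}$ independently, if no primary transmitter lies within the detection range $R_D\ge 0$ of it. A primary transmission is successful if no other primary node within $R_I^{(p)}$ of its receiver (including the receiver) initiates a transmission and no transmitting secondary node lies within $R_I^{(sp)}$ of its receiver. A successfully transmitted packet joins the end of the receiver's queue, or leaves the network if the receiver is its destination; other packets stay at the head of their queues. The spatial throughput in slot $t$ is the mean, over node locations, source-destination pairs, routing and channel access, of the total decrease, over all packets successfully transmitted in slot $t$, of their distances to their destinations. Write $C_{\{\beta<1\},t}^{(p)}(\lambda^{(p)})$ for the primary throughput in the overlaid network and $C_t^{(p)}(\lambda^{(p)})$ for that of the stand-alone primary network (no secondary nodes). If $C(\lambda)=\Theta(f(\lambda))$, the asymptotic multiplexing gain (AMG) of $C$ relative to $f$ is $\lim_{\lambda\to\infty}C(\lambda)/f(\lambda)$. **Statement.** Let $q^{(p)}\in[0,1]$ satisfy $\lambda^{(p)}q^{(p)}\pi (R_I^{(p)})^2\to c$ for some constant $c>0$ (so that $q^{(p)}$ is of exact order $1/\log\lambda^{(p)}$) and let $f(\lambda)=\sqrt{\lambda/\log\lambda}$. Then there are constants $\chi>0$ and $\chi^{(p)}_{\{\beta<1\}}$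 with $$\frac{\chi^{(p)}_{\{\beta<1\}}}{\chi}=\exp\left(-\left(\frac{R_I^{(sp)}}{R_I^{(s)}}\right)^2\right)$$ such that for every slot $t$: 1. $C_t^{(p)}=\Theta(f)$, with AMG $\chi$; 2. for every detection range $R_D=R_D(\lambda^{(p)})\ge 0$ with $R_D=O(R_r^{(p)})$, including $R_D=0$ (no sensing), and every $q^{(s)}=q^{(s)}(\lambda^{(p)})\in[0,1]$ whose effective access probability $\tilde q^{(s)}=q^{(s)}\exp(-\lambda^{(p)}q^{(p)}\pi R_D^2)$ satisfies $\lambda^{(s)}\tilde q^{(s)}\pi(R_I^{(s)})^2\to 1$, one has $C_{\{\beta<1\},t}^{(p)}=\Theta\big(\sqrt{\lambda^{(p)}/\log\lambda^{(p)}}\big)$, with AMG $\chi^{(p)}_{\{\beta<1\}}$. In particular, at this normalisation of the secondary effective access probability, the primary AMG does not depend on $R_D$: spectrum sensing does not improve it asymptotically. -/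

import Mathlib

open Real Filter Topology MeasureTheory ProbabilityTheory Asymptotics
open scoped NNReal ENNReal

noncomputable section

namespace OverlaidAloha

/-! ### Finite probability -/

/-- The product law: independent coordinates, the `i`-th one with law `p i`. -/
def indep {ι : Type} [Fintype ι] [DecidableEq ι] {α : Type} [Fintype α]
    (p : ι → PMF α) : PMF (ι → α) :=
  PMF.ofFintype (fun f => ∏ i, p i (f i)) (by
    have h := Finset.prod_univ_sum (fun _ : ι => (Finset.univ : Finset α)) (fun i a => p i a)
    rw [Fintype.piFinset_univ] at h
    rw [← h]
    refine Finset.prod_eq_one fun i _ => ?_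
    rw [← tsum_fintype (L := .unconditional _)]
    exact (p i).tsum_coe)

open Classical in
/-- A uniformly chosen element of the finite set `s`; `none` if there is nothing to choose. -/
def pick {α : Type} (s : Finset α) : PMF (Option α) :=
  if h : s.Nonempty then (PMF.uniformOfFinset s h).map some else PMF.pure none

/-- A coin showing `true` with probability `q`. -/
def coin (q : unitInterval) : PMF Bool :=
  PMF.ofFintype (fun b => ENNReal.ofReal (if b then (q : ℝ) else 1 - q)) (by
    rw [Fintype.sum_bool]
    simp only [if_true, Bool.false_eq_true, if_false]
    rw [← ENNReal.ofReal_add q.2.1 (sub_nonneg.2 q.2.2)]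
    simp)

/-- Independent coins, each showing `true` with probability `q`. -/
def coins (n : ℕ) (q : unitInterval) : PMF (Fin n → Bool) := indep fun _ => coin q

/-- Expectation of a (bounded) random variable under a discrete law. -/
def expect {α : Type} (p : PMF α) (f : α → ℝ) : ℝ := ∑' a, (p a).toReal * f a

/-! ### Node locations -/

/-- The Euclidean plane. -/
abbrev Plane := EuclideanSpace ℝ (Fin 2)

/-- A finite configuration of nodes: their number and their locations. -/
abbrev Config := Σ n : ℕ, (Fin n → Plane)

/-- The law of a homogeneous Poisson point process of density `lam` on a region `A` of positive
finite area: a Poisson number of points with mean `lam * |A|`, which, given their number, are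
independent and uniform on `A`. -/
def poissonNodes (A : Set Plane) (lam : ℝ) : Measure Config :=
  (poissonMeasure (lam * volume.real A).toNNReal).bind fun n =>
    (Measure.pi fun _ : Fin n => (volume[|A] : Measure Plane)).map
      (fun x => (⟨n, x⟩ : Config))

/-! ### The protocols in one slot -/

/-- Parameters of the two networks that matter to the primary network. -/
structure Params where
  /-- transmission range of the primary nodes -/
  Rr : ℝ
  /-- interference range from primary transmitters to primary receivers -/
  RI : ℝ
  /-- interference range from secondary transmitters to primary receivers -/
  RIsp : ℝ
  /-- detection range of the secondary nodes -/
  RD : ℝ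
  /-- ALOHA parameter of the primary nodes -/
  qp : unitInterval
  /-- ALOHA parameter of the secondary nodes -/
  qs : unitInterval

section Slot

variable {n m : ℕ}

/-- The queue of every primary node. A packet is represented by its destination, and the packet
at the head of the queue is the one to be transmitted. -/
abbrev Queues (n : ℕ) := Fin n → List (Fin n)

/-- The random choices made in one slot. -/
structure Slot (n m : ℕ) where
  /-- the primary nodes that initiate a transmission -/
  active : Fin n → Bool
  /-- the secondary nodes that would initiate a transmission over an idle channel -/
  coin : Fin m → Bool
  /-- the next relay (or final receiver) of the packet at the head of the queue of each node -/
  relay : Fin n → Option (Fin n)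

open Classical in
/-- The possible next hops at node `i` of a packet with destination `d`: the destination itself
if it is within the transmission range, and otherwise all other nodes in the half-disk with
centre at node `i`, radius `Rr` and orientation towards the destination. -/
def nextHops (P : Params) (x : Fin n → Plane) (i d : Fin n) : Finset (Fin n) :=
  if dist (x i) (x d) ≤ P.Rr then {d}
  else Finset.univ.filter fun j =>
    j ≠ i ∧ dist (x j) (x i) ≤ P.Rr ∧ 0 ≤ inner ℝ (x j - x i) (x d - x i)

/-- Random half-disk routing: the next hop of the head packet is chosen uniformly at random. -/
def relayLaw (P : Params) (x : Fin n → Plane) (Q : Queues n) (i : Fin n) : PMF (Option (Fin n)) :=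
  match (Q i).head? with
  | none => PMF.pure none
  | some d => pick (nextHops P x i d)

/-- The law of the choices of one slot: all coins and all relays are chosen independently. -/
def slotLaw (P : Params) (x : Fin n → Plane) (m : ℕ) (Q : Queues n) : PMF (Slot n m) :=
  (coins n P.qp).bind fun a => (coins m P.qs).bind fun b =>
    (indep (relayLaw P x Q)).map fun r => ⟨a, b, r⟩

/-- Secondary node `k` transmits: it detects no primary transmitter within `RD` of itself, and
its ALOHA coin says so (secondary nodes always have a packet to transmit). -/
def SecondaryTransmits (P : Params) (x : Fin n → Plane) (y : Fin m → Plane) (s : Slot n m)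
    (k : Fin m) : Prop :=
  s.coin k = true ∧ ∀ i, s.active i = true → P.RD < dist (x i) (y k)

/-- Primary node `i` successfully transmits to node `j`: it initiates a transmission to `j`, no
other primary node within `RI` of `j` (including `j` itself) does, and no secondary node within
`RIsp` of `j` transmits. -/
def Delivers (P : Params) (x : Fin n → Plane) (y : Fin m → Plane) (s : Slot n m)
    (i j : Fin n) : Prop :=
  s.active i = true ∧ s.relay i = some j ∧
    (∀ k, k ≠ i → dist (x k) (x j) ≤ P.RI → s.active k = false) ∧
    ∀ k, SecondaryTransmits P x y s k → P.RIsp < dist (y k) (x j)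

/-- The progress of a packet with destination `d` over the hop from `i` to `j`. -/
def progress (x : Fin n → Plane) (i j d : Fin n) : ℝ := dist (x i) (x d) - dist (x j) (x d)

open Classical in
/-- The total progress of all successfully transmitted packets in one slot. -/
def totalProgress (P : Params) (x : Fin n → Plane) (y : Fin m → Plane) (Q : Queues n)
    (s : Slot n m) : ℝ :=
  ∑ i, ∑ j, ∑ d, if Delivers P x y s i j ∧ (Q i).head? = some d then progress x i j d else 0

/-! ### Evolution of the queues -/

/-- Every node picks a destination uniformly at random among all other nodes. -/
def destinationLaw (n : ℕ) : PMF (Fin n → Option (Fin n)) :=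
  indep fun i => pick (Finset.univ.erase i)

/-- A node with nothing to relay generates a packet of its own, so that it always has a packet to
transmit. -/
def refill (own : Option (Fin n)) (q : List (Fin n)) : List (Fin n) :=
  if q = [] then own.toList else q

open Classical in
/-- The queues after a slot: a successfully transmitted packet leaves the queue of its sender and
joins the end of the queue of its receiver, or leaves the network if this is its destination. -/
def nextQueues (P : Params) (x : Fin n → Plane) (y : Fin m → Plane)
    (own : Fin n → Option (Fin n)) (Q : Queues n) (s : Slot n m) : Queues n := fun j =>
  let kept := if ∃ i, Delivers P x y s j i then (Q j).tail else Q j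
  let received := (List.finRange n).filterMap fun i =>
    if Delivers P x y s i j then (Q i).head? else none
  refill (own j) (kept ++ received.filter fun d => d ≠ j)

/-- The law of the queues at the beginning of slot `t`, given the node locations and the
source-destination pairs. In slot `0` every node holds a packet of its own. -/
def queueLaw (P : Params) (x : Fin n → Plane) (y : Fin m → Plane)
    (own : Fin n → Option (Fin n)) : ℕ → PMF (Queues n)
  | 0 => PMF.pure fun i => refill (own i) []
  | t + 1 => (queueLaw P x y own t).bind fun Q =>
      (slotLaw P x m Q).map (nextQueues P x y own Q)

/-- The mean total progress of all successfully transmitted primary packets in slot `t`, given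
the locations `x` of the primary and `y` of the secondary nodes; the mean is over
source-destination pairs, routing paths and channel access. -/
def meanProgress (P : Params) (x : Fin n → Plane) (y : Fin m → Plane) (t : ℕ) : ℝ :=
  expect
    ((destinationLaw n).bind fun own => (queueLaw P x y own t).bind fun Q =>
      (slotLaw P x m Q).map fun s => (Q, s))
    fun z => totalProgress P x y z.1 z.2

end Slot

/-! ### Spatial throughput and asymptotic multiplexing gain -/

/-- The spatial throughput, in slot `t`, of the primary network with density `lamp` in the region
`A`, overlaid with a secondary network with density `lams`. -/
def throughput (A : Set Plane) (lamp lams : ℝ) (P : Params) (t : ℕ) : ℝ :=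
  ∫ c, meanProgress P c.1.2 c.2.2 t ∂((poissonNodes A lamp).prod (poissonNodes A lams))

/-- The spatial throughput, in slot `t`, of the stand-alone primary network (no secondary nodes;
the secondary parameters in `P` play no role). -/
def singleThroughput (A : Set Plane) (lamp : ℝ) (P : Params) (t : ℕ) : ℝ :=
  ∫ c, meanProgress P c.2 (Fin.elim0 : Fin 0 → Plane) t ∂(poissonNodes A lamp)

/-- `χ` is the asymptotic multiplexing gain of a throughput `C` that scales as `Θ(f)`. -/
def IsAMG (C f : ℝ → ℝ) (χ : ℝ) : Prop :=
  C =Θ[atTop] f ∧ Tendsto (fun lam => C lam / f lam) atTop (𝓝 χ)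

/-- The transmission range `K √(log lam / lam)` in a network with density `lam`. -/
def txRange (K lam : ℝ) : ℝ := K * √(log lam / lam)

/-- The interference range `√(1 + l) K √(log lam / lam)` within a network with density `lam`. -/
def intfRange (K l lam : ℝ) : ℝ := √(1 + l) * txRange K lam

/-- The effective access probability of the secondary nodes: the ALOHA parameter `qs` times the
probability that a disk of radius `RD` is free of primary transmitters. -/
def effectiveAccess (qs qp : unitInterval) (lamp RD : ℝ) : ℝ :=
  qs * exp (-(lamp * qp * (π * RD ^ 2)))

end OverlaidAloha

end

noncomputable section

namespace OverlaidAloha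

/-! ### Expectations under discrete laws -/

section Expect

variable {α β : Type}

/-! In one slot the network makes progress of the order of the number of nodes times the probability
`q = qp` of transmitting times the hop length `R = txRange Kp`. With `r` the mean number of primary
nodes, `r q R / √(lam / log lam)` converges (`tendsto_scale`). It remains to find the limit of the
throughput divided by `r q R`, with and without secondary nodes.

Queues. A node keeps its first packet as long as it does not transmit, so by slot `t` the head of a
given queue has changed with probability at most `t q` (`expect_head_ne_le`). As `t` is fixed and `q
→ 0`, slot `t` may be replaced by slot `0` at a relative cost `O(t q)` (`abs_throughput_sub_le`). In
slot `0` the destinations of the head packets are uniform, and no long-run analysis of the queues is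
needed.

Secondary nodes. Given the primary coins, the secondary nodes that would spoil a reception form a
thinned Poisson process. Averaging over them gives `exp (-kap V)`, where `V` is the area of the part
of the disk of radius `RIsp` about the receiver in which no primary transmitter is detected
(`integral_hopSuccess`). Since `β < 1`, this disk is much larger than the detection range, and the
events that two of its points are uncovered are nearly independent unless the points are close.
Hence the second moment of `V` about `p π RIsp²`, with `p = exp (-lam q π RD²)`, is small compared
with `RIsp⁴` (`integral_coverVariance_le`, `tendsto_coverBound`). So `V` may be replaced by the
constant `p π RIsp²`, and the secondary network multiplies the success probability of typical hops
by one common factor `exp (-kap p π RIsp²)`. As `kap p` is the secondary density times the effective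
access probability, the exponent tends to `ρ²` whatever the detection range: sensing enters only
through `p`, and the normalisation absorbs it.

Primary nodes. The two random denominators, the number of possible destinations and the number of
possible next hops, are replaced by their means using a law of large numbers
(`abs_sourceProgress_sub_le`). What is left is a sum over triples (source, destination, relay),
whose mean is given by the Campbell-Mecke formula (`lintegral_palmSum₃`). Away from the boundary the
channel is clear with probability close to `exp (-c)`; rescaling the position of the relay by `R`
and dominated convergence give the geometric constant `meanGain` (`tendsto_relayIntegral`), which is
positive (`meanGain_pos`).

`abs_firstProgress_sub_le` collects the errors. `tendsto_throughput_div` gives the limit for both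
networks at once, the stand-alone network being the case of secondary density zero. -/

lemma hasSum_toReal (p : PMF α) : HasSum (fun a => (p a).toReal) 1 := by
  have h := ENNReal.hasSum_toReal (f := fun a => p a) (by rw [p.tsum_coe]; simp)
  rwa [← ENNReal.tsum_toReal_eq (fun a => p.apply_ne_top a), p.tsum_coe, ENNReal.toReal_one] at h

lemma summable_expect (p : PMF α) {f : α → ℝ} {C : ℝ} (hf : ∀ a, |f a| ≤ C) :
    Summable fun a => (p a).toReal * f a := by
  refine Summable.of_norm_bounded ((hasSum_toReal p).summable.mul_right C) fun a => ?_
  rw [norm_mul, Real.norm_of_nonneg ENNReal.toReal_nonneg]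
  exact mul_le_mul_of_nonneg_left (hf a) ENNReal.toReal_nonneg

lemma expect_const (p : PMF α) (c : ℝ) : expect p (fun _ => c) = c := by
  unfold expect
  rw [tsum_mul_right, (hasSum_toReal p).tsum_eq, one_mul]

lemma expect_mono (p : PMF α) {f g : α → ℝ} {C D : ℝ} (hf : ∀ a, |f a| ≤ C) (hg : ∀ a, |g a| ≤ D)
    (h : ∀ a ∈ p.support, f a ≤ g a) : expect p f ≤ expect p g := by
  refine Summable.tsum_le_tsum (fun a => ?_) (summable_expect p hf) (summable_expect p hg)
  by_cases ha : a ∈ p.support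
  · exact mul_le_mul_of_nonneg_left (h a ha) ENNReal.toReal_nonneg
  · rw [PMF.mem_support_iff, not_not] at ha
    simp [ha]

lemma abs_expect_le (p : PMF α) {f : α → ℝ} {C : ℝ} (hf : ∀ a, |f a| ≤ C) :
    |expect p f| ≤ C := by
  have hC : ∀ a : α, |(fun _ : α => C) a| ≤ |C| := fun _ => le_rfl
  have hC' : ∀ a : α, |(fun _ : α => -C) a| ≤ |C| := fun _ => by simp
  rw [abs_le]
  constructor
  · have := expect_mono p hC' hf fun a _ => (abs_le.1 (hf a)).1
    rwa [expect_const] at this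
  · have := expect_mono p hf hC fun a _ => (abs_le.1 (hf a)).2
    rwa [expect_const] at this

lemma expect_nonneg (p : PMF α) {f : α → ℝ} (hf : ∀ a, 0 ≤ f a) : 0 ≤ expect p f :=
  tsum_nonneg fun a => mul_nonneg ENNReal.toReal_nonneg (hf a)

lemma expect_pure (a : α) (f : α → ℝ) : expect (PMF.pure a) f = f a := by
  unfold expect
  rw [tsum_eq_single a]
  · simp
  · intro b hb
    simp [PMF.pure_apply, hb]

/-- Fubini for series. The bound on `f` makes the double series absolutely summable; this is why
bounds accompany most of the expectations below. -/
lemma expect_bind (p : PMF α) (k : α → PMF β) {f : β → ℝ} {C : ℝ} (hf : ∀ b, |f b| ≤ C) :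
    expect (p.bind k) f = expect p fun a => expect (k a) f := by
  have hs : Summable fun z : α × β => (p z.1).toReal * ((k z.1 z.2).toReal * f z.2) := by
    have hnn : (0 : α × β → ℝ) ≤ fun z => (p z.1).toReal * (k z.1 z.2).toReal := fun z =>
      mul_nonneg ENNReal.toReal_nonneg ENNReal.toReal_nonneg
    have hs1 : Summable fun z : α × β => (p z.1).toReal * (k z.1 z.2).toReal := by
      have hk : ∀ a, HasSum (fun b => (p a).toReal * (k a b).toReal) (p a).toReal := fun a => by
        simpa only [mul_one] using (hasSum_toReal (k a)).mul_left (p a).toReal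
      rw [summable_prod_of_nonneg hnn]
      refine ⟨fun a => (hk a).summable, ?_⟩
      simp_rw [(hk _).tsum_eq]
      exact (hasSum_toReal p).summable
    refine Summable.of_norm_bounded (hs1.mul_right C) fun z => ?_
    rw [← mul_assoc, Real.norm_eq_abs, abs_mul, abs_of_nonneg (hnn z)]
    exact mul_le_mul_of_nonneg_left (hf z.2) (hnn z)
  have h1 : expect (p.bind k) f
      = ∑' b, ∑' a, (p a).toReal * ((k a b).toReal * f b) := by
    refine tsum_congr fun b => ?_
    rw [PMF.bind_apply, ENNReal.tsum_toReal_eq, ← tsum_mul_right]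
    · refine tsum_congr fun a => ?_
      rw [ENNReal.toReal_mul, mul_assoc]
    · exact fun a => ENNReal.mul_ne_top (p.apply_ne_top a) ((k a).apply_ne_top b)
  have h2 : (expect p fun a => expect (k a) f)
      = ∑' a, ∑' b, (p a).toReal * ((k a b).toReal * f b) :=
    tsum_congr fun a => by rw [tsum_mul_left]; rfl
  rw [h1, h2]
  exact Summable.tsum_comm (f := fun a b => (p a).toReal * ((k a b).toReal * f b)) hs

lemma expect_map (p : PMF α) (g : α → β) {f : β → ℝ} {C : ℝ} (hf : ∀ b, |f b| ≤ C) :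
    expect (p.map g) f = expect p fun a => f (g a) := by
  rw [← PMF.bind_pure_comp, expect_bind _ _ hf]
  simp only [Function.comp, expect_pure]

lemma expect_mul_const (p : PMF α) (f : α → ℝ) (c : ℝ) :
    (expect p fun a => f a * c) = expect p f * c := by
  unfold expect
  rw [← tsum_mul_right]
  exact tsum_congr fun a => by ring

lemma expect_const_mul (p : PMF α) (f : α → ℝ) (c : ℝ) :
    (expect p fun a => c * f a) = c * expect p f := by
  simp_rw [mul_comm c]
  exact expect_mul_const p f c

lemma expect_add (p : PMF α) {f g : α → ℝ} {C D : ℝ} (hf : ∀ a, |f a| ≤ C) (hg : ∀ a, |g a| ≤ D) :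
    (expect p fun a => f a + g a) = expect p f + expect p g := by
  unfold expect
  rw [← (summable_expect p hf).tsum_add (summable_expect p hg)]
  exact tsum_congr fun a => by ring

lemma expect_sub (p : PMF α) {f g : α → ℝ} {C D : ℝ} (hf : ∀ a, |f a| ≤ C) (hg : ∀ a, |g a| ≤ D) :
    (expect p fun a => f a - g a) = expect p f - expect p g := by
  unfold expect
  rw [← (summable_expect p hf).tsum_sub (summable_expect p hg)]
  exact tsum_congr fun a => by ring

lemma expect_sum {ι : Type} (p : PMF α) (s : Finset ι) (f : ι → α → ℝ) (C : ι → ℝ)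
    (hf : ∀ i a, |f i a| ≤ C i) :
    (expect p fun a => ∑ i ∈ s, f i a) = ∑ i ∈ s, expect p (f i) := by
  unfold expect
  rw [← Summable.tsum_finsetSum fun i _ => summable_expect p (hf i)]
  exact tsum_congr fun a => Finset.mul_sum _ _ _

lemma expect_congr (p : PMF α) {f g : α → ℝ} (h : ∀ a ∈ p.support, f a = g a) :
    expect p f = expect p g := by
  refine tsum_congr fun a => ?_
  by_cases ha : a ∈ p.support
  · rw [h a ha]
  · rw [PMF.mem_support_iff, not_not] at ha
    simp [ha]

lemma expect_fintype [Fintype α] (p : PMF α) (f : α → ℝ) :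
    expect p f = ∑ a, (p a).toReal * f a := tsum_fintype _

lemma expect_indicator [DecidableEq α] (p : PMF α) (b : α) :
    (expect p fun a => if a = b then 1 else 0) = (p b).toReal := by
  unfold expect
  rw [tsum_eq_single b]
  · simp
  · intro a ha
    simp [ha]

/-- Expanding a product of sums over the coordinates gives exactly the sum over all outcomes. -/
lemma expect_indep_prod {ι : Type} [Fintype ι] [DecidableEq ι] [Fintype α] (p : ι → PMF α)
    (f : ι → α → ℝ) :
    (expect (indep p) fun a => ∏ i, f i (a i)) = ∏ i, expect (p i) (f i) := by
  simp_rw [expect_fintype]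
  rw [Finset.prod_univ_sum, Fintype.piFinset_univ]
  refine Finset.sum_congr rfl fun a _ => ?_
  rw [Finset.prod_mul_distrib]
  congr 1
  simp [indep, PMF.ofFintype_apply, ENNReal.toReal_prod]

lemma expect_indep_apply {ι : Type} [Fintype ι] [DecidableEq ι] [Fintype α] (p : ι → PMF α)
    (i : ι) (f : α → ℝ) : (expect (indep p) fun a => f (a i)) = expect (p i) f := by
  have h := expect_indep_prod p (fun j a => if j = i then f a else 1)
  rw [Finset.prod_eq_single i] at h
  · simp only [if_true] at h
    rw [← h]
    refine expect_congr _ fun a _ => ?_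
    rw [Finset.prod_eq_single i]
    · simp
    · intro j _ hj
      simp [hj]
    · simp
  · intro j _ hj
    simp only [hj, if_false]
    exact expect_const _ _
  · simp

lemma expect_coin (q : unitInterval) (f : Bool → ℝ) :
    expect (coin q) f = q * f true + (1 - q) * f false := by
  rw [expect_fintype, Fintype.sum_bool]
  simp [coin, PMF.ofFintype_apply, ENNReal.toReal_ofReal, q.2.1, q.2.2]

lemma expect_coins_prod {n : ℕ} (q : unitInterval) (f : Fin n → Bool → ℝ) :
    (expect (coins n q) fun a => ∏ i, f i (a i)) = ∏ i, (q * f i true + (1 - q) * f i false) := by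
  simp_rw [← expect_coin]
  exact expect_indep_prod _ _

lemma expect_coins_apply {n : ℕ} (q : unitInterval) (i : Fin n) (f : Bool → ℝ) :
    (expect (coins n q) fun a => f (a i)) = q * f true + (1 - q) * f false := by
  rw [← expect_coin]
  exact expect_indep_apply _ _ _

end Expect

/-! ### The progress made in one slot -/

section Protocol

variable {n m : ℕ}

/-- Node `i` transmits and the channel is clear at node `j`. -/
def ChannelClear (P : Params) (x : Fin n → Plane) (y : Fin m → Plane) (a : Fin n → Bool)
    (b : Fin m → Bool) (i j : Fin n) : Prop :=
  a i = true ∧ (∀ k, k ≠ i → dist (x k) (x j) ≤ P.RI → a k = false) ∧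
    ∀ k, (b k = true ∧ ∀ l, a l = true → P.RD < dist (x l) (y k)) → P.RIsp < dist (y k) (x j)

lemma delivers_iff (P : Params) (x : Fin n → Plane) (y : Fin m → Plane) (a : Fin n → Bool)
    (b : Fin m → Bool) (r : Fin n → Option (Fin n)) (i j : Fin n) :
    Delivers P x y ⟨a, b, r⟩ i j ↔ ChannelClear P x y a b i j ∧ r i = some j := by
  unfold Delivers ChannelClear SecondaryTransmits
  tauto

open Classical in
/-- The probability that node `i` transmits over a channel that is clear at node `j`. -/
def hopSuccess (P : Params) (x : Fin n → Plane) (y : Fin m → Plane) (i j : Fin n) : ℝ :=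
  expect (coins n P.qp) fun a => expect (coins m P.qs) fun b =>
    if ChannelClear P x y a b i j then 1 else 0

/-- The mean progress, in one slot, of a packet at node `i` with destination `d`. -/
def hopProgress (P : Params) (x : Fin n → Plane) (y : Fin m → Plane) (i d : Fin n) : ℝ :=
  ∑ j, (pick (nextHops P x i d) (some j)).toReal * progress x i j d * hopSuccess P x y i j

open Classical in
lemma abs_ite_one_le (p : Prop) [Decidable p] : |(if p then (1 : ℝ) else 0)| ≤ 1 := by
  split_ifs <;> simp

lemma ite_and_mul (p q : Prop) [Decidable p] [Decidable q] [Decidable (p ∧ q)] :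
    (if p ∧ q then (1 : ℝ) else 0) = (if p then 1 else 0) * (if q then 1 else 0) := by
  split_ifs <;> simp_all

lemma expect_slotLaw (P : Params) (x : Fin n → Plane) (Q : Queues n) {f : Slot n m → ℝ} {C : ℝ}
    (hf : ∀ s, |f s| ≤ C) :
    expect (slotLaw P x m Q) f = expect (coins n P.qp) fun a => expect (coins m P.qs) fun b =>
      expect (indep (relayLaw P x Q)) fun r => f ⟨a, b, r⟩ := by
  unfold slotLaw
  rw [expect_bind _ _ hf]
  congr 1; ext a
  rw [expect_bind _ _ hf]
  congr 1; ext b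
  rw [expect_map _ _ hf]

open Classical in
-- Whether the channel is clear depends on the coins only, and the relay of `i` is drawn
-- independently of them, so the probability factorises.
lemma expect_delivers (P : Params) (x : Fin n → Plane) (y : Fin m → Plane) (Q : Queues n)
    (i j : Fin n) :
    (expect (slotLaw P x m Q) fun s => if Delivers P x y s i j then 1 else 0) =
      hopSuccess P x y i j * (relayLaw P x Q i (some j)).toReal := by
  rw [expect_slotLaw _ _ _ fun s => abs_ite_one_le _]
  unfold hopSuccess
  rw [← expect_mul_const]
  congr 1; ext a
  rw [← expect_mul_const]
  congr 1; ext b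
  simp_rw [delivers_iff, ite_and_mul]
  rw [expect_const_mul]
  congr 1
  rw [expect_indep_apply (relayLaw P x Q) i fun o => if o = some j then (1 : ℝ) else 0]
  exact expect_indicator _ _

open Classical in
lemma expect_totalProgress (P : Params) (x : Fin n → Plane) (y : Fin m → Plane) (Q : Queues n) :
    (expect (slotLaw P x m Q) fun s => totalProgress P x y Q s) =
      ∑ i, ∑ d, (if (Q i).head? = some d then 1 else 0) * hopProgress P x y i d := by
  have key : ∀ s : Slot n m, totalProgress P x y Q s = ∑ i, ∑ d, ∑ j,
      (if Delivers P x y s i j then 1 else 0) *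
        ((if (Q i).head? = some d then 1 else 0) * progress x i j d) := by
    intro s
    unfold totalProgress
    refine Finset.sum_congr rfl fun i _ => ?_
    rw [Finset.sum_comm]
    refine Finset.sum_congr rfl fun d _ => Finset.sum_congr rfl fun j _ => ?_
    split_ifs <;> simp_all
  have hb : ∀ i d j (s : Slot n m), |(if Delivers P x y s i j then (1 : ℝ) else 0) *
      ((if (Q i).head? = some d then 1 else 0) * progress x i j d)| ≤ |progress x i j d| := by
    intro i d j s
    split_ifs <;> simp
  simp_rw [key]
  rw [expect_sum _ _ _ (fun i => ∑ d, ∑ j, |progress x i j d|)]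
  swap
  · exact fun i s => (Finset.abs_sum_le_sum_abs _ _).trans (Finset.sum_le_sum fun d _ =>
      (Finset.abs_sum_le_sum_abs _ _).trans (Finset.sum_le_sum fun j _ => hb i d j s))
  refine Finset.sum_congr rfl fun i _ => ?_
  rw [expect_sum _ _ _ (fun d => ∑ j, |progress x i j d|)]
  swap
  · exact fun d s => (Finset.abs_sum_le_sum_abs _ _).trans (Finset.sum_le_sum fun j _ => hb i d j s)
  refine Finset.sum_congr rfl fun d _ => ?_
  rw [expect_sum _ _ _ (fun j => |progress x i j d|) (hb i d)]
  unfold hopProgress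
  rw [Finset.mul_sum]
  refine Finset.sum_congr rfl fun j _ => ?_
  rw [expect_mul_const, expect_delivers]
  split_ifs with h
  · have : relayLaw P x Q i = pick (nextHops P x i d) := by
      unfold relayLaw
      rw [h]
    rw [this]
    ring
  · ring

lemma totalProgress_bounded (P : Params) (x : Fin n → Plane) (y : Fin m → Plane)
    (z : Queues n × Slot n m) :
    |totalProgress P x y z.1 z.2| ≤ ∑ i, ∑ j, ∑ d, |progress x i j d| := by
  classical
  unfold totalProgress
  refine (Finset.abs_sum_le_sum_abs _ _).trans (Finset.sum_le_sum fun i _ =>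
    (Finset.abs_sum_le_sum_abs _ _).trans (Finset.sum_le_sum fun j _ =>
    (Finset.abs_sum_le_sum_abs _ _).trans (Finset.sum_le_sum fun d _ => ?_)))
  split_ifs <;> simp

open Classical in
/-- The mean progress of the packets at the heads of the queues `Q`. -/
def queueProgress (P : Params) (x : Fin n → Plane) (y : Fin m → Plane) (Q : Queues n) : ℝ :=
  ∑ i, ∑ d, (if (Q i).head? = some d then 1 else 0) * hopProgress P x y i d

/-- Coins and relays of the current slot are averaged out, so the past enters only through the heads
of the queues. -/
lemma meanProgress_eq (P : Params) (x : Fin n → Plane) (y : Fin m → Plane) (t : ℕ) :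
    meanProgress P x y t = expect (destinationLaw n) fun own =>
      expect (queueLaw P x y own t) fun Q => queueProgress P x y Q := by
  classical
  unfold meanProgress
  rw [expect_bind _ _ (totalProgress_bounded P x y)]
  congr 1; ext own
  rw [expect_bind _ _ (totalProgress_bounded P x y)]
  congr 1; ext Q
  rw [expect_map _ _ (totalProgress_bounded P x y), expect_totalProgress]
  rfl

/-! ### Bounds for one hop -/

lemma hopSuccess_nonneg (P : Params) (x : Fin n → Plane) (y : Fin m → Plane) (i j : Fin n) :
    0 ≤ hopSuccess P x y i j :=
  expect_nonneg _ fun a => expect_nonneg _ fun b => by split_ifs <;> simp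

/-- A success requires the coin of the sender. -/
lemma hopSuccess_le (P : Params) (x : Fin n → Plane) (y : Fin m → Plane) (i j : Fin n) :
    hopSuccess P x y i j ≤ P.qp := by
  classical
  have h := expect_coins_apply P.qp i fun b => if b then (1 : ℝ) else 0
  simp only [if_true, mul_one, Bool.false_eq_true, if_false, mul_zero, add_zero] at h
  rw [← h]
  refine expect_mono _ (fun a => abs_expect_le _ fun b => abs_ite_one_le _)
    (fun a => abs_ite_one_le _) fun a _ => ?_
  split_ifs with ha
  · exact (le_abs_self _).trans (abs_expect_le _ fun b => abs_ite_one_le _)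
  · refine le_of_eq ((expect_congr _ fun b _ => ?_).trans (expect_const _ 0))
    rw [if_neg fun hc => ha hc.1]

lemma pick_toReal {α : Type} [DecidableEq α] (s : Finset α) (a : α) :
    (pick s (some a)).toReal = if a ∈ s then (s.card : ℝ)⁻¹ else 0 := by
  unfold pick
  split_ifs with hs ha ha
  · have := (PMF.toOuterMeasure_map_apply some (PMF.uniformOfFinset s hs) {some a})
    rw [PMF.toOuterMeasure_apply_singleton] at this
    rw [this]
    have h2 : (some ⁻¹' {some a} : Set α) = {a} := by ext; simp
    rw [h2, PMF.toOuterMeasure_apply_singleton, PMF.uniformOfFinset_apply_of_mem _ ha]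
    simp
  · have := (PMF.toOuterMeasure_map_apply some (PMF.uniformOfFinset s hs) {some a})
    rw [PMF.toOuterMeasure_apply_singleton] at this
    rw [this]
    have h2 : (some ⁻¹' {some a} : Set α) = {a} := by ext; simp
    rw [h2, PMF.toOuterMeasure_apply_singleton, PMF.uniformOfFinset_apply_of_notMem _ ha]
    simp
  · exact absurd ⟨a, ha⟩ hs
  · simp

lemma sum_pick_le_one {α : Type} [Fintype α] (s : Finset α) :
    ∑ a, (pick s (some a)).toReal ≤ 1 := by
  have h := (hasSum_toReal (pick s)).tsum_eq
  rw [tsum_fintype, Fintype.sum_option] at h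
  linarith [ENNReal.toReal_nonneg (a := pick s none)]

lemma abs_progress_le (x : Fin n → Plane) (i j d : Fin n) :
    |progress x i j d| ≤ dist (x j) (x i) := by
  rw [dist_comm]
  exact abs_dist_sub_le _ _ _

lemma dist_le_of_mem_nextHops {P : Params} {x : Fin n → Plane} {i d j : Fin n}
    (h : j ∈ nextHops P x i d) : dist (x j) (x i) ≤ P.Rr := by
  unfold nextHops at h
  split_ifs at h with hd
  · rw [Finset.mem_singleton] at h
    rw [h, dist_comm]
    exact hd
  · exact (Finset.mem_filter.1 h).2.2.1

/-- A hop has length at most `Rr`, which bounds the progress by the triangle inequality; success has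
probability at most `qp`, and the routing weights sum to at most one. -/
lemma abs_hopProgress_le (P : Params) (x : Fin n → Plane) (y : Fin m → Plane) (i d : Fin n)
    (hR : 0 ≤ P.Rr) : |hopProgress P x y i d| ≤ P.qp * P.Rr := by
  classical
  unfold hopProgress
  have hq : (0 : ℝ) ≤ P.qp * P.Rr := mul_nonneg P.qp.2.1 hR
  calc |∑ j, (pick (nextHops P x i d) (some j)).toReal * progress x i j d * hopSuccess P x y i j|
      ≤ ∑ j, (pick (nextHops P x i d) (some j)).toReal * (P.qp * P.Rr) := by
        refine (Finset.abs_sum_le_sum_abs _ _).trans (Finset.sum_le_sum fun j _ => ?_)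
        rw [mul_assoc, abs_mul, abs_of_nonneg ENNReal.toReal_nonneg]
        by_cases hj : j ∈ nextHops P x i d
        · refine mul_le_mul_of_nonneg_left ?_ ENNReal.toReal_nonneg
          rw [abs_mul, mul_comm, abs_of_nonneg (hopSuccess_nonneg P x y i j)]
          exact mul_le_mul (hopSuccess_le P x y i j)
            ((abs_progress_le x i j d).trans (dist_le_of_mem_nextHops hj)) (abs_nonneg _) P.qp.2.1
        · rw [pick_toReal, if_neg hj, zero_mul, zero_mul]
    _ ≤ 1 * (P.qp * P.Rr) := by
        rw [← Finset.sum_mul]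
        exact mul_le_mul_of_nonneg_right (sum_pick_le_one _) hq
    _ = _ := one_mul _

lemma abs_queueProgress_le' (P : Params) (x : Fin n → Plane) (y : Fin m → Plane) (Q : Queues n)
    (hR : 0 ≤ P.Rr) : |queueProgress P x y Q| ≤ n * (P.qp * P.Rr) := by
  classical
  unfold queueProgress
  refine (Finset.abs_sum_le_sum_abs _ _).trans ?_
  have : ∀ i ∈ Finset.univ, |∑ d, (if (Q i).head? = some d then 1 else 0) * hopProgress P x y i d|
      ≤ P.qp * P.Rr := by
    intro i _
    rcases h : (Q i).head? with _ | d
    · simp [mul_nonneg P.qp.2.1 hR]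
    · simpa using abs_hopProgress_le P x y i d hR
  refine (Finset.sum_le_sum this).trans ?_
  simp

lemma abs_meanProgress_le (P : Params) (x : Fin n → Plane) (y : Fin m → Plane) (t : ℕ)
    (hR : 0 ≤ P.Rr) : |meanProgress P x y t| ≤ n * (P.qp * P.Rr) := by
  rw [meanProgress_eq]
  exact abs_expect_le _ fun own => abs_expect_le _ fun Q => abs_queueProgress_le' P x y Q hR

/-! ### The queues hardly change during a fixed number of slots -/

/-- An inactive node delivers nothing, and received packets join the end of its nonempty queue. -/
lemma head_nextQueues {P : Params} {x : Fin n → Plane} {y : Fin m → Plane}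
    {own : Fin n → Option (Fin n)} {Q : Queues n} {s : Slot n m} {i : Fin n}
    (hown : (own i).isSome) (hQ : (Q i).head? = own i) (hs : s.active i ≠ true) :
    (nextQueues P x y own Q s i).head? = own i := by
  have h1 : ¬∃ j, Delivers P x y s i j := fun ⟨j, hj⟩ => hs hj.1
  obtain ⟨d, hd⟩ := Option.isSome_iff_exists.1 hown
  rw [hd] at hQ ⊢
  obtain ⟨l, hl⟩ : ∃ l, Q i = d :: l := by
    cases hq : Q i with
    | nil => simp [hq] at hQ
    | cons a l => exact ⟨l, by simp_all⟩
  simp [nextQueues, if_neg h1, hl, refill]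

open Classical in
-- Union bound over the slots: the original head can be lost only in a slot in which node `i` is
-- active, and each slot adds at most `qp`.
lemma expect_head_ne_le (P : Params) (x : Fin n → Plane) (y : Fin m → Plane)
    (own : Fin n → Option (Fin n)) (hown : ∀ i, (own i).isSome) (i : Fin n) (t : ℕ) :
    (expect (queueLaw P x y own t) fun Q => if (Q i).head? = own i then 0 else 1) ≤ t * P.qp := by
  have hb : ∀ Q : Queues n, |(if (Q i).head? = own i then (0 : ℝ) else 1)| ≤ 1 := fun Q => by
    split_ifs <;> simp
  induction t with
  | zero =>
    obtain ⟨d, hd⟩ := Option.isSome_iff_exists.1 (hown i)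
    simp [queueLaw, expect_pure, refill, hd]
  | succ t ih =>
    rw [queueLaw, expect_bind _ _ hb]
    have hstep : ∀ Q : Queues n,
        (expect ((slotLaw P x m Q).map (nextQueues P x y own Q)) fun Q' =>
          if (Q' i).head? = own i then (0 : ℝ) else 1) ≤
        (if (Q i).head? = own i then 0 else 1) + P.qp := by
      intro Q
      rw [expect_map _ _ hb]
      have hact : (expect (slotLaw P x m Q) fun s => if s.active i = true then (1 : ℝ) else 0)
          = P.qp := by
        rw [expect_slotLaw _ _ _ fun s => abs_ite_one_le _]
        refine Eq.trans ?_ ((expect_coins_apply P.qp i fun b => if b = true then (1 : ℝ) else 0).trans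
          (by simp))
        congr 1; ext a
        by_cases h : a i = true <;> simp [h, expect_const]
      rw [← hact, ← expect_const (slotLaw P x m Q) (if (Q i).head? = own i then (0 : ℝ) else 1),
        ← expect_add _ (fun _ => hb Q) fun s => abs_ite_one_le _]
      refine expect_mono (C := 1) (D := 2) _ (fun s => hb _) (fun s => ?_) fun s _ => ?_
      · split_ifs <;> norm_num
      · by_cases hQ : (Q i).head? = own i
        · by_cases hs : s.active i = true
          · rw [if_pos hs]
            split_ifs <;> norm_num
          · rw [head_nextQueues (hown i) hQ hs]
            simp [hs, hQ]
        · rw [if_neg hQ]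
          split_ifs <;> norm_num
    have h2 : ∀ Q : Queues n, |(if (Q i).head? = own i then (0 : ℝ) else 1) + P.qp| ≤ 2 := by
      intro Q
      have := P.qp.2.1
      have := P.qp.2.2
      rw [abs_le]
      split_ifs <;> constructor <;> linarith
    refine (expect_mono _ (fun Q => abs_expect_le _ hb) h2 fun Q _ => hstep Q).trans ?_
    rw [expect_add (C := 1) (D := 1) _ hb fun _ => by
      rw [abs_le]; exact ⟨by linarith [P.qp.2.1], P.qp.2.2⟩, expect_const]
    push_cast
    linarith

/-- Treated separately because a node without other nodes has no destination and hence an empty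
queue. -/
lemma meanProgress_of_subsingleton (P : Params) (x : Fin n → Plane) (y : Fin m → Plane) (t : ℕ)
    (hn : n ≤ 1) : meanProgress P x y t = 0 := by
  have : Subsingleton (Fin n) := Fin.subsingleton_iff_le_one.2 hn
  have hp : ∀ i j d, progress x i j d = 0 := fun i j d => by
    rw [progress, Subsingleton.elim i j, sub_self]
  rw [meanProgress_eq]
  simp only [queueProgress, hopProgress, hp]
  simp [expect_const]

lemma isSome_of_mem_support_destinationLaw (hn : 2 ≤ n) {own : Fin n → Option (Fin n)}
    (h : own ∈ (destinationLaw n).support) (i : Fin n) : (own i).isSome := by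
  rw [PMF.mem_support_iff] at h
  simp only [destinationLaw, indep, PMF.ofFintype_apply, ne_eq, Finset.prod_eq_zero_iff,
    Finset.mem_univ, true_and, not_exists] at h
  by_contra hi
  rw [Option.not_isSome_iff_eq_none] at hi
  apply h i
  have hne : (Finset.univ.erase i).Nonempty := by
    rw [← Finset.card_pos, Finset.card_erase_of_mem (Finset.mem_univ i), Finset.card_univ,
      Fintype.card_fin]
    omega
  rw [hi, pick, dif_pos hne]
  simp [PMF.map_apply]

/-- A node whose head has changed alters the progress by at most `2 qp Rr`, and on average at most
`n t qp` nodes are of this kind. The bound has one factor `qp` more than the progress itself, so it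
is negligible for fixed `t`. -/
lemma abs_meanProgress_sub_le (P : Params) (x : Fin n → Plane) (y : Fin m → Plane) (t : ℕ)
    (hR : 0 ≤ P.Rr) :
    |meanProgress P x y t - meanProgress P x y 0| ≤ n * (2 * (P.qp * P.Rr) * (t * P.qp)) := by
  classical
  have hq : (0 : ℝ) ≤ P.qp * P.Rr := mul_nonneg P.qp.2.1 hR
  rcases le_or_gt n 1 with hn | hn
  · rw [meanProgress_of_subsingleton _ _ _ _ hn, meanProgress_of_subsingleton _ _ _ _ hn]
    have := P.qp.2.1
    simp only [sub_self, abs_zero]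
    positivity
  have hB := abs_queueProgress_le' (m := m) P x y (hR := hR)
  rw [meanProgress_eq, meanProgress_eq,
    ← expect_sub _ (fun own => abs_expect_le _ hB) fun own => abs_expect_le _ hB,
    ← abs_of_nonneg (show (0 : ℝ) ≤ n * (2 * (P.qp * P.Rr) * (t * P.qp)) by
      have := P.qp.2.1
      positivity)]
  have hgoal : ∀ own ∈ (destinationLaw n).support,
      |expect (queueLaw P x y own t) (fun Q => queueProgress P x y Q) -
        expect (queueLaw P x y own 0) (fun Q => queueProgress P x y Q)| ≤
        n * (2 * (P.qp * P.Rr) * (t * P.qp)) := by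
    intro own hown
    have hsome := isSome_of_mem_support_destinationLaw hn hown
    set Q₀ : Queues n := fun i => refill (own i) []
    have hhead : ∀ i, (Q₀ i).head? = own i := fun i => by
      obtain ⟨d, hd⟩ := Option.isSome_iff_exists.1 (hsome i)
      simp [Q₀, refill, hd]
    rw [queueLaw.eq_1, expect_pure,
      ← expect_const (queueLaw P x y own t) (queueProgress P x y Q₀),
      ← expect_sub _ hB fun _ => hB Q₀]
    -- Nodes with an unchanged head cancel; for the others both terms are at most `qp Rr` in
    -- absolute value.
    have hpt : ∀ Q : Queues n, |queueProgress P x y Q - queueProgress P x y Q₀| ≤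
        ∑ i, (if (Q i).head? = own i then 0 else 1) * (2 * (P.qp * P.Rr)) := by
      intro Q
      unfold queueProgress
      rw [← Finset.sum_sub_distrib]
      refine (Finset.abs_sum_le_sum_abs _ _).trans (Finset.sum_le_sum fun i _ => ?_)
      split_ifs with h
      · rw [hhead, h]
        simp
      · have hz : ∀ o : Option (Fin n),
            |∑ d, (if o = some d then 1 else 0) * hopProgress P x y i d| ≤ P.qp * P.Rr := by
          intro o
          rcases o with _ | d
          · simpa using hq
          · simpa using abs_hopProgress_le P x y i d hR
        have h1 := abs_le.1 (hz (Q i).head?)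
        have h2 := abs_le.1 (hz (Q₀ i).head?)
        rw [abs_le]
        constructor <;> linarith [h1.1, h1.2, h2.1, h2.2]
    have hb : ∀ i (Q : Queues n), |(if (Q i).head? = own i then (0 : ℝ) else 1) *
        (2 * (P.qp * P.Rr))| ≤ 2 * (P.qp * P.Rr) := fun i Q => by
      split_ifs
      · simp only [zero_mul, abs_zero]; positivity
      · rw [one_mul, abs_of_nonneg (by positivity)]
    have hS : ∀ Q : Queues n, |∑ i, (if (Q i).head? = own i then (0 : ℝ) else 1) *
        (2 * (P.qp * P.Rr))| ≤ ∑ i : Fin n, 2 * (P.qp * P.Rr) := fun Q =>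
      (Finset.abs_sum_le_sum_abs _ _).trans (Finset.sum_le_sum fun i _ => hb i Q)
    have hE : (expect (queueLaw P x y own t) fun Q => ∑ i,
        (if (Q i).head? = own i then 0 else 1) * (2 * (P.qp * P.Rr))) ≤
        n * (2 * (P.qp * P.Rr) * (t * P.qp)) := by
      rw [expect_sum _ _ _ (fun _ => 2 * (P.qp * P.Rr)) hb]
      calc _ ≤ ∑ i : Fin n, (t : ℝ) * P.qp * (2 * (P.qp * P.Rr)) := by
            refine Finset.sum_le_sum fun i _ => ?_
            rw [expect_mul_const]
            exact mul_le_mul_of_nonneg_right (expect_head_ne_le P x y own hsome i t) (by positivity)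
        _ = _ := by
            rw [Finset.sum_const, Finset.card_univ, Fintype.card_fin, nsmul_eq_mul]
            ring
    have hD : ∀ Q : Queues n, |queueProgress P x y Q - queueProgress P x y Q₀| ≤
        ∑ i : Fin n, 2 * (P.qp * P.Rr) := fun Q => (hpt Q).trans ((le_abs_self _).trans (hS Q))
    rw [abs_le]
    constructor
    · refine (neg_le_neg hE).trans ?_
      rw [← neg_one_mul, ← expect_const_mul]
      refine expect_mono _ (C := ∑ i : Fin n, 2 * (P.qp * P.Rr)) (fun Q => ?_) hD fun Q _ => ?_
      · rw [neg_one_mul, abs_neg]; exact hS Q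
      · linarith [(abs_le.1 (hpt Q)).1]
    · exact (expect_mono _ hD hS fun Q _ => (abs_le.1 (hpt Q)).2).trans hE
  set K : ℝ := n * (2 * (P.qp * P.Rr) * (t * P.qp))
  have hK : 0 ≤ K := by
    have := P.qp.2.1
    positivity
  rw [abs_of_nonneg hK]
  have hD : ∀ own, |expect (queueLaw P x y own t) (fun Q => queueProgress P x y Q) -
      expect (queueLaw P x y own 0) (fun Q => queueProgress P x y Q)| ≤
      n * (P.qp * P.Rr) + n * (P.qp * P.Rr) := fun own =>
    (abs_sub _ _).trans (add_le_add (abs_expect_le _ hB) (abs_expect_le _ hB))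
  rw [abs_le]
  constructor
  · rw [← expect_const (destinationLaw n) (-K)]
    exact expect_mono _ (C := K) (fun _ => by rw [abs_neg, abs_of_nonneg hK]) hD
      fun own h => (abs_le.1 (hgoal own h)).1
  · rw [← expect_const (destinationLaw n) K]
    exact expect_mono _ hD (D := K) (fun _ => by rw [abs_of_nonneg hK])
      fun own h => (abs_le.1 (hgoal own h)).2

end Protocol

/-! ### Poisson point processes -/

section PoissonLaw

/-- The configuration of the nodes `x`. -/
abbrev toConfig (n : ℕ) : (Fin n → Plane) → Config := fun x => ⟨n, x⟩

lemma toConfig_injective (n : ℕ) : Function.Injective (toConfig n) :=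
  fun _ _ h => eq_of_heq (Sigma.mk.inj h).2

lemma measurableSet_config {s : Set Config} :
    MeasurableSet s ↔ ∀ n, MeasurableSet (toConfig n ⁻¹' s) := by
  rw [Sigma.instMeasurableSpace, MeasurableSpace.measurableSet_iInf]
  rfl

lemma measurable_toConfig (n : ℕ) : Measurable (toConfig n) :=
  fun _ hs => measurableSet_config.1 hs n

lemma measurableEmbedding_toConfig (n : ℕ) :
    MeasurableEmbedding (toConfig n) where
  injective := toConfig_injective n
  measurable := measurable_toConfig n
  measurableSet_image' := fun s hs => measurableSet_config.2 fun k => by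
    by_cases h : k = n
    · subst h
      rwa [Set.preimage_image_eq _ (toConfig_injective k)]
    · have : toConfig k ⁻¹' (toConfig n '' s) = ∅ := by
        ext x
        simp only [Set.mem_preimage, Set.mem_image, Set.mem_empty_iff_false, iff_false, not_exists]
        exact fun z hz => h (congrArg Sigma.fst hz.2).symm
      rw [this]
      exact MeasurableSet.empty

/-- A configuration space is a countable disjoint union over the number of nodes, so a preimage is a
countable union of images under measurable embeddings. -/
lemma measurable_prod_config {β γ : Type*} [MeasurableSpace β] [MeasurableSpace γ]
    {f : β × Config → γ} (hf : ∀ n, Measurable fun p : β × (Fin n → Plane) => f (p.1, ⟨n, p.2⟩)) :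
    Measurable f := by
  intro s hs
  have : f ⁻¹' s = ⋃ n, (Prod.map id (toConfig n)) ''
      ((fun p : β × (Fin n → Plane) => f (p.1, ⟨n, p.2⟩)) ⁻¹' s) := by
    ext ⟨b, n, x⟩
    simp only [Set.mem_preimage, Set.mem_iUnion, Set.mem_image, Prod.exists, Prod.map_apply, id]
    constructor
    · exact fun h => ⟨n, b, x, h, rfl⟩
    · rintro ⟨k, b', x', h, he⟩
      rw [← he]
      exact h
  rw [this]
  exact MeasurableSet.iUnion fun n =>
    (MeasurableEmbedding.id.prodMap (measurableEmbedding_toConfig n)).measurableSet_image.2 (hf n hs)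

lemma measurable_config {γ : Type*} [MeasurableSpace γ] {f : Config → γ}
    (hf : ∀ n, Measurable fun x : Fin n → Plane => f ⟨n, x⟩) : Measurable f :=
  fun _ hs => measurableSet_config.2 fun n => hf n hs

lemma measurable_config_prod_config {γ : Type*} [MeasurableSpace γ] {f : Config × Config → γ}
    (hf : ∀ n m, Measurable fun p : (Fin n → Plane) × (Fin m → Plane) => f (⟨n, p.1⟩, ⟨m, p.2⟩)) :
    Measurable f := by
  refine measurable_prod_config fun m => ?_
  have : Measurable fun p : (Fin m → Plane) × Config => f (p.2, ⟨m, p.1⟩) :=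
    measurable_prod_config fun n => (hf n m).comp measurable_swap
  exact this.comp measurable_swap

/-- The Poisson point process with intensity measure `r • ν`. -/
def poissonLaw (ν : Measure Plane) (r : ℝ≥0) : Measure Config :=
  (poissonMeasure r).bind fun n => (Measure.pi fun _ : Fin n => ν).map (toConfig n)

lemma poissonNodes_eq (A : Set Plane) (lam : ℝ) :
    poissonNodes A lam = poissonLaw (volume[|A]) (lam * volume.real A).toNNReal := rfl

variable (ν : Measure Plane) [IsProbabilityMeasure ν] (r : ℝ≥0)

instance : IsProbabilityMeasure (poissonLaw ν r) := by
  refine ⟨?_⟩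
  rw [poissonLaw, Measure.bind_apply MeasurableSet.univ (Measurable.of_discrete).aemeasurable]
  have : ∀ n : ℕ, ((Measure.pi fun _ : Fin n => ν).map (toConfig n))
      Set.univ = 1 := fun n => by
    rw [Measure.map_apply (measurable_toConfig n) MeasurableSet.univ]
    simp
  simp [this]

/-- The weights of the Poisson distribution. -/
def poissonWeight (r : ℝ≥0) (n : ℕ) : ℝ≥0∞ := ENNReal.ofReal (rexp (-r) * r ^ n / (n.factorial))

/-- This recursion characterises the Poisson weights and is the only property of them that the
Campbell-Mecke formula needs. -/
lemma poissonWeight_succ (n : ℕ) : poissonWeight r (n + 1) * (n + 1) = r * poissonWeight r n := by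
  unfold poissonWeight
  have h1 : ((n : ℝ≥0∞) + 1) = ENNReal.ofReal (n + 1) := by
    rw [ENNReal.ofReal_add (by positivity) (by positivity)]
    simp
  have h2 : (r : ℝ≥0∞) = ENNReal.ofReal r := by simp
  rw [h1, h2, ← ENNReal.ofReal_mul (by positivity), ← ENNReal.ofReal_mul (by positivity)]
  congr 1
  rw [Nat.factorial_succ]
  push_cast
  field_simp
  ring

lemma lintegral_poissonLaw (ν : Measure Plane) (r : ℝ≥0) {f : Config → ℝ≥0∞} (hf : Measurable f) :
    ∫⁻ c, f c ∂poissonLaw ν r =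
      ∑' n, poissonWeight r n * ∫⁻ x, f ⟨n, x⟩ ∂(Measure.pi fun _ : Fin n => ν) := by
  rw [poissonLaw, Measure.lintegral_bind (Measurable.of_discrete).aemeasurable hf.aemeasurable,
    poissonMeasure, lintegral_sum_measure]
  refine tsum_congr fun n => ?_
  rw [lintegral_smul_measure, lintegral_dirac, lintegral_map hf (measurable_toConfig n)]
  rfl

/-- The sum, over the points of a configuration, of a function of the point and the other points. -/
def palmSum (F : Plane → Config → ℝ≥0∞) : Config → ℝ≥0∞
  | ⟨0, _⟩ => 0
  | ⟨n + 1, x⟩ => ∑ i, F (x i) ⟨n, i.removeNth x⟩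

lemma measurable_palmSum {β : Type*} [MeasurableSpace β] {F : β → Plane → Config → ℝ≥0∞}
    (hF : Measurable fun p : (β × Plane) × Config => F p.1.1 p.1.2 p.2) :
    Measurable fun p : β × Config => palmSum (F p.1) p.2 := by
  refine measurable_prod_config fun n => ?_
  rcases n with _ | n
  · exact measurable_const
  · refine Finset.measurable_sum _ fun i _ => ?_
    have h : Measurable fun p : β × (Fin (n + 1) → Plane) =>
        (((p.1, p.2 i), ⟨n, i.removeNth p.2⟩) : (β × Plane) × Config) := by
      refine Measurable.prodMk (measurable_fst.prodMk ((measurable_pi_apply i).comp measurable_snd))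
        ((measurable_toConfig n).comp ?_)
      exact measurable_pi_lambda _ fun k => (measurable_pi_apply _).comp measurable_snd
    exact hF.comp h

lemma measurable_palmSum' {F : Plane → Config → ℝ≥0∞}
    (hF : Measurable fun p : Plane × Config => F p.1 p.2) : Measurable (palmSum F) := by
  have := measurable_palmSum (β := Unit) (F := fun _ => F)
    (hF.comp ((measurable_snd.comp measurable_fst).prodMk measurable_snd))
  exact this.comp (measurable_const.prodMk measurable_id : Measurable fun c : Config => ((), c))

/-- The Campbell-Mecke formula. -/
lemma lintegral_palmSum {F : Plane → Config → ℝ≥0∞}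
    (hF : Measurable fun p : Plane × Config => F p.1 p.2) :
    ∫⁻ c, palmSum F c ∂poissonLaw ν r = r * ∫⁻ c, ∫⁻ z, F z c ∂ν ∂poissonLaw ν r := by
  rw [lintegral_poissonLaw _ _ (measurable_palmSum' hF),
    lintegral_poissonLaw ν r (f := fun c => ∫⁻ z, F z c ∂ν) hF.lintegral_prod_left',
    tsum_eq_zero_add' ENNReal.summable]
  simp only [palmSum, lintegral_zero, mul_zero, zero_add]
  rw [← ENNReal.tsum_mul_left]
  refine tsum_congr fun n => ?_
  have hm : ∀ i : Fin (n + 1), Measurable fun x : Fin (n + 1) → Plane =>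
      F (x i) ⟨n, i.removeNth x⟩ := fun i => by
    have h : Measurable fun x : Fin (n + 1) → Plane =>
        ((x i, toConfig n (i.removeNth x)) : Plane × Config) :=
      (measurable_pi_apply i).prodMk ((measurable_toConfig n).comp
        (measurable_pi_lambda _ fun k => measurable_pi_apply _))
    exact hF.comp h
  -- Given their number the points are independent and identically distributed, so each of the `n +
  -- 1` points contributes the same.
  have hi : ∀ i : Fin (n + 1), ∫⁻ x, F (x i) ⟨n, i.removeNth x⟩ ∂(Measure.pi fun _ => ν) =
      ∫⁻ x, ∫⁻ z, F z ⟨n, x⟩ ∂ν ∂(Measure.pi fun _ : Fin n => ν) := by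
    intro i
    have hmn : Measurable fun p : Plane × (Fin n → Plane) => F p.1 ⟨n, p.2⟩ :=
      hF.comp (measurable_fst.prodMk ((measurable_toConfig n).comp measurable_snd))
    have h := (measurePreserving_piFinSuccAbove (fun _ : Fin (n + 1) => ν) i).lintegral_comp hmn
    rw [lintegral_prod_symm' _ hmn] at h
    exact h
  rw [lintegral_finsetSum _ fun i _ => hm i]
  simp_rw [hi]
  rw [Finset.sum_const, Finset.card_univ, Fintype.card_fin, nsmul_eq_mul, ← mul_assoc, ← mul_assoc]
  congr 1
  have := poissonWeight_succ r n
  push_cast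
  exact this

/-- The Campbell-Mecke formula for pairs of points. -/
lemma lintegral_palmSum₂ {F : Plane → Plane → Config → ℝ≥0∞}
    (hF : Measurable fun p : (Plane × Plane) × Config => F p.1.1 p.1.2 p.2) :
    ∫⁻ c, palmSum (fun u => palmSum (F u)) c ∂poissonLaw ν r =
      r ^ 2 * ∫⁻ u, ∫⁻ v, ∫⁻ c, F u v c ∂poissonLaw ν r ∂ν ∂ν := by
  have h1 := measurable_palmSum hF
  rw [lintegral_palmSum _ _ h1, lintegral_lintegral_swap (f := fun c z => palmSum (F z) c)
    (h1.comp measurable_swap).aemeasurable]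
  have h2 : ∀ u, ∫⁻ c, palmSum (F u) c ∂poissonLaw ν r =
      r * ∫⁻ v, ∫⁻ c, F u v c ∂poissonLaw ν r ∂ν := by
    intro u
    have hu : Measurable fun p : Plane × Config => F u p.1 p.2 :=
      hF.comp (((measurable_const (a := u)).prodMk measurable_fst).prodMk measurable_snd)
    rw [lintegral_palmSum _ _ hu, lintegral_lintegral_swap (f := fun c z => F u z c)
      (hu.comp measurable_swap).aemeasurable]
  simp_rw [h2]
  rw [lintegral_const_mul' _ _ ENNReal.coe_ne_top, ← mul_assoc, sq]

/-- The Campbell-Mecke formula for triples of points. -/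
lemma lintegral_palmSum₃ {F : Plane → Plane → Plane → Config → ℝ≥0∞}
    (hF : Measurable fun p : ((Plane × Plane) × Plane) × Config => F p.1.1.1 p.1.1.2 p.1.2 p.2) :
    ∫⁻ c, palmSum (fun u => palmSum fun v => palmSum (F u v)) c ∂poissonLaw ν r =
      r ^ 3 * ∫⁻ u, ∫⁻ v, ∫⁻ w, ∫⁻ c, F u v w c ∂poissonLaw ν r ∂ν ∂ν ∂ν := by
  have h1 : Measurable fun p : (Plane × Plane) × Config => palmSum (F p.1.1 p.1.2) p.2 :=
    measurable_palmSum (F := fun b : Plane × Plane => F b.1 b.2) hF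
  rw [lintegral_palmSum₂ _ _ h1]
  have h2 : ∀ u v, ∫⁻ c, palmSum (F u v) c ∂poissonLaw ν r =
      r * ∫⁻ w, ∫⁻ c, F u v w c ∂poissonLaw ν r ∂ν := by
    intro u v
    have hu : Measurable fun p : Plane × Config => F u v p.1 p.2 :=
      hF.comp (((measurable_const (a := (u, v))).prodMk measurable_fst).prodMk measurable_snd)
    rw [lintegral_palmSum _ _ hu, lintegral_lintegral_swap (f := fun c z => F u v z c)
      (hu.comp measurable_swap).aemeasurable]
  simp_rw [h2, lintegral_const_mul' _ _ ENNReal.coe_ne_top]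
  rw [← mul_assoc]
  congr 1

/-- The product of a function over the points of a configuration. -/
def configProd (h : Plane → ℝ) (c : Config) : ℝ := ∏ k, h (c.2 k)

lemma measurable_configProd {β : Type*} [MeasurableSpace β] {h : β → Plane → ℝ}
    (hh : Measurable fun p : β × Plane => h p.1 p.2) :
    Measurable fun p : β × Config => configProd (h p.1) p.2 := by
  refine measurable_prod_config fun n => ?_
  change Measurable fun p : β × (Fin n → Plane) => ∏ i, h p.1 (p.2 i)
  refine Finset.measurable_prod _ fun i _ => ?_
  exact hh.comp (measurable_fst.prodMk ((measurable_pi_apply i).comp measurable_snd))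

lemma measurable_configProd' {h : Plane → ℝ} (hh : Measurable h) : Measurable (configProd h) :=
  measurable_config fun n => by
    change Measurable fun x : Fin n → Plane => ∏ i, h (x i)
    exact Finset.measurable_prod _ fun i _ => hh.comp (measurable_pi_apply i)

lemma configProd_nonneg {h : Plane → ℝ} (h0 : ∀ z, 0 ≤ h z) (c : Config) : 0 ≤ configProd h c :=
  Finset.prod_nonneg fun _ _ => h0 _

lemma configProd_le_one {h : Plane → ℝ} (h0 : ∀ z, 0 ≤ h z) (h1 : ∀ z, h z ≤ 1) (c : Config) :
    configProd h c ≤ 1 := Finset.prod_le_one (fun _ _ => h0 _) fun _ _ => h1 _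

/-- The generating functional of a Poisson point process. -/
lemma integral_configProd {h : Plane → ℝ} (hm : Measurable h) (h0 : ∀ z, 0 ≤ h z)
    (h1 : ∀ z, h z ≤ 1) :
    ∫ c, configProd h c ∂poissonLaw ν r = rexp (r * (∫ z, h z ∂ν - 1)) := by
  rw [integral_eq_lintegral_of_nonneg_ae (.of_forall fun c => configProd_nonneg h0 c)
    (measurable_configProd' hm).aestronglyMeasurable,
    lintegral_poissonLaw _ _ (measurable_configProd' hm).ennreal_ofReal]
  have hI : 0 ≤ ∫ z, h z ∂ν := integral_nonneg h0
  have hn : ∀ n : ℕ, poissonWeight r n * ∫⁻ x, ENNReal.ofReal (configProd h ⟨n, x⟩)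
      ∂(Measure.pi fun _ : Fin n => ν) =
      ENNReal.ofReal (rexp (-r) * ((r * ∫ z, h z ∂ν) ^ n / n.factorial)) := by
    intro n
    have hint : Integrable (fun x : Fin n → Plane => ∏ i, h (x i)) (Measure.pi fun _ => ν) :=
      Integrable.fintype_prod fun _ => (Integrable.of_bound hm.aestronglyMeasurable 1
        (.of_forall fun z => by rw [Real.norm_of_nonneg (h0 z)]; exact h1 z))
    unfold configProd
    rw [← ofReal_integral_eq_lintegral_ofReal hint
      (.of_forall fun x => Finset.prod_nonneg fun i _ => h0 _),
      integral_fintype_prod_eq_prod (fun _ => h), poissonWeight,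
      ← ENNReal.ofReal_mul (by positivity)]
    congr 1
    rw [Finset.prod_const, Finset.card_univ, Fintype.card_fin, mul_pow]
    ring
  simp_rw [hn]
  -- Summation over the number of points yields an exponential series.
  have hs := (NormedSpace.expSeries_div_hasSum_exp ((r : ℝ) * ∫ z, h z ∂ν)).mul_left (rexp (-r))
  rw [← ENNReal.ofReal_tsum_of_nonneg (fun n => by positivity) hs.summable, hs.tsum_eq,
    ← Real.exp_eq_exp_ℝ, ← Real.exp_add, ENNReal.toReal_ofReal (by positivity)]
  congr 1
  ring

/-- The number of points of a configuration in the set `s`. -/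
def configCount (s : Set Plane) (c : Config) : ℝ := ∑ k, s.indicator 1 (c.2 k)

lemma indicator_one_nonneg (s : Set Plane) (z : Plane) : 0 ≤ s.indicator (1 : Plane → ℝ) z :=
  Set.indicator_nonneg (fun _ _ => zero_le_one) z

lemma configCount_nonneg (s : Set Plane) (c : Config) : 0 ≤ configCount s c :=
  Finset.sum_nonneg fun _ _ => indicator_one_nonneg s _

lemma measurable_configCount {β : Type*} [MeasurableSpace β] {s : β → Set Plane}
    (hs : MeasurableSet {p : β × Plane | p.2 ∈ s p.1}) :
    Measurable fun p : β × Config => configCount (s p.1) p.2 := by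
  refine measurable_prod_config fun n => ?_
  change Measurable fun p : β × (Fin n → Plane) => ∑ i, (s p.1).indicator 1 (p.2 i)
  refine Finset.measurable_sum _ fun i _ => ?_
  have h : Measurable fun p : β × Plane => (s p.1).indicator (1 : Plane → ℝ) p.2 := by
    have h1 : (fun p : β × Plane => (s p.1).indicator (1 : Plane → ℝ) p.2) =
        {p : β × Plane | p.2 ∈ s p.1}.indicator 1 := by
      ext p
      simp [Set.indicator]
    rw [h1]
    exact measurable_one.indicator hs
  exact h.comp (measurable_fst.prodMk ((measurable_pi_apply i).comp measurable_snd))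

lemma measurable_configCount' {s : Set Plane} (hs : MeasurableSet s) :
    Measurable (configCount s) :=
  (measurable_configCount (β := Unit) (s := fun _ => s) (measurable_snd hs)).comp
    (measurable_const.prodMk measurable_id : Measurable fun c : Config => ((), c))

lemma configCount_succ (s : Set Plane) {n : ℕ} (x : Fin (n + 1) → Plane) (i : Fin (n + 1)) :
    configCount s ⟨n + 1, x⟩ = s.indicator 1 (x i) + configCount s ⟨n, i.removeNth x⟩ := by
  simp only [configCount, Fin.sum_univ_succAbove _ i, Fin.removeNth_apply]

lemma lintegral_configCount {s : Set Plane} (hs : MeasurableSet s) :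
    ∫⁻ c, ENNReal.ofReal (configCount s c) ∂poissonLaw ν r = r * ν s := by
  have h : ∀ c, ENNReal.ofReal (configCount s c) =
      palmSum (fun z _ => s.indicator 1 z) c := by
    rintro ⟨_ | n, x⟩
    · simp [configCount, palmSum]
    · unfold configCount palmSum
      rw [ENNReal.ofReal_sum_of_nonneg fun _ _ => indicator_one_nonneg s _]
      refine Finset.sum_congr rfl fun i _ => ?_
      by_cases hi : x i ∈ s <;> simp [hi]
  simp_rw [h]
  rw [lintegral_palmSum _ _ ((measurable_one.indicator hs).comp measurable_fst)]
  simp [lintegral_indicator_one hs]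

/-- The square of the count is the sum, over the points in `s`, of one plus the count of the other
points; the Campbell-Mecke formula then gives the second moment from the first. -/
lemma lintegral_configCount_sq {s : Set Plane} (hs : MeasurableSet s) :
    ∫⁻ c, ENNReal.ofReal (configCount s c ^ 2) ∂poissonLaw ν r =
      r * ν s * (1 + r * ν s) := by
  have h : ∀ c, ENNReal.ofReal (configCount s c ^ 2) =
      palmSum (fun z c => s.indicator 1 z * ENNReal.ofReal (1 + configCount s c)) c := by
    rintro ⟨_ | n, x⟩
    · simp [configCount, palmSum]
    · have h1 : configCount s ⟨n + 1, x⟩ ^ 2 =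
          ∑ i, s.indicator 1 (x i) * configCount s ⟨n + 1, x⟩ := by
        rw [← Finset.sum_mul, sq]
        rfl
      rw [h1, ENNReal.ofReal_sum_of_nonneg fun _ _ =>
        mul_nonneg (indicator_one_nonneg s _) (configCount_nonneg s _)]
      unfold palmSum
      refine Finset.sum_congr rfl fun i _ => ?_
      rw [configCount_succ s x i]
      by_cases hi : x i ∈ s <;> simp [hi]
  simp_rw [h]
  have hm := measurable_configCount' hs
  have h1 : Measurable (s.indicator (1 : Plane → ℝ≥0∞)) := measurable_one.indicator hs
  rw [lintegral_palmSum _ _ ((h1.comp measurable_fst).mul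
    ((measurable_const.add hm).ennreal_ofReal.comp measurable_snd))]
  have h2 : ∀ c : Config, ∫⁻ z, s.indicator 1 z * ENNReal.ofReal (1 + configCount s c) ∂ν =
      ν s * ENNReal.ofReal (1 + configCount s c) := fun c => by
    rw [lintegral_mul_const _ h1, lintegral_indicator_one hs]
  simp_rw [h2, ENNReal.ofReal_add zero_le_one (configCount_nonneg s _)]
  have h3 : Measurable fun c => ENNReal.ofReal 1 + ENNReal.ofReal (configCount s c) :=
    measurable_const.add hm.ennreal_ofReal
  rw [lintegral_const_mul _ h3, lintegral_add_left measurable_const, lintegral_configCount _ _ hs]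
  simp [mul_assoc]

/-- Turns a second moment into a bound for a first absolute moment, with a free parameter `e`;
choosing `e` optimally has the effect of the Cauchy-Schwarz inequality. -/
lemma abs_le_add_sq_div {e : ℝ} (he : 0 < e) (t : ℝ) : |t| ≤ e / 2 + t ^ 2 / (2 * e) := by
  have h : e / 2 + t ^ 2 / (2 * e) - |t| = (e - |t|) ^ 2 / (2 * e) := by
    rw [sub_sq, sq_abs]
    field_simp
    ring
  have : 0 ≤ (e - |t|) ^ 2 / (2 * e) := by positivity
  linarith

/-- The law of large numbers for the number of points in a set. -/
lemma lintegral_configCount_div_sub_one {s : Set Plane} (hs : MeasurableSet s) {h : ℝ} (hpos : 0 < h)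
    (hh : r * ν.real s = h) :
    ∫⁻ c, ENNReal.ofReal |configCount s c / h - 1| ∂poissonLaw ν r ≤
      ENNReal.ofReal (1 / √h) := by
  have hm := measurable_configCount' hs
  have hE : (r : ℝ≥0∞) * ν s = ENNReal.ofReal h := by
    rw [← hh, ENNReal.ofReal_mul (by positivity)]
    simp
  have hE1 := lintegral_configCount ν r hs
  have hE2 := lintegral_configCount_sq ν r hs
  rw [hE] at hE1
  rw [hE, ← ENNReal.ofReal_one, ← ENNReal.ofReal_add zero_le_one hpos.le,
    ← ENNReal.ofReal_mul hpos.le] at hE2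
  have hi1 : Integrable (configCount s) (poissonLaw ν r) := by
    refine ⟨hm.aestronglyMeasurable, ?_⟩
    rw [hasFiniteIntegral_iff_ofReal (.of_forall (configCount_nonneg s)), hE1]
    exact ENNReal.ofReal_lt_top
  have hi2 : Integrable (fun c => configCount s c ^ 2) (poissonLaw ν r) := by
    refine ⟨(hm.pow_const 2).aestronglyMeasurable, ?_⟩
    rw [hasFiniteIntegral_iff_ofReal (.of_forall fun c => sq_nonneg _), hE2]
    exact ENNReal.ofReal_lt_top
  have hv1 : ∫ c, configCount s c ∂poissonLaw ν r = h := by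
    rw [integral_eq_lintegral_of_nonneg_ae (.of_forall (configCount_nonneg s))
      hm.aestronglyMeasurable, hE1, ENNReal.toReal_ofReal hpos.le]
  have hv2 : ∫ c, configCount s c ^ 2 ∂poissonLaw ν r = h * (1 + h) := by
    rw [integral_eq_lintegral_of_nonneg_ae (.of_forall fun c => sq_nonneg _)
      (hm.pow_const 2).aestronglyMeasurable, hE2, ENNReal.toReal_ofReal (by positivity)]
  have hsq : 0 < √h := Real.sqrt_pos.2 hpos
  -- `e` is the standard deviation of `configCount s / h`; with this choice `e / 2 + e² / (2 e) =
  -- e`.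
  set e : ℝ := 1 / √h with he
  have hepos : 0 < e := by positivity
  have he2 : e ^ 2 = 1 / h := by rw [he, div_pow, Real.sq_sqrt hpos.le, one_pow]
  have hexp : ∀ c, e / 2 + (configCount s c / h - 1) ^ 2 / (2 * e) =
      (e / 2 + 1 / (2 * e)) + (configCount s c ^ 2 * (1 / (h ^ 2 * (2 * e))) -
        configCount s c * (2 / (h * (2 * e)))) := by
    intro c
    field_simp
    ring
  have hint : Integrable (fun c => e / 2 + (configCount s c / h - 1) ^ 2 / (2 * e))
      (poissonLaw ν r) := by
    simp_rw [hexp]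
    exact (integrable_const _).add ((hi2.mul_const _).sub (hi1.mul_const _))
  calc ∫⁻ c, ENNReal.ofReal |configCount s c / h - 1| ∂poissonLaw ν r
      ≤ ∫⁻ c, ENNReal.ofReal (e / 2 + (configCount s c / h - 1) ^ 2 / (2 * e))
          ∂poissonLaw ν r :=
        lintegral_mono fun c => ENNReal.ofReal_le_ofReal (abs_le_add_sq_div hepos _)
    _ = ENNReal.ofReal e := by
        rw [← ofReal_integral_eq_lintegral_ofReal hint (.of_forall fun c => by positivity)]
        congr 1
        simp_rw [hexp]
        have h4 : Integrable (fun c => configCount s c ^ 2 * (1 / (h ^ 2 * (2 * e))) -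
            configCount s c * (2 / (h * (2 * e)))) (poissonLaw ν r) :=
          (hi2.mul_const _).sub (hi1.mul_const _)
        rw [integral_add (integrable_const _) h4, integral_sub (hi2.mul_const _) (hi1.mul_const _), integral_mul_const, integral_mul_const,
          hv1, hv2]
        simp only [integral_const, probReal_univ, one_smul]
        have h3 : h = 1 / e ^ 2 := by rw [he2]; simp
        rw [h3]
        field_simp
        ring

/-- A crude substitute for the law of large numbers near the boundary, where the half-disk may leave
the region and `h` only bounds the mean. -/
lemma lintegral_configCount_div_sub_one_le {s : Set Plane} (hs : MeasurableSet s) {h : ℝ}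
    (hpos : 0 < h) (hh : r * ν.real s ≤ h) :
    ∫⁻ c, ENNReal.ofReal |configCount s c / h - 1| ∂poissonLaw ν r ≤ 2 := by
  have hm := measurable_configCount' hs
  calc ∫⁻ c, ENNReal.ofReal |configCount s c / h - 1| ∂poissonLaw ν r
      ≤ ∫⁻ c, (ENNReal.ofReal (configCount s c) * ENNReal.ofReal (1 / h) + 1)
          ∂poissonLaw ν r := by
        refine lintegral_mono fun c => ?_
        have hc := configCount_nonneg s c
        rw [← ENNReal.ofReal_mul hc, ← ENNReal.ofReal_one, ← ENNReal.ofReal_add (by positivity)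
          zero_le_one]
        refine ENNReal.ofReal_le_ofReal ?_
        rw [mul_one_div]
        have : 0 ≤ configCount s c / h := by positivity
        rw [abs_le]
        constructor <;> linarith
    _ ≤ 1 + 1 := by
        rw [lintegral_add_right _ measurable_const, lintegral_mul_const _ hm.ennreal_ofReal,
          lintegral_configCount _ _ hs]
        gcongr
        · have : (r : ℝ≥0∞) * ν s = ENNReal.ofReal (r * ν.real s) := by
            rw [ENNReal.ofReal_mul (by positivity)]
            simp
          rw [this, ← ENNReal.ofReal_mul (by positivity), ← ENNReal.ofReal_one]
          refine ENNReal.ofReal_le_ofReal ?_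
          rw [mul_one_div, div_le_one hpos]
          exact hh
        · simp
    _ = 2 := one_add_one_eq_two

end PoissonLaw

/-! ### The law of the head packets and the measurability of the mean progress. -/

section MeanProgress

variable {n m : ℕ}

open Classical in
/-- The probability that the packet at the head of the queue of node `i` in slot `t` has
destination `d`. -/
def headLaw (P : Params) (x : Fin n → Plane) (y : Fin m → Plane) (t : ℕ) (i d : Fin n) : ℝ :=
  expect (destinationLaw n) fun own => expect (queueLaw P x y own t) fun Q =>
    if (Q i).head? = some d then 1 else 0

/-- Separates the law of the queues from the geometry of one hop. In slot `0` the first factor is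
explicit, and in general it depends on finitely many comparisons of distances. -/
lemma meanProgress_eq_sum (P : Params) (x : Fin n → Plane) (y : Fin m → Plane) (t : ℕ) :
    meanProgress P x y t = ∑ i, ∑ d, headLaw P x y t i d * hopProgress P x y i d := by
  classical
  rw [meanProgress_eq]
  have hb : ∀ i d (Q : Queues n), |(if (Q i).head? = some d then 1 else 0) * hopProgress P x y i d| ≤
      |hopProgress P x y i d| := by
    intro i d Q
    split_ifs <;> simp
  have hE : ∀ own, expect (queueLaw P x y own t) (fun Q => queueProgress P x y Q) =
      ∑ i, ∑ d, (expect (queueLaw P x y own t) fun Q => if (Q i).head? = some d then 1 else 0) *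
        hopProgress P x y i d := by
    intro own
    unfold queueProgress
    rw [expect_sum _ _ _ (fun i => ∑ d, |hopProgress P x y i d|) fun i Q =>
      (Finset.abs_sum_le_sum_abs _ _).trans (Finset.sum_le_sum fun d _ => hb i d Q)]
    refine Finset.sum_congr rfl fun i _ => ?_
    rw [expect_sum _ _ _ (fun d => |hopProgress P x y i d|) fun d Q => hb i d Q]
    exact Finset.sum_congr rfl fun d _ => expect_mul_const _ _ _
  simp_rw [hE]
  have hb' : ∀ i d own, |(expect (queueLaw P x y own t) fun Q =>
      if (Q i).head? = some d then (1 : ℝ) else 0) * hopProgress P x y i d| ≤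
      1 * |hopProgress P x y i d| := by
    intro i d own
    rw [abs_mul]
    exact mul_le_mul_of_nonneg_right (abs_expect_le _ fun Q => abs_ite_one_le _) (abs_nonneg _)
  rw [expect_sum _ _ _ (fun i => ∑ d, 1 * |hopProgress P x y i d|) fun i own =>
    (Finset.abs_sum_le_sum_abs _ _).trans (Finset.sum_le_sum fun d _ => hb' i d own)]
  refine Finset.sum_congr rfl fun i _ => ?_
  rw [expect_sum _ _ _ (fun d => 1 * |hopProgress P x y i d|) fun d own => hb' i d own]
  exact Finset.sum_congr rfl fun d _ => expect_mul_const _ _ _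

lemma headLaw_zero (P : Params) (x : Fin n → Plane) (y : Fin m → Plane) (i d : Fin n) :
    headLaw P x y 0 i d = if d = i then 0 else ((n : ℝ) - 1)⁻¹ := by
  classical
  unfold headLaw
  have h : ∀ own : Fin n → Option (Fin n), (expect (queueLaw P x y own 0) fun Q =>
      if (Q i).head? = some d then (1 : ℝ) else 0) = if own i = some d then 1 else 0 := by
    intro own
    rw [queueLaw, expect_pure]
    have : (refill (own i) []).head? = own i := by
      cases own i <;> simp [refill]
    rw [this]
  simp_rw [h]
  unfold destinationLaw
  rw [expect_indep_apply _ i fun o => if o = some d then (1 : ℝ) else 0, expect_indicator,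
    pick_toReal]
  have hn : 1 ≤ n := i.pos
  simp [Finset.card_erase_of_mem, Nat.cast_sub hn]

/-! ### Measurability -/

/-- The comparisons of distances on which the protocols depend. -/
def pattern (P : Params) (z : (Fin n → Plane) × (Fin m → Plane)) :
    (Fin n → Fin n → Prop) × (Fin n → Fin n → Fin n → Prop) × (Fin n → Fin n → Prop) ×
      (Fin n → Fin m → Prop) × (Fin n → Fin m → Prop) :=
  (fun i j => dist (z.1 i) (z.1 j) ≤ P.Rr,
    fun i j d => 0 ≤ inner ℝ (z.1 j - z.1 i) (z.1 d - z.1 i),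
    fun i j => dist (z.1 i) (z.1 j) ≤ P.RI,
    fun i k => P.RD < dist (z.1 i) (z.2 k),
    fun i k => P.RIsp < dist (z.2 k) (z.1 i))

lemma measurable_pattern (P : Params) :
    Measurable (pattern P : (Fin n → Plane) × (Fin m → Plane) → _) := by
  have h1 : ∀ i, Measurable fun z : (Fin n → Plane) × (Fin m → Plane) => z.1 i := fun i =>
    (measurable_pi_apply i).comp measurable_fst
  have h2 : ∀ k, Measurable fun z : (Fin n → Plane) × (Fin m → Plane) => z.2 k := fun k =>
    (measurable_pi_apply k).comp measurable_snd
  refine Measurable.prodMk ?_ (Measurable.prodMk ?_ (Measurable.prodMk ?_ (Measurable.prodMk ?_ ?_)))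
  · exact measurable_pi_lambda _ fun i => measurable_pi_lambda _ fun j =>
      measurableSet_setOfPred.1 (measurableSet_le ((h1 i).dist (h1 j)) measurable_const)
  · exact measurable_pi_lambda _ fun i => measurable_pi_lambda _ fun j => measurable_pi_lambda _
      fun d => measurableSet_setOfPred.1 (measurableSet_le measurable_const
        (((h1 j).sub (h1 i)).inner ((h1 d).sub (h1 i))))
  · exact measurable_pi_lambda _ fun i => measurable_pi_lambda _ fun j =>
      measurableSet_setOfPred.1 (measurableSet_le ((h1 i).dist (h1 j)) measurable_const)
  · exact measurable_pi_lambda _ fun i => measurable_pi_lambda _ fun k =>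
      measurableSet_setOfPred.1 (measurableSet_lt measurable_const ((h1 i).dist (h2 k)))
  · exact measurable_pi_lambda _ fun i => measurable_pi_lambda _ fun k =>
      measurableSet_setOfPred.1 (measurableSet_lt measurable_const ((h2 k).dist (h1 i)))

/-- `pattern` takes values in a finite type in which all sets are measurable, so factoring through
it suffices and nothing need be known about `g`. -/
lemma measurable_of_pattern (P : Params) {g : (Fin n → Plane) × (Fin m → Plane) → ℝ}
    (hg : ∀ z z', pattern P z = pattern P z' → g z = g z') : Measurable g := by
  intro s _
  have : g ⁻¹' s = pattern P ⁻¹' (pattern P '' (g ⁻¹' s)) := by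
    ext z
    refine ⟨fun h => ⟨z, h, rfl⟩, ?_⟩
    rintro ⟨z', hz', he⟩
    rw [Set.mem_preimage, ← hg z' z he]
    exact hz'
  rw [this]
  exact measurable_pattern P (Set.Finite.measurableSet (Set.toFinite _))

section Pattern

variable {P : Params} {z z' : (Fin n → Plane) × (Fin m → Plane)}

lemma nextHops_of_pattern (h : pattern P z = pattern P z') : nextHops P z.1 = nextHops P z'.1 := by
  have h1 : ∀ i j, (dist (z.1 i) (z.1 j) ≤ P.Rr) = (dist (z'.1 i) (z'.1 j) ≤ P.Rr) := fun i j =>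
    congrFun (congrFun (congrArg Prod.fst h) i) j
  have h2 : ∀ i j d, (0 ≤ inner ℝ (z.1 j - z.1 i) (z.1 d - z.1 i)) =
      (0 ≤ inner ℝ (z'.1 j - z'.1 i) (z'.1 d - z'.1 i)) := fun i j d =>
    congrFun (congrFun (congrFun (congrArg (fun p => p.2.1) h) i) j) d
  ext i d
  unfold nextHops
  simp_rw [h1, h2]

lemma channelClear_of_pattern (h : pattern P z = pattern P z') :
    ChannelClear P z.1 z.2 = ChannelClear P z'.1 z'.2 := by
  have h1 : ∀ i j, (dist (z.1 i) (z.1 j) ≤ P.RI) = (dist (z'.1 i) (z'.1 j) ≤ P.RI) := fun i j =>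
    congrFun (congrFun (congrArg (fun p => p.2.2.1) h) i) j
  have h2 : ∀ i k, (P.RD < dist (z.1 i) (z.2 k)) = (P.RD < dist (z'.1 i) (z'.2 k)) := fun i j =>
    congrFun (congrFun (congrArg (fun p => p.2.2.2.1) h) i) j
  have h3 : ∀ i k, (P.RIsp < dist (z.2 k) (z.1 i)) = (P.RIsp < dist (z'.2 k) (z'.1 i)) :=
    fun i j => congrFun (congrFun (congrArg (fun p => p.2.2.2.2) h) i) j
  ext a b i j
  unfold ChannelClear
  simp_rw [h1, h2, h3]

/-- Routing, interference and sensing consult the locations only through the recorded comparisons;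
induction on the slot carries this over to the queues. -/
lemma queueLaw_of_pattern (h : pattern P z = pattern P z')
    (own : Fin n → Option (Fin n)) (t : ℕ) :
    queueLaw P z.1 z.2 own t = queueLaw P z'.1 z'.2 own t := by
  have h1 : relayLaw P z.1 = relayLaw P z'.1 := by
    ext Q i
    unfold relayLaw
    rw [nextHops_of_pattern h]
  have h2 : Delivers P z.1 z.2 = Delivers P z'.1 z'.2 := by
    funext s i j
    rcases s with ⟨a, b, r⟩
    rw [delivers_iff, delivers_iff, channelClear_of_pattern h]
  have h3 : ∀ Q : Queues n, slotLaw P z.1 m Q = slotLaw P z'.1 m Q := by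
    intro Q
    unfold slotLaw
    rw [h1]
  have h4 : nextQueues P z.1 z.2 own = nextQueues P z'.1 z'.2 own := by
    funext Q s j
    unfold nextQueues
    rw [h2]
  induction t with
  | zero => rfl
  | succ t ih =>
    rw [queueLaw, queueLaw, ih, h4]
    simp_rw [h3]

end Pattern

/-- The only ingredient that is not a function of `pattern` is `progress`, which is a difference of
distances. -/
lemma measurable_meanProgress (P : Params) (t : ℕ) :
    Measurable fun z : (Fin n → Plane) × (Fin m → Plane) => meanProgress P z.1 z.2 t := by
  classical
  simp_rw [meanProgress_eq_sum]
  refine Finset.measurable_sum _ fun i _ => Finset.measurable_sum _ fun d _ => Measurable.mul ?_ ?_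
  · refine measurable_of_pattern P fun z z' h => ?_
    unfold headLaw
    simp_rw [queueLaw_of_pattern h]
  · unfold hopProgress
    refine Finset.measurable_sum _ fun j _ => Measurable.mul (Measurable.mul ?_ ?_) ?_
    · refine measurable_of_pattern P fun z z' h => ?_
      rw [nextHops_of_pattern h]
    · have h1 : ∀ i, Measurable fun z : (Fin n → Plane) × (Fin m → Plane) => z.1 i := fun i =>
        (measurable_pi_apply i).comp measurable_fst
      exact ((h1 i).dist (h1 d)).sub ((h1 j).dist (h1 d))
    · refine measurable_of_pattern P fun z z' h => ?_
      unfold hopSuccess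
      simp_rw [channelClear_of_pattern h]

lemma measurable_meanProgress_config (P : Params) (t : ℕ) :
    Measurable fun c : Config × Config => meanProgress P c.1.2 c.2.2 t :=
  measurable_config_prod_config fun _ _ => measurable_meanProgress P t

end MeanProgress

/-! ### The mean over the secondary nodes -/

section Secondary

variable {n m : ℕ}

/-- The points at which no transmitter is detected. -/
def uncovered (RD : ℝ) (x : Fin n → Plane) (a : Fin n → Bool) : Set Plane :=
  {z | ∀ l, a l = true → RD < dist (x l) z}

lemma measurableSet_uncovered (RD : ℝ) (x : Fin n → Plane) (a : Fin n → Bool) :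
    MeasurableSet (uncovered RD x a) := by
  have : uncovered RD x a = ⋂ l, ⋂ (_ : a l = true), {z | RD < dist (x l) z} := by
    ext z
    simp [uncovered]
  rw [this]
  exact MeasurableSet.iInter fun l => MeasurableSet.iInter fun _ =>
    measurableSet_lt measurable_const (measurable_const.dist measurable_id)

/-- Node `i` is the only transmitter that could interfere with node `j`. -/
def PrimaryClear (P : Params) (x : Fin n → Plane) (i j : Fin n) (a : Fin n → Bool) : Prop :=
  a i = true ∧ ∀ k, k ≠ i → dist (x k) (x j) ≤ P.RI → a k = false

open Classical in
/-- The probability of a successful transmission from node `i` to node `j` in the presence of a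
Poisson process of secondary nodes of which `kap` per unit area would transmit over an idle
channel. -/
def meanHopSuccess (P : Params) (A : Set Plane) (kap : ℝ) (x : Fin n → Plane) (i j : Fin n) : ℝ :=
  expect (coins n P.qp) fun a => if PrimaryClear P x i j a then
    rexp (-(kap * volume.real (uncovered P.RD x a ∩ Metric.closedBall (x j) P.RIsp ∩ A))) else 0

open Classical in
-- With the primary coins fixed, a secondary node spoils the reception exactly when its coin is on
-- and it lies in the uncovered part of the interference disk; the secondary coins are independent,
-- hence the product.
lemma hopSuccess_eq (P : Params) (x : Fin n → Plane) (y : Fin m → Plane) (i j : Fin n) :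
    hopSuccess P x y i j = expect (coins n P.qp) fun a => if PrimaryClear P x i j a then
      ∏ k, (1 - P.qs * (uncovered P.RD x a ∩ Metric.closedBall (x j) P.RIsp).indicator 1 (y k))
      else 0 := by
  unfold hopSuccess
  congr 1; ext a
  split_ifs with h
  · have h1 : ∀ b : Fin m → Bool, (if ChannelClear P x y a b i j then (1 : ℝ) else 0) =
        ∏ k, (if b k = true then
          1 - (uncovered P.RD x a ∩ Metric.closedBall (x j) P.RIsp).indicator 1 (y k) else 1) := by
      intro b
      have h2 : ChannelClear P x y a b i j ↔ ∀ k, ¬(b k = true ∧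
          y k ∈ uncovered P.RD x a ∩ Metric.closedBall (x j) P.RIsp) := by
        unfold ChannelClear
        unfold PrimaryClear at h
        refine (and_iff_right h.1).trans ((and_iff_right h.2).trans ?_)
        simp only [uncovered, Set.mem_inter_iff, Set.mem_ofPred_eq,
          Metric.mem_closedBall, not_and, not_le, and_imp]
      split_ifs with hc
      · refine (Finset.prod_eq_one fun k _ => ?_).symm
        have := h2.1 hc k
        split_ifs with hb
        · rw [Set.indicator_of_notMem fun hy => this ⟨hb, hy⟩, sub_zero]
        · rfl
      · rw [h2] at hc
        push Not at hc
        obtain ⟨k, hk, hy⟩ := hc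
        refine (Finset.prod_eq_zero (Finset.mem_univ k) ?_).symm
        rw [if_pos hk, Set.indicator_of_mem hy]
        simp
    simp_rw [h1]
    rw [expect_coins_prod P.qs fun k b => if b = true then
      1 - (uncovered P.RD x a ∩ Metric.closedBall (x j) P.RIsp).indicator 1 (y k) else 1]
    refine Finset.prod_congr rfl fun k _ => ?_
    simp only [if_true, Bool.false_eq_true, if_false]
    ring
  · refine (expect_congr _ fun b _ => ?_).trans (expect_const _ 0)
    exact if_neg fun hc => h ⟨hc.1, hc.2.1⟩

lemma meanHopSuccess_nonneg (P : Params) (A : Set Plane) (kap : ℝ) (x : Fin n → Plane)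
    (i j : Fin n) : 0 ≤ meanHopSuccess P A kap x i j :=
  expect_nonneg _ fun a => by split_ifs <;> positivity

lemma expect_active (q : unitInterval) (i : Fin n) :
    (expect (coins n q) fun a => if a i = true then (1 : ℝ) else 0) = q := by
  rw [expect_coins_apply q i fun b => if b = true then (1 : ℝ) else 0]
  simp

lemma abs_exp_neg_le {s : ℝ} (h : 0 ≤ s) : |rexp (-s)| ≤ 1 := by
  rw [abs_of_pos (exp_pos _)]
  exact Real.exp_le_one_iff.2 (by linarith)

lemma meanHopSuccess_le (P : Params) (A : Set Plane) {kap : ℝ} (hk : 0 ≤ kap) (x : Fin n → Plane)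
    (i j : Fin n) : meanHopSuccess P A kap x i j ≤ P.qp := by
  classical
  rw [← expect_active P.qp i]
  have h := fun a : Fin n → Bool => abs_exp_neg_le (mul_nonneg hk (measureReal_nonneg
    (μ := volume) (s := uncovered P.RD x a ∩ Metric.closedBall (x j) P.RIsp ∩ A)))
  refine expect_mono _ (C := 1) (fun a => ?_) (fun a => abs_ite_one_le _) fun a _ => ?_
  · split_ifs
    · exact h a
    · simp
  · by_cases hc : PrimaryClear P x i j a
    · rw [if_pos hc, if_pos hc.1]
      exact (le_abs_self _).trans (h a)
    · rw [if_neg hc]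
      split_ifs <;> simp

lemma real_cond_apply {A S : Set Plane} (hS : MeasurableSet S) :
    (volume[|A]).real S = (volume.real A)⁻¹ * volume.real (A ∩ S) := by
  simp only [measureReal_def, cond_apply' hS, ENNReal.toReal_mul, ENNReal.toReal_inv]

/-- The generating functional at `1 - q 1_S`: the probability that the process thinned with
probability `q` has no point in `S`. -/
lemma integral_poissonNodes_prod {A : Set Plane} (hA : volume A ≠ 0) (hA' : volume A ≠ ∞)
    {lam : ℝ} (hl : 0 ≤ lam) (q : unitInterval) {S : Set Plane} (hS : MeasurableSet S) :
    ∫ c, configProd (fun z => 1 - q * S.indicator 1 z) c ∂poissonNodes A lam =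
      rexp (-(lam * q * volume.real (S ∩ A))) := by
  have : IsProbabilityMeasure (volume[|A]) := cond_isProbabilityMeasure_of_finite hA hA'
  have hm : Measurable (S.indicator (1 : Plane → ℝ)) := measurable_one.indicator hS
  have hle : ∀ z, S.indicator (1 : Plane → ℝ) z ≤ 1 :=
    fun z => Set.indicator_le_self' (fun _ _ => zero_le_one) z
  have hi : Integrable (S.indicator (1 : Plane → ℝ)) (volume[|A]) :=
    (integrable_const (1 : ℝ)).indicator hS
  have hm' : Measurable fun z => 1 - q * S.indicator (1 : Plane → ℝ) z :=
    measurable_const.sub (hm.const_mul _)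
  rw [poissonNodes_eq, integral_configProd _ _ hm']
  · congr 1
    rw [integral_sub (integrable_const _) (hi.const_mul _), integral_const_mul,
      integral_indicator_one hS, Real.coe_toNNReal _ (by positivity), real_cond_apply hS]
    have hA0 : volume.real A ≠ 0 := (ENNReal.toReal_pos hA hA').ne'
    simp only [integral_const, probReal_univ, one_smul, Set.inter_comm A S]
    field_simp
    ring
  · intro z
    have := mul_le_mul q.2.2 (hle z) (indicator_one_nonneg S z) zero_le_one
    linarith
  · intro z
    have := mul_nonneg q.2.1 (indicator_one_nonneg S z)
    linarith

/-- The total progress of the packets at their sources when a hop from `i` to `j` succeeds with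
probability `T i j`. -/
def sourceProgress (P : Params) (x : Fin n → Plane) (T : Fin n → Fin n → ℝ) : ℝ :=
  ∑ i, ∑ d, (if d = i then 0 else ((n : ℝ) - 1)⁻¹) *
    ∑ j, (pick (nextHops P x i d) (some j)).toReal * progress x i j d * T i j

lemma meanProgress_zero (P : Params) (x : Fin n → Plane) (y : Fin m → Plane) :
    meanProgress P x y 0 = sourceProgress P x (hopSuccess P x y) := by
  rw [meanProgress_eq_sum]
  simp_rw [headLaw_zero]
  rfl

/-- The primary coins take finitely many values, so the mean over the secondary nodes can be taken
for each of them; it is then a void probability. -/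
lemma integral_hopSuccess {A : Set Plane} (hA : volume A ≠ 0) (hA' : volume A ≠ ∞) {lam : ℝ}
    (hl : 0 ≤ lam) (P : Params) (x : Fin n → Plane) (i j : Fin n) :
    Integrable (fun c : Config => hopSuccess P x c.2 i j) (poissonNodes A lam) ∧
    ∫ c, hopSuccess P x c.2 i j ∂poissonNodes A lam = meanHopSuccess P A (lam * P.qs) x i j := by
  classical
  have : IsProbabilityMeasure (volume[|A]) := cond_isProbabilityMeasure_of_finite hA hA'
  have hp : IsProbabilityMeasure (poissonNodes A lam) := by
    rw [poissonNodes_eq]; infer_instance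
  set S : (Fin n → Bool) → Set Plane := fun a =>
    uncovered P.RD x a ∩ Metric.closedBall (x j) P.RIsp
  have hS : ∀ a, MeasurableSet (S a) := fun a =>
    (measurableSet_uncovered _ _ _).inter Metric.isClosed_closedBall.measurableSet
  have hle : ∀ a z, (S a).indicator (1 : Plane → ℝ) z ≤ 1 :=
    fun a z => Set.indicator_le_self' (fun _ _ => zero_le_one) z
  have h01 : ∀ a z, 0 ≤ 1 - P.qs * (S a).indicator (1 : Plane → ℝ) z ∧
      1 - P.qs * (S a).indicator (1 : Plane → ℝ) z ≤ 1 := fun a z => by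
    have h1 := mul_le_mul P.qs.2.2 (hle a z) (indicator_one_nonneg (S a) z) zero_le_one
    have h2 := mul_nonneg P.qs.2.1 (indicator_one_nonneg (S a) z)
    constructor <;> linarith
  have hint : ∀ a, Integrable (configProd fun z => 1 - P.qs * (S a).indicator 1 z)
      (poissonNodes A lam) := fun a => by
    refine Integrable.of_bound (measurable_configProd' (measurable_const.sub
      ((measurable_one.indicator (hS a)).const_mul _))).aestronglyMeasurable 1 (.of_forall fun c => ?_)
    rw [Real.norm_of_nonneg (configProd_nonneg (fun z => (h01 a z).1) c)]
    exact configProd_le_one (fun z => (h01 a z).1) (fun z => (h01 a z).2) c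
  have heq : (fun c : Config => hopSuccess P x c.2 i j) = fun c => ∑ a, (coins n P.qp a).toReal *
      if PrimaryClear P x i j a then configProd (fun z => 1 - P.qs * (S a).indicator 1 z) c
        else 0 := by
    ext c
    rw [hopSuccess_eq, expect_fintype]
    rfl
  have hint' : ∀ a ∈ Finset.univ, Integrable (fun c => (coins n P.qp a).toReal *
      if PrimaryClear P x i j a then configProd (fun z => 1 - P.qs * (S a).indicator 1 z) c
        else 0) (poissonNodes A lam) := fun a _ => by
    refine Integrable.const_mul ?_ _
    split_ifs
    · exact hint a
    · exact integrable_zero _ _ _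
  rw [heq]
  refine ⟨integrable_finsetSum _ hint', ?_⟩
  rw [integral_finsetSum _ hint', meanHopSuccess, expect_fintype]
  refine Finset.sum_congr rfl fun a _ => ?_
  rw [integral_const_mul]
  congr 1
  split_ifs
  · exact integral_poissonNodes_prod hA hA' hl P.qs (hS a)
  · simp

/-- `sourceProgress` is linear in the success probabilities, and in slot `0` the other factors do
not involve the secondary nodes. -/
lemma integral_meanProgress_zero {A : Set Plane} (hA : volume A ≠ 0) (hA' : volume A ≠ ∞) {lam : ℝ}
    (hl : 0 ≤ lam) (P : Params) (x : Fin n → Plane) :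
    ∫ c : Config, meanProgress P x c.2 0 ∂poissonNodes A lam =
      sourceProgress P x (meanHopSuccess P A (lam * P.qs) x) := by
  simp_rw [meanProgress_zero]
  have h := integral_hopSuccess hA hA' hl P x
  unfold sourceProgress
  have h1 : ∀ i d, Integrable (fun c : Config => ∑ j, (pick (nextHops P x i d) (some j)).toReal *
      progress x i j d * hopSuccess P x c.2 i j) (poissonNodes A lam) := fun i d =>
    integrable_finsetSum _ fun j _ => (h i j).1.const_mul _
  rw [integral_finsetSum _ fun i _ => integrable_finsetSum _ fun d _ => (h1 i d).const_mul _]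
  refine Finset.sum_congr rfl fun i _ => ?_
  rw [integral_finsetSum _ fun d _ => (h1 i d).const_mul _]
  refine Finset.sum_congr rfl fun d _ => ?_
  rw [integral_const_mul, integral_finsetSum _ fun j _ => (h i j).1.const_mul _]
  congr 1
  refine Finset.sum_congr rfl fun j _ => ?_
  rw [integral_const_mul, (h i j).2]

end Secondary

/-! ### Concentration of the area in which secondary nodes transmit -/

section Concentration

variable {n : ℕ}

/-- The indicator of the event that a transmitter at `x` is not detected at `z`. -/
def undetected (RD : ℝ) (z x : Plane) : ℝ := if RD < dist x z then 1 else 0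

lemma undetected_nonneg (RD : ℝ) (z x : Plane) : 0 ≤ undetected RD z x := by
  unfold undetected
  split_ifs <;> simp

lemma undetected_le_one (RD : ℝ) (z x : Plane) : undetected RD z x ≤ 1 := by
  unfold undetected
  split_ifs <;> simp

lemma undetected_of_lt {RD : ℝ} {z x : Plane} (h : RD < dist x z) : undetected RD z x = 1 :=
  if_pos h

lemma measurable_undetected (RD : ℝ) :
    Measurable fun p : Plane × Plane => undetected RD p.1 p.2 :=
  Measurable.ite (measurableSet_lt measurable_const (measurable_snd.dist measurable_fst))
    measurable_const measurable_const

lemma indicator_uncovered (RD : ℝ) (x : Fin n → Plane) (a : Fin n → Bool) (z : Plane) :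
    (uncovered RD x a).indicator (1 : Plane → ℝ) z =
      ∏ l, if a l = true then undetected RD z (x l) else 1 := by
  classical
  by_cases h : z ∈ uncovered RD x a
  · rw [Set.indicator_of_mem h]
    refine (Finset.prod_eq_one fun l _ => ?_).symm
    split_ifs with hl
    · exact if_pos (h l hl)
    · rfl
  · rw [Set.indicator_of_notMem h]
    simp only [uncovered, Set.mem_ofPred_eq, not_forall] at h
    obtain ⟨l, hl, hd⟩ := h
    refine (Finset.prod_eq_zero (Finset.mem_univ l) ?_).symm
    rw [if_pos hl]
    exact if_neg hd

/-- The probability that no transmitter is detected at `z.1` and at `z.2`, if a node at `u`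
transmits and each node of `c` transmits with probability `q`. -/
def pairUncovered (q RD : ℝ) (z : Plane × Plane) (u : Plane) (c : Config) : ℝ :=
  undetected RD z.1 u * undetected RD z.2 u *
    configProd (fun x => 1 - q + q * (undetected RD z.1 x * undetected RD z.2 x)) c

/-- Both indicators are products over the transmitters. By independence of the coins, node `i`
contributes `q` times its own detection factor and every other node its averaged factor. -/
lemma expect_uncovered (q : unitInterval) (RD : ℝ) (x : Fin (n + 1) → Plane) (i : Fin (n + 1))
    (z : Plane × Plane) :
    (expect (coins (n + 1) q) fun a => (if a i = true then 1 else 0) *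
      ((uncovered RD x a).indicator 1 z.1 * (uncovered RD x a).indicator 1 z.2)) =
      q * pairUncovered q RD z (x i) ⟨n, i.removeNth x⟩ := by
  have h : ∀ a : Fin (n + 1) → Bool, (if a i = true then (1 : ℝ) else 0) *
      ((uncovered RD x a).indicator 1 z.1 * (uncovered RD x a).indicator 1 z.2) =
      ∏ l, (if l = i then (if a l = true then 1 else 0) else 1) *
        if a l = true then undetected RD z.1 (x l) * undetected RD z.2 (x l) else 1 := by
    intro a
    rw [Finset.prod_mul_distrib]
    congr 1
    · simp
    · rw [indicator_uncovered, indicator_uncovered, ← Finset.prod_mul_distrib]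
      exact Finset.prod_congr rfl fun l _ => by split_ifs <;> simp
  simp_rw [h]
  rw [expect_coins_prod q fun l b => (if l = i then (if b = true then 1 else 0) else 1) *
        if b = true then undetected RD z.1 (x l) * undetected RD z.2 (x l) else 1,
    Fin.prod_univ_succAbove _ i]
  simp only [if_true, Fin.succAbove_ne, if_false, Bool.false_eq_true, pairUncovered, configProd,
    Fin.removeNth_apply, one_mul, mul_one, mul_zero, add_zero]
  rw [mul_assoc]
  congr 2
  exact Finset.prod_congr rfl fun l _ => by ring

/-- The second moment about `p` times the area of the disk of the uncovered area in the disk of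
centre `w` and radius `R`. -/
def coverVariance (q RD p R : ℝ) (u w : Plane) (c : Config) : ℝ :=
  ∫ z, (pairUncovered q RD z u c - p * pairUncovered q RD (z.1, z.1) u c -
    p * pairUncovered q RD (z.2, z.2) u c + p ^ 2)
    ∂((volume.restrict (Metric.closedBall w R)).prod (volume.restrict (Metric.closedBall w R)))

/-- The squared deviation of an area is a double integral over pairs of points, so its mean is
determined by the probabilities that two points are uncovered together. The factor for `a i`
restricts to slots in which the sender transmits. -/
lemma expect_uncovered_area_sq (q : unitInterval) (RD p R : ℝ) (x : Fin (n + 1) → Plane)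
    (i : Fin (n + 1)) (w : Plane) :
    (expect (coins (n + 1) q) fun a => (if a i = true then 1 else 0) *
      (volume.real (uncovered RD x a ∩ Metric.closedBall w R) -
        p * volume.real (Metric.closedBall w R)) ^ 2) =
      q * coverVariance q RD p R (x i) w ⟨n, i.removeNth x⟩ := by
  set μ : Measure Plane := volume.restrict (Metric.closedBall w R) with hμ
  have hfin : IsFiniteMeasure μ := ⟨by
    rw [hμ, Measure.restrict_apply_univ]
    exact measure_closedBall_lt_top⟩
  have hmeas := fun a => measurableSet_uncovered RD x a
  have hm : ∀ a, Measurable ((uncovered RD x a).indicator (1 : Plane → ℝ)) := fun a =>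
    measurable_one.indicator (hmeas a)
  have hle : ∀ a z, (uncovered RD x a).indicator (1 : Plane → ℝ) z ≤ 1 :=
    fun a z => Set.indicator_le_self' (fun _ _ => zero_le_one) z
  have harea : ∀ a, volume.real (uncovered RD x a ∩ Metric.closedBall w R) -
      p * volume.real (Metric.closedBall w R) =
      ∫ z, ((uncovered RD x a).indicator 1 z - p) ∂μ := by
    intro a
    have hi : Integrable ((uncovered RD x a).indicator (1 : Plane → ℝ)) μ :=
      (integrable_const (1 : ℝ)).indicator (hmeas a)
    rw [integral_sub hi (integrable_const _),
      integral_indicator_one (hmeas a), integral_const, hμ,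
      measureReal_restrict_apply (hmeas a), measureReal_restrict_apply_univ, smul_eq_mul, mul_comm p]
  have hint : ∀ a ∈ Finset.univ, Integrable (fun z : Plane × Plane => (coins (n + 1) q a).toReal *
      ((if a i = true then 1 else 0) * (((uncovered RD x a).indicator 1 z.1 - p) *
        ((uncovered RD x a).indicator 1 z.2 - p)))) (μ.prod μ) := by
    intro a _
    refine ((Integrable.of_bound (C := (1 + |p|) * (1 + |p|)) ?_ (.of_forall fun z => ?_)).const_mul
      _).const_mul _
    · exact ((((hm a).comp measurable_fst).sub_const p).mul
        (((hm a).comp measurable_snd).sub_const p)).aestronglyMeasurable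
    · have hb : ∀ z, |(uncovered RD x a).indicator (1 : Plane → ℝ) z - p| ≤ 1 + |p| := fun z =>
        (abs_sub _ _).trans (add_le_add (by
          rw [abs_of_nonneg (indicator_one_nonneg _ _)]; exact hle a z) le_rfl)
      rw [norm_mul]
      exact mul_le_mul (hb _) (hb _) (abs_nonneg _) (by positivity)
  have hsq : ∀ a, (coins (n + 1) q a).toReal * ((if a i = true then 1 else 0) *
      (∫ z, ((uncovered RD x a).indicator 1 z - p) ∂μ) ^ 2) =
      ∫ z, (coins (n + 1) q a).toReal * ((if a i = true then 1 else 0) *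
        (((uncovered RD x a).indicator 1 z.1 - p) *
        ((uncovered RD x a).indicator 1 z.2 - p))) ∂(μ.prod μ) := by
    intro a
    rw [integral_const_mul, integral_const_mul, sq,
      integral_prod_mul (fun z => (uncovered RD x a).indicator 1 z - p)
        (fun z => (uncovered RD x a).indicator 1 z - p)]
  rw [expect_fintype]
  simp_rw [harea, hsq]
  rw [← integral_finsetSum _ hint, coverVariance, ← integral_const_mul, ← hμ]
  refine integral_congr_ae (.of_forall fun z => ?_)
  change _ = (q : ℝ) * _
  -- An indicator equals its square, so the linear terms are values of `pairUncovered` on the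
  -- diagonal.
  have hself : ∀ z', (uncovered RD x · |>.indicator (1 : Plane → ℝ) z') =
      fun a => (uncovered RD x a).indicator 1 z' * (uncovered RD x a).indicator 1 z' := by
    intro z'
    ext a
    by_cases h : z' ∈ uncovered RD x a <;> simp [h]
  have e1 := expect_uncovered q RD x i z
  have e2 := expect_uncovered q RD x i (z.1, z.1)
  have e3 := expect_uncovered q RD x i (z.2, z.2)
  have e4 := expect_active q i
  rw [expect_fintype] at e1 e2 e3 e4
  have : (q : ℝ) * (pairUncovered q RD z (x i) ⟨n, i.removeNth x⟩ -
      p * pairUncovered q RD (z.1, z.1) (x i) ⟨n, i.removeNth x⟩ -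
      p * pairUncovered q RD (z.2, z.2) (x i) ⟨n, i.removeNth x⟩ + p ^ 2) =
      q * pairUncovered q RD z (x i) ⟨n, i.removeNth x⟩ -
      p * (q * pairUncovered q RD (z.1, z.1) (x i) ⟨n, i.removeNth x⟩) -
      p * (q * pairUncovered q RD (z.2, z.2) (x i) ⟨n, i.removeNth x⟩) + q * p ^ 2 := by ring
  have e5 : (q : ℝ) * p ^ 2 = ∑ a, (coins (n + 1) q a).toReal *
      (if a i = true then 1 else 0) * p ^ 2 := by rw [← Finset.sum_mul, e4]
  rw [this, ← e1, ← e2, ← e3, e5, Finset.mul_sum, Finset.mul_sum, ← Finset.sum_sub_distrib,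
    ← Finset.sum_sub_distrib, ← Finset.sum_add_distrib]
  refine Finset.sum_congr rfl fun a _ => ?_
  have h1 := congrFun (hself z.1) a
  have h2 := congrFun (hself z.2) a
  simp only at h1 h2 ⊢
  rw [← h1, ← h2]
  ring

open Classical in
-- Without secondary nodes, success means that `i` is on and every other node in the disk about the
-- receiver is off. The receiver itself is one of the points of the product when `j ≠ i`.
lemma meanHopSuccess_zero (P : Params) (A : Set Plane) (x : Fin (n + 1) → Plane)
    (i j : Fin (n + 1)) : meanHopSuccess P A 0 x i j =
      P.qp * configProd (fun z => 1 - P.qp * (Metric.closedBall (x j) P.RI).indicator 1 z)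
        ⟨n, i.removeNth x⟩ := by
  unfold meanHopSuccess
  have h : ∀ a : Fin (n + 1) → Bool, (if PrimaryClear P x i j a then
      rexp (-(0 * volume.real (uncovered P.RD x a ∩ Metric.closedBall (x j) P.RIsp ∩ A))) else 0) =
      ∏ l, if l = i then (if a l = true then (1 : ℝ) else 0) else
        if a l = true then 1 - (Metric.closedBall (x j) P.RI).indicator 1 (x l) else 1 := by
    intro a
    rw [Fin.prod_univ_succAbove _ i]
    simp only [if_true, Fin.succAbove_ne, if_false, zero_mul, neg_zero, Real.exp_zero]
    by_cases hi : a i = true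
    · rw [if_pos hi, one_mul]
      split_ifs with hc
      · refine (Finset.prod_eq_one fun l _ => ?_).symm
        split_ifs with hl
        · rw [Set.indicator_of_notMem, sub_zero]
          intro hmem
          have := hc.2 _ (Fin.succAbove_ne i l) (Metric.mem_closedBall.1 hmem)
          rw [hl] at this
          exact Bool.noConfusion this
        · rfl
      · have : ∃ k, k ≠ i ∧ dist (x k) (x j) ≤ P.RI ∧ a k = true := by
          by_contra hcon
          push Not at hcon
          exact hc ⟨hi, fun k hk hd => by simpa using hcon k hk hd⟩
        obtain ⟨k, hk, hd, ha⟩ := this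
        obtain ⟨l, rfl⟩ := Fin.exists_succAbove_eq hk
        refine (Finset.prod_eq_zero (Finset.mem_univ l) ?_).symm
        rw [if_pos ha, Set.indicator_of_mem (Metric.mem_closedBall.2 hd)]
        simp
    · rw [if_neg hi, zero_mul, if_neg fun hc => hi hc.1]
  simp_rw [h]
  rw [expect_coins_prod P.qp fun l b => if l = i then (if b = true then (1 : ℝ) else 0) else
        if b = true then 1 - (Metric.closedBall (x j) P.RI).indicator 1 (x l) else 1,
    Fin.prod_univ_succAbove _ i]
  simp only [if_true, Fin.succAbove_ne, if_false, Bool.false_eq_true, configProd,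
    Fin.removeNth_apply, mul_one, mul_zero, add_zero]
  congr 1
  exact Finset.prod_congr rfl fun l _ => by ring

lemma abs_exp_neg_sub_exp_neg_le {s t : ℝ} (hs : 0 ≤ s) (ht : 0 ≤ t) :
    |rexp (-s) - rexp (-t)| ≤ |s - t| := by
  wlog h : s ≤ t generalizing s t
  · rw [abs_sub_comm, abs_sub_comm s]
    exact this ht hs (not_le.1 h).le
  have h1 : rexp (-t) ≤ rexp (-s) := Real.exp_le_exp.2 (by linarith)
  rw [abs_of_nonneg (by linarith), abs_sub_comm, abs_of_nonneg (by linarith)]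
  have h2 : rexp (-t) = rexp (-s) * rexp (-(t - s)) := by rw [← Real.exp_add]; congr 1; ring
  have h3 := Real.add_one_le_exp (-(t - s))
  have h4 : rexp (-s) ≤ 1 := Real.exp_le_one_iff.2 (by linarith)
  have h5 := Real.exp_pos (-s)
  rw [h2]
  nlinarith

/-- `exp (-·)` is 1-Lipschitz on nonnegative numbers, so replacing the uncovered area by `p` times
the area of the disk costs at most the deviation of the area, bounded via `abs_le_add_sq_div` by its
second moment. Of the event that the channel is clear only the activity of `i` is kept; this loses
the correlation with the uncovered area but suffices. -/
lemma abs_meanHopSuccess_sub_le (P : Params) {A : Set Plane} {kap p e : ℝ} (hk : 0 ≤ kap)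
    (hp : 0 ≤ p) (he : 0 < e) (x : Fin (n + 1) → Plane) (i j : Fin (n + 1))
    (hA : Metric.closedBall (x j) P.RIsp ⊆ A) :
    |meanHopSuccess P A kap x i j - rexp (-(kap * (p * volume.real (Metric.closedBall (x j) P.RIsp))))
      * meanHopSuccess P A 0 x i j| ≤
      P.qp * (e / 2 + kap ^ 2 / (2 * e) *
        coverVariance P.qp P.RD p P.RIsp (x i) (x j) ⟨n, i.removeNth x⟩) := by
  classical
  set v := p * volume.real (Metric.closedBall (x j) P.RIsp) with hv
  have hv0 : 0 ≤ v := by positivity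
  set V : (Fin (n + 1) → Bool) → ℝ := fun a =>
    volume.real (uncovered P.RD x a ∩ Metric.closedBall (x j) P.RIsp) with hV
  have hV0 : ∀ a, 0 ≤ V a := fun a => measureReal_nonneg
  have hcap : ∀ a, uncovered P.RD x a ∩ Metric.closedBall (x j) P.RIsp ∩ A =
      uncovered P.RD x a ∩ Metric.closedBall (x j) P.RIsp := fun a =>
    Set.inter_eq_left.2 (Set.inter_subset_right.trans hA)
  have hsq := expect_uncovered_area_sq P.qp P.RD p P.RIsp x i (x j)
  have hR : (P.qp : ℝ) * (e / 2 + kap ^ 2 / (2 * e) *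
        coverVariance P.qp P.RD p P.RIsp (x i) (x j) ⟨n, i.removeNth x⟩) =
      ∑ a, (coins (n + 1) P.qp a).toReal * ((if a i = true then 1 else 0) *
        (e / 2 + (kap * V a - kap * v) ^ 2 / (2 * e))) := by
    have e4 := expect_active P.qp i
    have : (P.qp : ℝ) * (e / 2 + kap ^ 2 / (2 * e) *
        coverVariance P.qp P.RD p P.RIsp (x i) (x j) ⟨n, i.removeNth x⟩) =
        P.qp * (e / 2) + P.qp * coverVariance P.qp P.RD p P.RIsp (x i) (x j) ⟨n, i.removeNth x⟩ *
          (kap ^ 2 / (2 * e)) := by ring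
    rw [this, ← hsq]
    nth_rewrite 1 [← e4]
    rw [expect_fintype, expect_fintype, Finset.sum_mul, Finset.sum_mul, ← Finset.sum_add_distrib]
    refine Finset.sum_congr rfl fun a _ => ?_
    simp only [hV, hv]
    ring
  unfold meanHopSuccess
  simp_rw [hcap]
  rw [hR, expect_fintype, expect_fintype, Finset.mul_sum, ← Finset.sum_sub_distrib]
  refine (Finset.abs_sum_le_sum_abs _ _).trans (Finset.sum_le_sum fun a _ => ?_)
  rw [mul_left_comm, ← mul_sub, abs_mul, abs_of_nonneg ENNReal.toReal_nonneg]
  refine mul_le_mul_of_nonneg_left ?_ ENNReal.toReal_nonneg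
  by_cases hc : PrimaryClear P x i j a
  · rw [if_pos hc, if_pos hc, if_pos hc.1, zero_mul, neg_zero, Real.exp_zero, mul_one, one_mul]
    exact (abs_exp_neg_sub_exp_neg_le (mul_nonneg hk (hV0 a)) (mul_nonneg hk hv0)).trans
      (abs_le_add_sq_div he _)
  · rw [if_neg hc, if_neg hc, mul_zero, sub_zero, abs_zero]
    split_ifs <;> positivity

attribute [irreducible] undetected pairUncovered coverVariance

end Concentration

/-! ### Mean of the second moment over the primary nodes -/

section Variance

/-- The configuration with an additional point. -/
def addPoint (z : Plane) (c : Config) : Config := ⟨c.1 + 1, Fin.cons z c.2⟩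

lemma configProd_addPoint (h : Plane → ℝ) (z : Plane) (c : Config) :
    configProd h (addPoint z c) = h z * configProd h c := by
  change ∏ k : Fin (c.1 + 1), h ((Fin.cons z c.2 : Fin (c.1 + 1) → Plane) k) = _
  rw [Fin.prod_univ_succ]
  rfl

lemma configProd_succ (h : Plane → ℝ) {n : ℕ} (x : Fin (n + 1) → Plane) (i : Fin (n + 1)) :
    configProd h ⟨n + 1, x⟩ = configProd h (addPoint (x i) ⟨n, i.removeNth x⟩) := by
  rw [configProd_addPoint]
  simp only [configProd, Fin.prod_univ_succAbove _ i, Fin.removeNth_apply]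

lemma measurable_addPoint : Measurable fun p : Plane × Config => addPoint p.1 p.2 := by
  refine measurable_prod_config fun n => ?_
  change Measurable (toConfig (n + 1) ∘
    fun p : Plane × (Fin n → Plane) => (Fin.cons p.1 p.2 : Fin (n + 1) → Plane))
  refine (measurable_toConfig _).comp (measurable_pi_lambda _ fun k => ?_)
  refine Fin.cases ?_ (fun k => ?_) k
  · exact measurable_fst
  · exact (measurable_pi_apply k).comp measurable_snd

lemma volume_real_closedBall (z : Plane) {R : ℝ} (hR : 0 ≤ R) :
    volume.real (Metric.closedBall z R) = π * R ^ 2 := by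
  rw [measureReal_def, EuclideanSpace.volume_closedBall_fin_two, ENNReal.toReal_mul,
    ENNReal.toReal_pow, ENNReal.toReal_ofReal hR]
  rw [ENNReal.toReal_ofReal Real.pi_pos.le, mul_comm]

/-- Brings the averaged factor into the form to which the void probability formula applies. -/
lemma undetected_mul_eq (q RD : ℝ) (z : Plane × Plane) (x : Plane) :
    1 - q + q * (undetected RD z.1 x * undetected RD z.2 x) =
      1 - q * (Metric.closedBall z.1 RD ∪ Metric.closedBall z.2 RD).indicator 1 x := by
  unfold undetected
  by_cases h1 : RD < dist x z.1 <;> by_cases h2 : RD < dist x z.2 <;>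
    simp [Set.indicator, h1, h2, not_le.2, not_lt.1]

/-- The lower bound says that one additional node changes the uncovered probability by a factor at
least `1 - q`; the destination and the receiver therefore cost only `O(q)`. -/
lemma pair_factor_mem (q : unitInterval) (RD : ℝ) (z : Plane × Plane) (x : Plane) :
    1 - (q : ℝ) ≤ 1 - q + q * (undetected RD z.1 x * undetected RD z.2 x) ∧
      1 - q + q * (undetected RD z.1 x * undetected RD z.2 x) ≤ 1 := by
  have h0 := mul_nonneg (undetected_nonneg RD z.1 x) (undetected_nonneg RD z.2 x)
  have h1 : undetected RD z.1 x * undetected RD z.2 x ≤ 1 :=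
    mul_le_one₀ (undetected_le_one _ _ _) (undetected_nonneg _ _ _) (undetected_le_one _ _ _)
  have := q.2.1
  constructor <;> nlinarith

lemma pair_factor_nonneg (q : unitInterval) (RD : ℝ) (z : Plane × Plane) (x : Plane) :
    0 ≤ 1 - (q : ℝ) + q * (undetected RD z.1 x * undetected RD z.2 x) :=
  (sub_nonneg.2 q.2.2).trans (pair_factor_mem q RD z x).1

lemma pairUncovered_nonneg (q : unitInterval) (RD : ℝ) (z : Plane × Plane) (u : Plane)
    (c : Config) : 0 ≤ pairUncovered q RD z u c := by
  unfold pairUncovered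
  exact mul_nonneg (mul_nonneg (undetected_nonneg _ _ _) (undetected_nonneg _ _ _))
    (configProd_nonneg (pair_factor_nonneg q RD z) c)

lemma pairUncovered_le_one (q : unitInterval) (RD : ℝ) (z : Plane × Plane) (u : Plane)
    (c : Config) : pairUncovered q RD z u c ≤ 1 := by
  unfold pairUncovered
  exact mul_le_one₀ (mul_le_one₀ (undetected_le_one _ _ _) (undetected_nonneg _ _ _)
    (undetected_le_one _ _ _)) (configProd_nonneg (pair_factor_nonneg q RD z) c)
    (configProd_le_one (pair_factor_nonneg q RD z) (fun x => (pair_factor_mem q RD z x).2) c)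

lemma measurable_pairUncovered (q RD : ℝ) :
    Measurable fun p : ((Plane × Plane) × Plane) × Config => pairUncovered q RD p.1.1 p.1.2 p.2 := by
  have m1 : Measurable fun p : (Plane × Plane) × Plane => (p.1.1, p.2) := by fun_prop
  have m2 : Measurable fun p : (Plane × Plane) × Plane => (p.1.2, p.2) := by fun_prop
  have h1 : Measurable fun p : (Plane × Plane) × Plane => undetected RD p.1.1 p.2 :=
    (measurable_undetected RD).comp m1
  have h2 : Measurable fun p : (Plane × Plane) × Plane => undetected RD p.1.2 p.2 :=
    (measurable_undetected RD).comp m2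
  have h3 : Measurable fun p : (Plane × Plane) × Config =>
      configProd (fun x => 1 - q + q * (undetected RD p.1.1 x * undetected RD p.1.2 x)) p.2 :=
    measurable_configProd (h := fun (z : Plane × Plane) x =>
      1 - q + q * (undetected RD z.1 x * undetected RD z.2 x))
      (((h1.mul h2).const_mul q).const_add (1 - q))
  have h4 : Measurable fun p : ((Plane × Plane) × Plane) × Config =>
      undetected RD p.1.1.1 p.1.2 * undetected RD p.1.1.2 p.1.2 := (h1.mul h2).comp measurable_fst
  have h5 : Measurable fun p : ((Plane × Plane) × Plane) × Config => (p.1.1, p.2) := by fun_prop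
  have h6 : Measurable fun p : ((Plane × Plane) × Plane) × Config =>
      configProd (fun x => 1 - q + q * (undetected RD p.1.1.1 x * undetected RD p.1.1.2 x)) p.2 :=
    h3.comp h5
  unfold pairUncovered
  exact h4.mul h6

variable {A : Set Plane}

lemma measurable_addPoint₂ (v w : Plane) :
    Measurable fun c : Config => addPoint v (addPoint w c) := by
  have h1 : Measurable fun c : Config => (w, c) := measurable_const.prodMk measurable_id
  have h2 : Measurable fun c : Config => addPoint w c := measurable_addPoint.comp h1
  have h3 : Measurable fun c : Config => (v, addPoint w c) := measurable_const.prodMk h2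
  exact measurable_addPoint.comp h3

/-- The sender `u` transmits for certain, the extra nodes `v` and `w` with probability `q`, and the
Poisson nodes give the void probability of the union of the two detection disks. -/
lemma integral_pairUncovered (hA : volume A ≠ 0) (hA' : volume A ≠ ∞) {lam : ℝ} (hl : 0 ≤ lam)
    (q : unitInterval) (RD : ℝ) (z : Plane × Plane) (u v w : Plane) :
    ∫ c, pairUncovered q RD z u (addPoint v (addPoint w c)) ∂poissonNodes A lam =
      undetected RD z.1 u * undetected RD z.2 u *
        ((1 - q + q * (undetected RD z.1 v * undetected RD z.2 v)) *
        ((1 - q + q * (undetected RD z.1 w * undetected RD z.2 w)) *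
        rexp (-(lam * q * volume.real
          ((Metric.closedBall z.1 RD ∪ Metric.closedBall z.2 RD) ∩ A))))) := by
  unfold pairUncovered
  simp_rw [configProd_addPoint]
  rw [integral_const_mul, integral_const_mul, integral_const_mul,
    ← integral_poissonNodes_prod hA hA' hl q
      (Metric.isClosed_closedBall.measurableSet.union Metric.isClosed_closedBall.measurableSet)]
  simp_rw [undetected_mul_eq]

/-- If the detection disks of `z.1` and `z.2` are disjoint and do not contain `u`, the two points
are uncovered independently, up to the nodes `v` and `w`, and only `O(q)` survives. For the
remaining pairs a trivial bound by `2` is used; they are few. -/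
lemma integral_pairUncovered_bound (hA : volume A ≠ 0) (hA' : volume A ≠ ∞) {lam : ℝ} (hl : 0 ≤ lam)
    (q : unitInterval) {RD : ℝ} (hRD : 0 ≤ RD) (z : Plane × Plane) (u v w : Plane)
    (h1 : Metric.closedBall z.1 RD ⊆ A) (h2 : Metric.closedBall z.2 RD ⊆ A) {p : ℝ}
    (hp : p = rexp (-(lam * q * (π * RD ^ 2)))) :
    ∫ c, (pairUncovered q RD z u (addPoint v (addPoint w c)) -
      p * pairUncovered q RD (z.1, z.1) u (addPoint v (addPoint w c)) -
      p * pairUncovered q RD (z.2, z.2) u (addPoint v (addPoint w c)) + p ^ 2)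
      ∂poissonNodes A lam ≤
    4 * q + 2 * ({z : Plane × Plane | dist z.1 z.2 ≤ 2 * RD}.indicator 1 z +
      (Metric.closedBall u RD ×ˢ (Set.univ : Set Plane)).indicator 1 z +
      ((Set.univ : Set Plane) ×ˢ Metric.closedBall u RD).indicator 1 z) := by
  have : IsProbabilityMeasure (volume[|A]) := cond_isProbabilityMeasure_of_finite hA hA'
  have hpr : IsProbabilityMeasure (poissonNodes A lam) := by
    rw [poissonNodes_eq]; infer_instance
  have hint : ∀ z, Integrable (fun c => pairUncovered q RD z u (addPoint v (addPoint w c)))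
      (poissonNodes A lam) := fun z => by
    refine Integrable.of_bound (C := 1) (Measurable.aestronglyMeasurable ?_) (.of_forall fun c => ?_)
    · have ha : Measurable fun c : Config => ((z, u), addPoint v (addPoint w c)) :=
        measurable_const.prodMk (measurable_addPoint₂ v w)
      exact (measurable_pairUncovered q RD).comp ha
    · rw [Real.norm_of_nonneg (pairUncovered_nonneg _ _ _ _ _)]
      exact pairUncovered_le_one _ _ _ _ _
  have hp0 : 0 < p := hp ▸ exp_pos _
  have hq0 := q.2.1
  have hq1 := q.2.2
  have hp1 : p ≤ 1 := by
    rw [hp]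
    exact Real.exp_le_one_iff.2 (neg_nonpos.2 (by positivity))
  have hsplit : ∫ c, (pairUncovered q RD z u (addPoint v (addPoint w c)) -
      p * pairUncovered q RD (z.1, z.1) u (addPoint v (addPoint w c)) -
      p * pairUncovered q RD (z.2, z.2) u (addPoint v (addPoint w c)) + p ^ 2)
      ∂poissonNodes A lam =
      ∫ c, pairUncovered q RD z u (addPoint v (addPoint w c)) ∂poissonNodes A lam -
      p * ∫ c, pairUncovered q RD (z.1, z.1) u (addPoint v (addPoint w c)) ∂poissonNodes A lam -
      p * ∫ c, pairUncovered q RD (z.2, z.2) u (addPoint v (addPoint w c)) ∂poissonNodes A lam +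
      p ^ 2 := by
    have ha : Integrable (fun c => pairUncovered q RD z u (addPoint v (addPoint w c)) -
        p * pairUncovered q RD (z.1, z.1) u (addPoint v (addPoint w c))) (poissonNodes A lam) :=
      (hint z).sub ((hint _).const_mul p)
    have hb : Integrable (fun c => pairUncovered q RD z u (addPoint v (addPoint w c)) -
        p * pairUncovered q RD (z.1, z.1) u (addPoint v (addPoint w c)) -
        p * pairUncovered q RD (z.2, z.2) u (addPoint v (addPoint w c))) (poissonNodes A lam) :=
      ha.sub ((hint _).const_mul p)
    rw [integral_add hb (integrable_const _), integral_sub ha ((hint _).const_mul p),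
      integral_sub (hint z) ((hint _).const_mul p), integral_const_mul, integral_const_mul]
    simp
  rw [hsplit]
  have hnn : ∀ z, 0 ≤ ∫ c, pairUncovered q RD z u (addPoint v (addPoint w c)) ∂poissonNodes A lam :=
    fun z => integral_nonneg fun c => pairUncovered_nonneg _ _ _ _ _
  have hle : ∫ c, pairUncovered q RD z u (addPoint v (addPoint w c)) ∂poissonNodes A lam ≤ 1 := by
    refine (integral_mono (hint z) (integrable_const 1) fun c =>
      pairUncovered_le_one _ _ _ _ _).trans ?_
    simp
  -- The two negative terms are dropped and the other two are at most `1`.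
  have hcrude : ∫ c, pairUncovered q RD z u (addPoint v (addPoint w c)) ∂poissonNodes A lam -
      p * ∫ c, pairUncovered q RD (z.1, z.1) u (addPoint v (addPoint w c)) ∂poissonNodes A lam -
      p * ∫ c, pairUncovered q RD (z.2, z.2) u (addPoint v (addPoint w c)) ∂poissonNodes A lam +
      p ^ 2 ≤ 2 := by
    have e1 := mul_nonneg hp0.le (hnn (z.1, z.1))
    have e2 := mul_nonneg hp0.le (hnn (z.2, z.2))
    have e3 : p ^ 2 ≤ 1 := pow_le_one₀ hp0.le hp1
    linarith
  have i1 : 0 ≤ {z : Plane × Plane | dist z.1 z.2 ≤ 2 * RD}.indicator (1 : Plane × Plane → ℝ) z :=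
    Set.indicator_nonneg (fun _ _ => zero_le_one) z
  have i2 : 0 ≤ (Metric.closedBall u RD ×ˢ (Set.univ : Set Plane)).indicator
      (1 : Plane × Plane → ℝ) z := Set.indicator_nonneg (fun _ _ => zero_le_one) z
  have i3 : 0 ≤ ((Set.univ : Set Plane) ×ˢ Metric.closedBall u RD).indicator
      (1 : Plane × Plane → ℝ) z := Set.indicator_nonneg (fun _ _ => zero_le_one) z
  by_cases hd : dist z.1 z.2 ≤ 2 * RD
  · rw [Set.indicator_of_mem (s := {z : Plane × Plane | dist z.1 z.2 ≤ 2 * RD}) hd]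
    simp only [Pi.one_apply]
    linarith
  by_cases hu1 : z.1 ∈ Metric.closedBall u RD
  · rw [Set.indicator_of_mem (s := Metric.closedBall u RD ×ˢ (Set.univ : Set Plane))
      ⟨hu1, Set.mem_univ _⟩]
    simp only [Pi.one_apply]
    linarith
  by_cases hu2 : z.2 ∈ Metric.closedBall u RD
  · rw [Set.indicator_of_mem (s := (Set.univ : Set Plane) ×ˢ Metric.closedBall u RD)
      ⟨Set.mem_univ _, hu2⟩]
    simp only [Pi.one_apply]
    linarith
  have k1 : undetected RD z.1 u = 1 := undetected_of_lt (by
    rw [Metric.mem_closedBall, not_le, dist_comm] at hu1; exact hu1)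
  have k2 : undetected RD z.2 u = 1 := undetected_of_lt (by
    rw [Metric.mem_closedBall, not_le, dist_comm] at hu2; exact hu2)
  have hv : volume.real ((Metric.closedBall z.1 RD ∪ Metric.closedBall z.2 RD) ∩ A) =
      2 * (π * RD ^ 2) := by
    rw [Set.inter_eq_left.2 (Set.union_subset h1 h2), measureReal_union
      (Metric.closedBall_disjoint_closedBall (by linarith)) Metric.isClosed_closedBall.measurableSet
      measure_closedBall_lt_top.ne measure_closedBall_lt_top.ne, volume_real_closedBall _ hRD,
      volume_real_closedBall _ hRD]
    ring
  have hv1 : volume.real ((Metric.closedBall z.1 RD ∪ Metric.closedBall z.1 RD) ∩ A) =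
      π * RD ^ 2 := by
    rw [Set.union_self, Set.inter_eq_left.2 h1, volume_real_closedBall _ hRD]
  have hv2 : volume.real ((Metric.closedBall z.2 RD ∪ Metric.closedBall z.2 RD) ∩ A) =
      π * RD ^ 2 := by
    rw [Set.union_self, Set.inter_eq_left.2 h2, volume_real_closedBall _ hRD]
  rw [integral_pairUncovered hA hA' hl, integral_pairUncovered hA hA' hl,
    integral_pairUncovered hA hA' hl]
  simp only [k1, k2, hv, hv1, hv2, ← hp, one_mul]
  have hp2 : rexp (-(lam * q * (2 * (π * RD ^ 2)))) = p ^ 2 := by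
    rw [hp, ← Real.exp_nat_mul]
    congr 1
    push_cast
    ring
  rw [hp2]
  have f := pair_factor_mem q RD z v
  have f' := pair_factor_mem q RD z w
  have g0 := pair_factor_nonneg q RD z w
  have a1 := pair_factor_mem q RD (z.1, z.1) v
  have a1' := pair_factor_mem q RD (z.1, z.1) w
  have a2 := pair_factor_mem q RD (z.2, z.2) v
  have a2' := pair_factor_mem q RD (z.2, z.2) w
  have n1 := pair_factor_nonneg q RD (z.1, z.1) v
  have n2 := pair_factor_nonneg q RD (z.2, z.2) v
  set α := 1 - (q : ℝ) + q * (undetected RD z.1 v * undetected RD z.2 v)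
  set α' := 1 - (q : ℝ) + q * (undetected RD z.1 w * undetected RD z.2 w)
  simp only at a1 a1' a2 a2' n1 n2
  set β := 1 - (q : ℝ) + q * (undetected RD z.1 v * undetected RD z.1 v)
  set β' := 1 - (q : ℝ) + q * (undetected RD z.1 w * undetected RD z.1 w)
  set γ := 1 - (q : ℝ) + q * (undetected RD z.2 v * undetected RD z.2 v)
  set γ' := 1 - (q : ℝ) + q * (undetected RD z.2 w * undetected RD z.2 w)
  have hαα : α * α' ≤ 1 := mul_le_one₀ f.2 g0 f'.2
  have hββ : 1 - 2 * (q : ℝ) ≤ β * β' := by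
    have := mul_le_mul a1.1 a1'.1 (sub_nonneg.2 hq1) n1
    nlinarith
  have hγγ : 1 - 2 * (q : ℝ) ≤ γ * γ' := by
    have := mul_le_mul a2.1 a2'.1 (sub_nonneg.2 hq1) n2
    nlinarith
  have e3 : p ^ 2 ≤ 1 := pow_le_one₀ hp0.le hp1
  have e4 : 0 ≤ p ^ 2 := sq_nonneg p
  -- Without `v` and `w` all products would be `1` and the bracket would vanish; with them `α α' ≤
  -- 1`, while `β β'` and `γ γ'` are at least `1 - 2 q`.
  have : α * (α' * p ^ 2) - p * (β * (β' * p)) - p * (γ * (γ' * p)) + p ^ 2 =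
      p ^ 2 * (α * α' - β * β' - γ * γ' + 1) := by ring
  rw [this]
  have h5 : p ^ 2 * (α * α' - β * β' - γ * γ' + 1) ≤ p ^ 2 * (4 * q) :=
    mul_le_mul_of_nonneg_left (by linarith) e4
  have h6 : p ^ 2 * (4 * q) ≤ 1 * (4 * q) := mul_le_mul_of_nonneg_right e3 (by positivity)
  linarith

lemma measurable_coverIntegrand (q RD p : ℝ) :
    Measurable fun b : ((Plane × Plane) × Plane) × Config => pairUncovered q RD b.1.1 b.1.2 b.2 -
      p * pairUncovered q RD (b.1.1.1, b.1.1.1) b.1.2 b.2 -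
      p * pairUncovered q RD (b.1.1.2, b.1.1.2) b.1.2 b.2 + p ^ 2 := by
  have h := measurable_pairUncovered q RD
  have m1 : Measurable fun b : ((Plane × Plane) × Plane) × Config =>
      (((b.1.1.1, b.1.1.1), b.1.2), b.2) := by fun_prop
  have m2 : Measurable fun b : ((Plane × Plane) × Plane) × Config =>
      (((b.1.1.2, b.1.1.2), b.1.2), b.2) := by fun_prop
  exact ((h.sub ((h.comp m1).const_mul p)).sub ((h.comp m2).const_mul p)).add_const _

lemma abs_coverIntegrand_le (q : unitInterval) (RD : ℝ) {p : ℝ} (hp0 : 0 ≤ p) (hp1 : p ≤ 1)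
    (z : Plane × Plane) (u : Plane) (c : Config) :
    |pairUncovered q RD z u c - p * pairUncovered q RD (z.1, z.1) u c -
      p * pairUncovered q RD (z.2, z.2) u c + p ^ 2| ≤ 2 := by
  have a := pairUncovered_nonneg q RD z u c
  have a' := pairUncovered_le_one q RD z u c
  have b := mul_nonneg hp0 (pairUncovered_nonneg q RD (z.1, z.1) u c)
  have b' := mul_le_one₀ hp1 (pairUncovered_nonneg q RD (z.1, z.1) u c)
    (pairUncovered_le_one q RD (z.1, z.1) u c)
  have d := mul_nonneg hp0 (pairUncovered_nonneg q RD (z.2, z.2) u c)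
  have d' := mul_le_one₀ hp1 (pairUncovered_nonneg q RD (z.2, z.2) u c)
    (pairUncovered_le_one q RD (z.2, z.2) u c)
  have e : p ^ 2 ≤ 1 := pow_le_one₀ hp0 hp1
  have e' : 0 ≤ p ^ 2 := sq_nonneg p
  rw [abs_le]
  constructor <;> linarith

/-- Integrates the pointwise bound over pairs in the disk. Close pairs have measure at most `4 π RD²
· π R²`, pairs with a given point near `u` at most `π RD² · π R²`; weighted by `2`, the three sets
together give the constant `12`. -/
lemma integral_coverVariance_le (hA : volume A ≠ 0) (hA' : volume A ≠ ∞) {lam : ℝ} (hl : 0 ≤ lam)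
    (q : unitInterval) {RD R : ℝ} (hRD : 0 ≤ RD) (hR : 0 ≤ R) (u v w : Plane)
    (hw : ∀ z ∈ Metric.closedBall w R, Metric.closedBall z RD ⊆ A) {p : ℝ}
    (hp : p = rexp (-(lam * q * (π * RD ^ 2)))) :
    ∫ c, coverVariance q RD p R u w (addPoint v (addPoint w c)) ∂poissonNodes A lam ≤
      4 * q * (π * R ^ 2) ^ 2 + 12 * (π * RD ^ 2) * (π * R ^ 2) := by
  have : IsProbabilityMeasure (volume[|A]) := cond_isProbabilityMeasure_of_finite hA hA'
  have hpr : IsProbabilityMeasure (poissonNodes A lam) := by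
    rw [poissonNodes_eq]; infer_instance
  have hq0 := q.2.1
  have hp0 : 0 ≤ p := hp ▸ (exp_pos _).le
  have hp1 : p ≤ 1 := by
    rw [hp]
    exact Real.exp_le_one_iff.2 (neg_nonpos.2 (by positivity))
  unfold coverVariance
  set μ : Measure Plane := volume.restrict (Metric.closedBall w R) with hμ
  have hμu : μ Set.univ = ENNReal.ofReal (π * R ^ 2) := by
    rw [hμ, Measure.restrict_apply_univ, ← volume_real_closedBall w hR, ofReal_measureReal
      measure_closedBall_lt_top.ne]
  have hfin : IsFiniteMeasure μ := ⟨by rw [hμu]; exact ENNReal.ofReal_lt_top⟩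
  have hμb : ∀ z r, 0 ≤ r → μ (Metric.closedBall z r) ≤ ENNReal.ofReal (π * r ^ 2) := by
    intro z r hr
    refine (Measure.restrict_apply_le _ _).trans_eq ?_
    rw [← volume_real_closedBall z hr, ofReal_measureReal measure_closedBall_lt_top.ne]
  have ha : Measurable fun b : Config × (Plane × Plane) =>
      ((b.2, u), addPoint v (addPoint w b.1)) :=
    (measurable_snd.prodMk measurable_const).prodMk ((measurable_addPoint₂ v w).comp measurable_fst)
  have hmeas : Measurable fun b : Config × (Plane × Plane) =>
      pairUncovered q RD b.2 u (addPoint v (addPoint w b.1)) -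
      p * pairUncovered q RD (b.2.1, b.2.1) u (addPoint v (addPoint w b.1)) -
      p * pairUncovered q RD (b.2.2, b.2.2) u (addPoint v (addPoint w b.1)) + p ^ 2 :=
    (measurable_coverIntegrand q RD p).comp ha
  rw [integral_integral_swap (Integrable.of_bound hmeas.aestronglyMeasurable 2
    (.of_forall fun b => abs_coverIntegrand_le q RD hp0 hp1 _ _ _))]
  set S₁ : Set (Plane × Plane) := {z | dist z.1 z.2 ≤ 2 * RD} with hS₁
  set S₂ : Set (Plane × Plane) := Metric.closedBall u RD ×ˢ Set.univ
  set S₃ : Set (Plane × Plane) := Set.univ ×ˢ Metric.closedBall u RD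
  have m₁ : MeasurableSet S₁ := measurableSet_le (measurable_fst.dist measurable_snd) measurable_const
  have m₂ : MeasurableSet S₂ := Metric.isClosed_closedBall.measurableSet.prod MeasurableSet.univ
  have m₃ : MeasurableSet S₃ := MeasurableSet.univ.prod Metric.isClosed_closedBall.measurableSet
  have j : ∀ {S : Set (Plane × Plane)}, MeasurableSet S →
      Integrable (S.indicator (1 : Plane × Plane → ℝ)) (μ.prod μ) :=
    fun hS => (integrable_const (1 : ℝ)).indicator hS
  have r₁ : (μ.prod μ).real S₁ ≤ π * (2 * RD) ^ 2 * (π * R ^ 2) := by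
    refine ENNReal.toReal_le_of_le_ofReal (by positivity) ?_
    rw [Measure.prod_apply m₁, ENNReal.ofReal_mul (by positivity), ← hμu, ← lintegral_const]
    refine lintegral_mono fun z => ?_
    have : Prod.mk z ⁻¹' S₁ = Metric.closedBall z (2 * RD) := by
      ext z'
      simp [hS₁, dist_comm]
    rw [this]
    exact hμb _ _ (by positivity)
  have r₂ : (μ.prod μ).real S₂ ≤ π * RD ^ 2 * (π * R ^ 2) := by
    refine ENNReal.toReal_le_of_le_ofReal (by positivity) ?_
    rw [Measure.prod_prod, ENNReal.ofReal_mul (by positivity), hμu]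
    gcongr
    exact hμb _ _ hRD
  have r₃ : (μ.prod μ).real S₃ ≤ π * RD ^ 2 * (π * R ^ 2) := by
    refine ENNReal.toReal_le_of_le_ofReal (by positivity) ?_
    rw [Measure.prod_prod, ENNReal.ofReal_mul (by positivity), hμu, mul_comm]
    gcongr
    exact hμb _ _ hRD
  have hint : Integrable (fun z => 4 * (q : ℝ) + 2 * (S₁.indicator 1 z + S₂.indicator 1 z +
      S₃.indicator 1 z)) (μ.prod μ) :=
    (integrable_const _).add ((((j m₁).add (j m₂)).add (j m₃)).const_mul 2)
  have hae : ∀ᵐ z ∂(μ.prod μ), z ∈ Metric.closedBall w R ×ˢ Metric.closedBall w R := by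
    rw [hμ, Measure.prod_restrict]
    exact ae_restrict_mem (Metric.isClosed_closedBall.measurableSet.prod
      Metric.isClosed_closedBall.measurableSet)
  have hmono : ∫ z, ∫ c, (pairUncovered q RD z u (addPoint v (addPoint w c)) -
      p * pairUncovered q RD (z.1, z.1) u (addPoint v (addPoint w c)) -
      p * pairUncovered q RD (z.2, z.2) u (addPoint v (addPoint w c)) + p ^ 2)
        ∂poissonNodes A lam ∂(μ.prod μ) ≤
      ∫ z, (4 * (q : ℝ) + 2 * (S₁.indicator 1 z + S₂.indicator 1 z + S₃.indicator 1 z))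
        ∂(μ.prod μ) := by
    refine integral_mono_ae ?_ hint (hae.mono fun z hz =>
      integral_pairUncovered_bound hA hA' hl q hRD z u v w (hw _ hz.1) (hw _ hz.2) hp)
    exact (Integrable.of_bound hmeas.aestronglyMeasurable 2
      (.of_forall fun b => abs_coverIntegrand_le q RD hp0 hp1 _ _ _)).integral_prod_right
  refine hmono.trans ?_
  have hs12 : Integrable (fun z => S₁.indicator (1 : Plane × Plane → ℝ) z + S₂.indicator 1 z)
    (μ.prod μ) := (j m₁).add (j m₂)
  have hs123 : Integrable (fun z => S₁.indicator (1 : Plane × Plane → ℝ) z + S₂.indicator 1 z +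
    S₃.indicator 1 z) (μ.prod μ) := hs12.add (j m₃)
  rw [integral_add (integrable_const _) (hs123.const_mul 2), integral_const, integral_const_mul,
    integral_add hs12 (j m₃), integral_add (j m₁) (j m₂), integral_indicator_one m₁,
    integral_indicator_one m₂, integral_indicator_one m₃, measureReal_def,
    ← Set.univ_prod_univ, Measure.prod_prod, hμu, ENNReal.toReal_mul,
    ENNReal.toReal_ofReal (by positivity), smul_eq_mul]
  nlinarith

end Variance

/-! ### Comparison with a sum over triples of nodes -/

section Comparison

variable {n : ℕ}

/-- The half-disk with centre `u`, radius `R` and orientation towards `v`. -/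
def halfDisk (R : ℝ) (u v : Plane) : Set Plane := {w | dist w u ≤ R ∧ 0 ≤ inner ℝ (w - u) (v - u)}

lemma measurableSet_halfDisk (R : ℝ) :
    MeasurableSet {p : (Plane × Plane) × Plane | p.2 ∈ halfDisk R p.1.1 p.1.2} := by
  refine MeasurableSet.inter ?_ ?_
  · exact measurableSet_le (measurable_snd.dist (measurable_fst.comp measurable_fst))
      measurable_const
  · have h1 : Measurable fun p : (Plane × Plane) × Plane => p.2 - p.1.1 :=
      measurable_snd.sub (measurable_fst.comp measurable_fst)
    have h2 : Measurable fun p : (Plane × Plane) × Plane => p.1.2 - p.1.1 :=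
      (measurable_snd.comp measurable_fst).sub (measurable_fst.comp measurable_fst)
    exact measurableSet_le measurable_const (h1.inner (𝕜 := ℝ) h2)

lemma mem_nextHops_iff {P : Params} {x : Fin n → Plane} {i d : Fin n}
    (h : P.Rr < dist (x i) (x d)) (j : Fin n) :
    j ∈ nextHops P x i d ↔ j ≠ i ∧ x j ∈ halfDisk P.Rr (x i) (x d) := by
  unfold nextHops
  rw [if_neg (not_le.2 h), Finset.mem_filter]
  simp [halfDisk]

open Classical in
/-- A sum over a node, the destination of its packet and the possible next hops, restricted to
destinations outside the transmission range. -/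
def relaySum (P : Params) (x : Fin n → Plane) (φ : Fin n → Fin n → Fin n → ℝ) : ℝ :=
  ∑ i, ∑ d, if d = i then 0 else
    if P.Rr < dist (x i) (x d) then ∑ j ∈ nextHops P x i d, φ i d j else 0

lemma hop_progress_bound {P : Params} {x : Fin n → Plane} {T : Fin n → Fin n → ℝ}
    (hT0 : ∀ i j, 0 ≤ T i j) (hT : ∀ i j, T i j ≤ P.qp) {i d j : Fin n}
    (hj : j ∈ nextHops P x i d) : |progress x i j d * T i j| ≤ P.qp * P.Rr := by
  rw [abs_mul, mul_comm, abs_of_nonneg (hT0 i j)]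
  exact mul_le_mul (hT i j) ((abs_progress_le x i j d).trans (dist_le_of_mem_nextHops hj))
    (abs_nonneg _) P.qp.2.1

lemma sum_pick_mul (P : Params) (x : Fin n → Plane) (T : Fin n → Fin n → ℝ) (i d : Fin n) :
    ∑ j, (pick (nextHops P x i d) (some j)).toReal * progress x i j d * T i j =
      ((nextHops P x i d).card : ℝ)⁻¹ * ∑ j ∈ nextHops P x i d, progress x i j d * T i j := by
  classical
  rw [Finset.mul_sum, ← Finset.sum_subset (Finset.subset_univ (nextHops P x i d))]
  · refine Finset.sum_congr rfl fun j hj => ?_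
    rw [pick_toReal, if_pos hj, mul_assoc]
  · intro j _ hj
    rw [pick_toReal, if_neg hj, zero_mul, zero_mul]

lemma abs_sum_hop_le {P : Params} {x : Fin n → Plane} {T : Fin n → Fin n → ℝ}
    (hT0 : ∀ i j, 0 ≤ T i j) (hT : ∀ i j, T i j ≤ P.qp) (i d : Fin n) :
    |∑ j ∈ nextHops P x i d, progress x i j d * T i j| ≤
      (nextHops P x i d).card * (P.qp * P.Rr) := by
  refine (Finset.abs_sum_le_sum_abs _ _).trans ?_
  refine (Finset.sum_le_sum fun j hj => hop_progress_bound hT0 hT hj).trans ?_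
  rw [Finset.sum_const, nsmul_eq_mul]

open Classical in
-- Three replacements, one error term each: the number `n - 1` of possible destinations by `r`, the
-- number of next hops by `h`, and the success probability `T` by `s T₀`. The second term also pays
-- for destinations within range, which `relaySum` omits.
lemma abs_sourceProgress_sub_le {P : Params} {x : Fin n → Plane} {T T₀ : Fin n → Fin n → ℝ}
    {r h s : ℝ} (hR : 0 ≤ P.Rr) (hT0 : ∀ i j, 0 ≤ T i j) (hT : ∀ i j, T i j ≤ P.qp)
    (hr : 0 < r) (hh : 0 < h) :
    |sourceProgress P x T - s * (r * h)⁻¹ * relaySum P x (fun i d j => progress x i j d * T₀ i j)| ≤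
      ∑ _i : Fin n, P.qp * P.Rr * |((n : ℝ) - 1) / r - 1| +
      (∑ i, ∑ d, (if d = i then 0 else P.qp * P.Rr / r *
        (if P.Rr < dist (x i) (x d) then |((nextHops P x i d).card : ℝ) / h - 1| else 1))) +
      relaySum P x (fun i _ j => P.Rr / (r * h) * |T i j - s * T₀ i j|) := by
  have hq0 := P.qp.2.1
  have hqR : 0 ≤ P.qp * P.Rr := mul_nonneg hq0 hR
  set a : ℝ := ((n : ℝ) - 1)⁻¹ with ha
  unfold sourceProgress relaySum
  rw [Finset.mul_sum, ← Finset.sum_sub_distrib, ← Finset.sum_add_distrib, ← Finset.sum_add_distrib]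
  refine (Finset.abs_sum_le_sum_abs _ _).trans (Finset.sum_le_sum fun i _ => ?_)
  rw [Finset.mul_sum, ← Finset.sum_sub_distrib]
  have hd : ∀ d, |(if d = i then 0 else a) *
      (∑ j, (pick (nextHops P x i d) (some j)).toReal * progress x i j d * T i j) -
      s * (r * h)⁻¹ * (if d = i then 0 else if P.Rr < dist (x i) (x d) then
        ∑ j ∈ nextHops P x i d, progress x i j d * T₀ i j else 0)| ≤
      (if d = i then 0 else P.qp * P.Rr * |a - r⁻¹|) +
      (if d = i then 0 else P.qp * P.Rr / r *
        (if P.Rr < dist (x i) (x d) then |((nextHops P x i d).card : ℝ) / h - 1| else 1)) +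
      (if d = i then 0 else if P.Rr < dist (x i) (x d) then
        ∑ j ∈ nextHops P x i d, P.Rr / (r * h) * |T i j - s * T₀ i j| else 0) := by
    intro d
    split_ifs with h1 h2
    · simp
    · rw [sum_pick_mul]
      set S := ∑ j ∈ nextHops P x i d, progress x i j d * T i j with hS
      set S₀ := ∑ j ∈ nextHops P x i d, progress x i j d * T₀ i j with hS₀
      set k : ℝ := ((nextHops P x i d).card : ℝ) with hk
      have hSb : |S| ≤ k * (P.qp * P.Rr) := abs_sum_hop_le hT0 hT i d
      have hk0 : 0 ≤ k := Nat.cast_nonneg _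
      have e1 : |k⁻¹ * S| ≤ P.qp * P.Rr := by
        rw [abs_mul, abs_of_nonneg (inv_nonneg.2 hk0)]
        rcases hk0.eq_or_lt with hz | hz
        · rw [← hz]; simpa using hqR
        · rw [inv_mul_le_iff₀ hz]; exact hSb
      -- Factoring out `k⁻¹ S`, which is bounded by `qp Rr`, keeps the random number of hops out of
      -- the denominator; if there are no hops, `S` vanishes.
      have e2 : |k⁻¹ * S - h⁻¹ * S| ≤ P.qp * P.Rr * |k / h - 1| := by
        rcases hk0.eq_or_lt with hz | hz
        · have : S = 0 := by
            rw [← hz, zero_mul] at hSb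
            exact abs_nonpos_iff.1 hSb
          rw [this]
          simpa using by positivity
        · have : k⁻¹ * S - h⁻¹ * S = -(k⁻¹ * S) * (k / h - 1) := by
            field_simp
            ring
          rw [this, abs_mul, abs_neg]
          exact mul_le_mul_of_nonneg_right e1 (abs_nonneg _)
      have e3 : |S - s * S₀| ≤ ∑ j ∈ nextHops P x i d, P.Rr * |T i j - s * T₀ i j| := by
        rw [hS, hS₀, Finset.mul_sum, ← Finset.sum_sub_distrib]
        refine (Finset.abs_sum_le_sum_abs _ _).trans (Finset.sum_le_sum fun j hj => ?_)
        have : progress x i j d * T i j - s * (progress x i j d * T₀ i j) =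
          progress x i j d * (T i j - s * T₀ i j) := by ring
        rw [this, abs_mul]
        exact mul_le_mul_of_nonneg_right
          ((abs_progress_le x i j d).trans (dist_le_of_mem_nextHops hj)) (abs_nonneg _)
      have e4 : a * (k⁻¹ * S) - s * (r * h)⁻¹ * S₀ =
          k⁻¹ * S * (a - r⁻¹) + (r⁻¹ * (k⁻¹ * S - h⁻¹ * S) + (r * h)⁻¹ * (S - s * S₀)) := by
        rw [mul_inv]
        ring
      rw [e4, add_assoc]
      refine (abs_add_le _ _).trans (add_le_add ?_ ((abs_add_le _ _).trans (add_le_add ?_ ?_)))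
      · rw [abs_mul]
        exact mul_le_mul_of_nonneg_right e1 (abs_nonneg _)
      · rw [abs_mul, abs_of_pos (inv_pos.2 hr)]
        calc r⁻¹ * |k⁻¹ * S - h⁻¹ * S| ≤ r⁻¹ * (P.qp * P.Rr * |k / h - 1|) :=
              mul_le_mul_of_nonneg_left e2 (inv_pos.2 hr).le
          _ = _ := by ring
      · rw [abs_mul, abs_of_pos (by positivity)]
        calc (r * h)⁻¹ * |S - s * S₀| ≤
              (r * h)⁻¹ * ∑ j ∈ nextHops P x i d, P.Rr * |T i j - s * T₀ i j| :=
              mul_le_mul_of_nonneg_left e3 (by positivity)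
          _ = _ := by
              rw [Finset.mul_sum]
              refine Finset.sum_congr rfl fun j _ => ?_
              ring
    -- The destination is within range: nothing is subtracted, and the whole term is an error of
    -- relative size `1`.
    · rw [sum_pick_mul]
      set S := ∑ j ∈ nextHops P x i d, progress x i j d * T i j with hS
      set k : ℝ := ((nextHops P x i d).card : ℝ) with hk
      have hSb : |S| ≤ k * (P.qp * P.Rr) := abs_sum_hop_le hT0 hT i d
      have hk0 : 0 ≤ k := Nat.cast_nonneg _
      have e1 : |k⁻¹ * S| ≤ P.qp * P.Rr := by
        rw [abs_mul, abs_of_nonneg (inv_nonneg.2 hk0)]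
        rcases hk0.eq_or_lt with hz | hz
        · rw [← hz]; simpa using hqR
        · rw [inv_mul_le_iff₀ hz]; exact hSb
      have e4 : a * (k⁻¹ * S) - s * (r * h)⁻¹ * 0 = k⁻¹ * S * (a - r⁻¹) + r⁻¹ * (k⁻¹ * S) := by ring
      rw [e4, add_zero, mul_one]
      refine (abs_add_le _ _).trans (add_le_add ?_ ?_)
      · rw [abs_mul]
        exact mul_le_mul_of_nonneg_right e1 (abs_nonneg _)
      · rw [abs_mul, abs_of_pos (inv_pos.2 hr), div_eq_inv_mul]
        exact mul_le_mul_of_nonneg_left e1 (inv_pos.2 hr).le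
  refine (Finset.abs_sum_le_sum_abs _ _).trans ((Finset.sum_le_sum fun d _ => hd d).trans ?_)
  rw [Finset.sum_add_distrib, Finset.sum_add_distrib]
  gcongr
  -- Summation over the `n - 1` destinations turns the difference of the inverses into the relative
  -- error `|(n - 1) / r - 1|`.
  have h1 : (∑ d, if d = i then 0 else P.qp * P.Rr * |a - r⁻¹|) =
      ((n : ℝ) - 1) * (P.qp * P.Rr * |a - r⁻¹|) := by
    have : ∀ d, (if d = i then 0 else P.qp * P.Rr * |a - r⁻¹|) =
        P.qp * P.Rr * |a - r⁻¹| - if d = i then P.qp * P.Rr * |a - r⁻¹| else 0 := fun d => by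
      split_ifs <;> simp
    simp_rw [this]
    rw [Finset.sum_sub_distrib, Finset.sum_ite_eq' _ i]
    simp
    ring
  rw [h1]
  have hn : (0 : ℝ) ≤ (n : ℝ) - 1 := by
    have : (1 : ℝ) ≤ n := by exact_mod_cast i.pos
    linarith
  rcases hn.eq_or_lt with hz | hz
  · rw [← hz, zero_mul]
    positivity
  · have : ((n : ℝ) - 1) * (P.qp * P.Rr * |a - r⁻¹|) = P.qp * P.Rr * |((n : ℝ) - 1) * (a - r⁻¹)| := by
      rw [abs_mul, abs_of_pos hz]
      ring
    rw [this, mul_sub, ha, mul_inv_cancel₀ hz.ne', abs_sub_comm, ← div_eq_mul_inv]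

/-! ### Sums over nodes as sums over the points of a configuration -/

lemma sum_ite_ne {M : Type*} [AddCommMonoid M] {N : ℕ} (i : Fin (N + 1)) (φ : Fin (N + 1) → M) :
    (∑ d, if d = i then 0 else φ d) = ∑ k, φ (i.succAbove k) := by
  rw [Fin.sum_univ_succAbove _ i]
  simp [Fin.succAbove_ne]

open Classical in
-- Of the nodes in the half-disk the source is excluded by definition and the destination because it
-- is out of range, so the relays are among the points left after removing both.
lemma sum_nextHops {N : ℕ} (P : Params) (x : Fin (N + 2) → Plane) (i : Fin (N + 2))
    (k : Fin (N + 1)) (h : P.Rr < dist (x i) (x (i.succAbove k))) (φ : Fin (N + 2) → ℝ) :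
    ∑ j ∈ nextHops P x i (i.succAbove k), φ j =
      ∑ l, if x (i.succAbove (k.succAbove l)) ∈ halfDisk P.Rr (x i) (x (i.succAbove k)) then
        φ (i.succAbove (k.succAbove l)) else 0 := by
  have h1 : ∑ j ∈ nextHops P x i (i.succAbove k), φ j =
      ∑ j, if j ∈ nextHops P x i (i.succAbove k) then φ j else 0 := by
    rw [Finset.sum_ite_mem, Finset.univ_inter]
  have h2 : ¬ dist (x (i.succAbove k)) (x i) ≤ P.Rr := by
    rw [dist_comm]
    exact not_le.2 h
  rw [h1, Fin.sum_univ_succAbove _ i, Fin.sum_univ_succAbove _ k]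
  simp only [mem_nextHops_iff h, ne_eq, not_true_eq_false, false_and, if_false, zero_add,
    Fin.succAbove_ne, not_false_eq_true, true_and]
  rw [if_neg fun hc => h2 hc.1, zero_add]

open Classical in
lemma relaySum_add_two {N : ℕ} (P : Params) (x : Fin (N + 2) → Plane)
    (φ : Fin (N + 2) → Fin (N + 2) → Fin (N + 2) → ℝ) :
    relaySum P x φ = ∑ i, ∑ k, ∑ l, if P.Rr < dist (x i) (x (i.succAbove k)) ∧
      x (i.succAbove (k.succAbove l)) ∈ halfDisk P.Rr (x i) (x (i.succAbove k)) then
        φ i (i.succAbove k) (i.succAbove (k.succAbove l)) else 0 := by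
  unfold relaySum
  refine Finset.sum_congr rfl fun i _ => ?_
  rw [sum_ite_ne]
  refine Finset.sum_congr rfl fun k _ => ?_
  split_ifs with h
  · rw [sum_nextHops P x i k h]
    simp only [h, true_and]
  · simp [h]

/-- A relay differs from source and destination, so at least three nodes are needed. -/
lemma relaySum_eq_zero {n : ℕ} (hn : n ≤ 2) (P : Params) (x : Fin n → Plane)
    (φ : Fin n → Fin n → Fin n → ℝ) : relaySum P x φ = 0 := by
  rcases n with _ | _ | _ | n
  · simp [relaySum]
  · simp [relaySum, Subsingleton.elim _ (0 : Fin 1)]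
  · rw [relaySum_add_two]
    simp
  · omega

open Classical in
/-- The restriction of a function of three points and a configuration to the points for which the
second is outside the transmission range of the first, and the third is in the half-disk. -/
def relayRestrict (R : ℝ) (F : Plane → Plane → Plane → Config → ℝ≥0∞) :
    Plane → Plane → Plane → Config → ℝ≥0∞ := fun u v w c =>
  if R < dist u v ∧ w ∈ halfDisk R u v then F u v w c else 0

open Classical in
lemma ofReal_relaySum_add_three {N : ℕ} (P : Params) (x : Fin (N + 3) → Plane)
    {φ : Fin (N + 3) → Fin (N + 3) → Fin (N + 3) → ℝ} (h0 : ∀ i d j, P.Rr < dist (x i) (x d) →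
      x j ∈ halfDisk P.Rr (x i) (x d) → 0 ≤ φ i d j) :
    ENNReal.ofReal (relaySum P x φ) = ∑ i, ∑ k, ∑ l,
      if P.Rr < dist (x i) (x (i.succAbove k)) ∧
        x (i.succAbove (k.succAbove l)) ∈ halfDisk P.Rr (x i) (x (i.succAbove k)) then
        ENNReal.ofReal (φ i (i.succAbove k) (i.succAbove (k.succAbove l))) else 0 := by
  have h : ∀ i k l, 0 ≤ if P.Rr < dist (x i) (x (i.succAbove k)) ∧
      x (i.succAbove (k.succAbove l)) ∈ halfDisk P.Rr (x i) (x (i.succAbove k)) then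
        φ i (i.succAbove k) (i.succAbove (k.succAbove l)) else 0 := fun i k l => by
    split_ifs with hc
    exacts [h0 _ _ _ hc.1 hc.2, le_rfl]
  rw [relaySum_add_two, ENNReal.ofReal_sum_of_nonneg fun i _ =>
    Finset.sum_nonneg fun k _ => Finset.sum_nonneg fun l _ => h i k l]
  refine Finset.sum_congr rfl fun i _ => ?_
  rw [ENNReal.ofReal_sum_of_nonneg fun k _ => Finset.sum_nonneg fun l _ => h i k l]
  refine Finset.sum_congr rfl fun k _ => ?_
  rw [ENNReal.ofReal_sum_of_nonneg fun l _ => h i k l]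
  refine Finset.sum_congr rfl fun l _ => ?_
  split_ifs <;> simp

/-- The points `x i`, `x (i.succAbove k)`, `x (i.succAbove (k.succAbove l))` and the others. -/
def tripleApply {N : ℕ} {γ : Type*} (F : Plane → Plane → Plane → Config → γ) (x : Fin (N + 3) → Plane)
    (i : Fin (N + 3)) (k : Fin (N + 2)) (l : Fin (N + 1)) : γ :=
  F (x i) (x (i.succAbove k)) (x (i.succAbove (k.succAbove l)))
    ⟨N, l.removeNth (k.removeNth (i.removeNth x))⟩

lemma palmSum_add_three {N : ℕ} (F : Plane → Plane → Plane → Config → ℝ≥0∞)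
    (x : Fin (N + 3) → Plane) :
    palmSum (fun u => palmSum fun v => palmSum (F u v)) ⟨N + 3, x⟩ =
      ∑ i, ∑ k, ∑ l, tripleApply F x i k l := rfl

/-- Writes the sum over distinct triples as an iterated `palmSum`, to which the Campbell-Mecke
formula for triples applies. The condition on `φ` and `F` is needed for admissible triples only. -/
lemma ofReal_relaySum_eq {P : Params} {φ : ∀ n, (Fin n → Plane) → Fin n → Fin n → Fin n → ℝ}
    {F : Plane → Plane → Plane → Config → ℝ≥0∞}
    (h0 : ∀ n x i d j, P.Rr < dist (x i) (x d) → x j ∈ halfDisk P.Rr (x i) (x d) → 0 ≤ φ n x i d j)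
    (hF : ∀ N (x : Fin (N + 3) → Plane) i k l,
      P.Rr < dist (x i) (x (i.succAbove k)) →
      x (i.succAbove (k.succAbove l)) ∈ halfDisk P.Rr (x i) (x (i.succAbove k)) →
      ENNReal.ofReal (φ (N + 3) x i (i.succAbove k) (i.succAbove (k.succAbove l))) =
        tripleApply F x i k l) {n : ℕ} (x : Fin n → Plane) :
    ENNReal.ofReal (relaySum P x (φ n x)) =
      palmSum (fun u => palmSum fun v => palmSum (relayRestrict P.Rr F u v)) ⟨n, x⟩ := by
  rcases n with _ | _ | _ | N
  · rw [relaySum_eq_zero (by omega)]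
    simp [palmSum]
  · rw [relaySum_eq_zero (by omega)]
    simp [palmSum]
  · rw [relaySum_eq_zero (by omega)]
    simp [palmSum]
  · rw [palmSum_add_three, ofReal_relaySum_add_three P x (h0 _ x)]
    refine Finset.sum_congr rfl fun i _ => Finset.sum_congr rfl fun k _ =>
      Finset.sum_congr rfl fun l _ => ?_
    rw [tripleApply, relayRestrict]
    split_ifs with hc
    · exact hF N x i k l hc.1 hc.2
    · rfl

/-- The version for error terms, for which only an upper bound by a function of the three points and
the others is available. -/
lemma ofReal_relaySum_le {P : Params} {φ : ∀ n, (Fin n → Plane) → Fin n → Fin n → Fin n → ℝ}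
    {F : Plane → Plane → Plane → Config → ℝ≥0∞}
    (h0 : ∀ n x i d j, P.Rr < dist (x i) (x d) → x j ∈ halfDisk P.Rr (x i) (x d) → 0 ≤ φ n x i d j)
    (hF : ∀ N (x : Fin (N + 3) → Plane) i k l,
      P.Rr < dist (x i) (x (i.succAbove k)) →
      x (i.succAbove (k.succAbove l)) ∈ halfDisk P.Rr (x i) (x (i.succAbove k)) →
      ENNReal.ofReal (φ (N + 3) x i (i.succAbove k) (i.succAbove (k.succAbove l))) ≤
        tripleApply F x i k l) {n : ℕ} (x : Fin n → Plane) :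
    ENNReal.ofReal (relaySum P x (φ n x)) ≤
      palmSum (fun u => palmSum fun v => palmSum (relayRestrict P.Rr F u v)) ⟨n, x⟩ := by
  rcases n with _ | _ | _ | N
  · rw [relaySum_eq_zero (by omega)]
    simp
  · rw [relaySum_eq_zero (by omega)]
    simp
  · rw [relaySum_eq_zero (by omega)]
    simp
  · rw [palmSum_add_three, ofReal_relaySum_add_three P x (h0 _ x)]
    refine Finset.sum_le_sum fun i _ => Finset.sum_le_sum fun k _ =>
      Finset.sum_le_sum fun l _ => ?_
    rw [tripleApply, relayRestrict]
    split_ifs with hc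
    · exact hF N x i k l hc.1 hc.2
    · rfl

open Classical in
lemma card_nextHops {N : ℕ} (P : Params) (x : Fin (N + 2) → Plane) (i : Fin (N + 2))
    (k : Fin (N + 1)) (h : P.Rr < dist (x i) (x (i.succAbove k))) :
    ((nextHops P x i (i.succAbove k)).card : ℝ) =
      configCount (halfDisk P.Rr (x i) (x (i.succAbove k)))
        ⟨N, k.removeNth (i.removeNth x)⟩ := by
  have := sum_nextHops P x i k h fun _ => 1
  rw [Finset.sum_const, nsmul_eq_mul, mul_one] at this
  rw [this]
  rfl

/-- Seen from one of its points, a configuration has `n - 1` other points. -/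
lemma ofReal_node_sum {n : ℕ} (x : Fin n → Plane) {C r : ℝ} (hC : 0 ≤ C) :
    ENNReal.ofReal (∑ _i : Fin n, C * |((n : ℝ) - 1) / r - 1|) = palmSum (fun _ c =>
      ENNReal.ofReal C * ENNReal.ofReal |configCount Set.univ c / r - 1|) ⟨n, x⟩ := by
  rcases n with _ | n
  · simp [palmSum]
  · rw [ENNReal.ofReal_sum_of_nonneg fun _ _ => by positivity, palmSum]
    refine Finset.sum_congr rfl fun i _ => ?_
    rw [ENNReal.ofReal_mul hC]
    simp [configCount]

open Classical in
lemma ofReal_pair_sum {n : ℕ} (P : Params) (x : Fin n → Plane) {C h : ℝ} (hC : 0 ≤ C) :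
    ENNReal.ofReal (∑ i, ∑ d, (if d = i then 0 else C * (if P.Rr < dist (x i) (x d) then
      |((nextHops P x i d).card : ℝ) / h - 1| else 1))) =
    palmSum (fun u => palmSum fun v c => ENNReal.ofReal C * (if P.Rr < dist u v then
      ENNReal.ofReal |configCount (halfDisk P.Rr u v) c / h - 1| else 1)) ⟨n, x⟩ := by
  rcases n with _ | _ | n
  · simp [palmSum]
  · simp [palmSum, Subsingleton.elim _ (0 : Fin 1)]
  · have hnn : ∀ i d, 0 ≤ C * (if P.Rr < dist (x i) (x d) then
        |((nextHops P x i d).card : ℝ) / h - 1| else 1) := fun i d => by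
      split_ifs <;> positivity
    simp only [palmSum]
    rw [ENNReal.ofReal_sum_of_nonneg fun i _ => Finset.sum_nonneg fun d _ => by
      split_ifs; exacts [le_rfl, mul_nonneg hC (abs_nonneg _), mul_nonneg hC zero_le_one]]
    refine Finset.sum_congr rfl fun i _ => ?_
    rw [sum_ite_ne, ENNReal.ofReal_sum_of_nonneg fun k _ => hnn _ _]
    refine Finset.sum_congr rfl fun k _ => ?_
    rw [ENNReal.ofReal_mul hC]
    congr 1
    simp only [Fin.removeNth_apply]
    split_ifs with hd
    · rw [card_nextHops P x i k hd]
      exact (if_pos hd).symm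
    · rw [ENNReal.ofReal_one]
      exact (if_neg hd).symm

end Comparison

/-! ### Geometry of the disk -/

section Disk

lemma volume_closedBall_ne_zero (z : Plane) {R : ℝ} (hR : 0 < R) :
    volume (Metric.closedBall z R) ≠ 0 :=
  (Metric.measure_closedBall_pos volume z hR).ne'

lemma volume_closedBall_ne_top (z : Plane) (R : ℝ) : volume (Metric.closedBall z R) ≠ ∞ :=
  measure_closedBall_lt_top.ne

lemma halfDisk_subset (R : ℝ) (u v : Plane) : halfDisk R u v ⊆ Metric.closedBall u R :=
  fun _ hw => hw.1

lemma measurableSet_halfDisk' (R : ℝ) (u v : Plane) : MeasurableSet (halfDisk R u v) :=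
  (measurable_prodMk_left (x := (u, v))) (measurableSet_halfDisk R)

lemma volume_line_eq_zero {u v : Plane} (h : u ≠ v) :
    volume {w : Plane | inner ℝ (w - u) (v - u) = 0} = 0 := by
  have hs : {w : Plane | inner ℝ (w - u) (v - u) = 0} =
      (AffineSubspace.mk' u (ℝ ∙ (v - u))ᗮ : AffineSubspace ℝ Plane) := by
    ext w
    rw [SetLike.mem_coe, AffineSubspace.mem_mk', Submodule.mem_orthogonal_singleton_iff_inner_left]
    rfl
  rw [hs]
  refine Measure.addHaar_affineSubspace _ _ fun htop => ?_
  have hv : v ∈ (AffineSubspace.mk' u (ℝ ∙ (v - u))ᗮ : AffineSubspace ℝ Plane) := by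
    rw [htop]; trivial
  rw [AffineSubspace.mem_mk', Submodule.mem_orthogonal_singleton_iff_inner_left, vsub_eq_sub,
    inner_self_eq_zero, sub_eq_zero] at hv
  exact h hv.symm

/-- The point reflection `w ↦ 2 u - w` exchanges the two halves of the disk, which overlap in a null
line. -/
lemma volume_real_halfDisk {R : ℝ} (hR : 0 ≤ R) {u v : Plane} (h : u ≠ v) :
    volume.real (halfDisk R u v) = π * R ^ 2 / 2 := by
  set D' : Set Plane := {w | dist w u ≤ R ∧ inner ℝ (w - u) (v - u) ≤ 0} with hD'
  have hm := measurableSet_halfDisk' R u v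
  have hpre : (fun w => (u + u) - w) ⁻¹' halfDisk R u v = D' := by
    ext w
    have e1 : u + u - w - u = -(w - u) := by abel
    simp only [halfDisk, hD', Set.mem_preimage, Set.mem_ofPred_eq, dist_eq_norm, e1, norm_neg,
      inner_neg_left, Left.nonneg_neg_iff]
  have hm' : MeasurableSet D' := by
    rw [← hpre]
    exact (measurable_const.sub measurable_id) hm
  have hvol : volume.real D' = volume.real (halfDisk R u v) := by
    rw [← hpre, measureReal_def, measureReal_def,
      (Measure.measurePreserving_sub_left volume (u + u)).measure_preimage hm.nullMeasurableSet]
  have hun : halfDisk R u v ∪ D' = Metric.closedBall u R := by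
    ext w
    simp only [halfDisk, hD', Set.mem_union, Set.mem_ofPred_eq, Metric.mem_closedBall]
    constructor
    · rintro (hw | hw) <;> exact hw.1
    · intro hw
      rcases le_total 0 (inner ℝ (w - u) (v - u)) with hi | hi
      · exact Or.inl ⟨hw, hi⟩
      · exact Or.inr ⟨hw, hi⟩
  have hint : volume.real (halfDisk R u v ∩ D') = 0 := by
    rw [measureReal_def, measure_mono_null (fun w hw => ?_) (volume_line_eq_zero h),
      ENNReal.toReal_zero]
    exact le_antisymm hw.2.2 hw.1.2
  have hfin : ∀ {S : Set Plane}, S ⊆ Metric.closedBall u R → volume S ≠ ∞ := fun hS =>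
    measure_ne_top_of_subset hS measure_closedBall_lt_top.ne
  have key := measureReal_union_add_inter (μ := volume) (s := halfDisk R u v) hm'
    (hfin (halfDisk_subset R u v)) (hfin fun w hw => hw.1)
  rw [hun, hint, hvol, volume_real_closedBall _ hR] at key
  linarith

/-- The uniform distribution on a disk. -/
def uniformDisk (rA : ℝ) : Measure Plane := volume[|Metric.closedBall (0 : Plane) rA]

lemma isProbabilityMeasure_uniformDisk {rA : ℝ} (hA : 0 < rA) :
    IsProbabilityMeasure (uniformDisk rA) :=
  cond_isProbabilityMeasure_of_finite (volume_closedBall_ne_zero 0 hA) (volume_closedBall_ne_top 0 rA)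

lemma uniformDisk_real {rA : ℝ} (hA : 0 < rA) {S : Set Plane} (hS : MeasurableSet S) :
    (uniformDisk rA).real S = (π * rA ^ 2)⁻¹ * volume.real (Metric.closedBall 0 rA ∩ S) := by
  rw [uniformDisk, real_cond_apply hS, volume_real_closedBall _ hA.le]

lemma closedBall_subset_disk {rA R : ℝ} {w : Plane} (h : ‖w‖ + R ≤ rA) :
    Metric.closedBall w R ⊆ Metric.closedBall 0 rA := by
  refine Metric.closedBall_subset_closedBall' ?_
  rw [dist_zero_right]
  linarith

lemma uniformDisk_real_closedBall_le {rA R : ℝ} (hA : 0 < rA) (hR : 0 ≤ R) (z : Plane) :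
    (uniformDisk rA).real (Metric.closedBall z R) ≤ R ^ 2 / rA ^ 2 := by
  rw [uniformDisk_real hA Metric.isClosed_closedBall.measurableSet]
  have := measureReal_mono (μ := volume) (Set.inter_subset_right
    (s := Metric.closedBall (0 : Plane) rA) (t := Metric.closedBall z R)) measure_closedBall_lt_top.ne
  rw [volume_real_closedBall _ hR] at this
  calc _ ≤ (π * rA ^ 2)⁻¹ * (π * R ^ 2) := mul_le_mul_of_nonneg_left this (by positivity)
    _ = _ := by
      have := Real.pi_pos
      field_simp

lemma uniformDisk_real_halfDisk_le {rA R : ℝ} (hA : 0 < rA) (hR : 0 ≤ R) {u v : Plane}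
    (h : u ≠ v) : (uniformDisk rA).real (halfDisk R u v) ≤ R ^ 2 / (2 * rA ^ 2) := by
  rw [uniformDisk_real hA (measurableSet_halfDisk' R u v)]
  have := measureReal_mono (μ := volume) (Set.inter_subset_right
    (s := Metric.closedBall (0 : Plane) rA) (t := halfDisk R u v))
    (measure_ne_top_of_subset (halfDisk_subset R u v) measure_closedBall_lt_top.ne)
  rw [volume_real_halfDisk hR h] at this
  calc _ ≤ (π * rA ^ 2)⁻¹ * (π * R ^ 2 / 2) := mul_le_mul_of_nonneg_left this (by positivity)
    _ = _ := by
      have := Real.pi_pos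
      field_simp

lemma uniformDisk_real_halfDisk {rA R : ℝ} (hA : 0 < rA) (hR : 0 ≤ R) {u v : Plane}
    (h : u ≠ v) (hu : ‖u‖ + R ≤ rA) :
    (uniformDisk rA).real (halfDisk R u v) = R ^ 2 / (2 * rA ^ 2) := by
  rw [uniformDisk_real hA (measurableSet_halfDisk' R u v),
    Set.inter_eq_right.2 ((halfDisk_subset R u v).trans (closedBall_subset_disk hu)),
    volume_real_halfDisk hR h]
  have := Real.pi_pos
  field_simp

/-- The points of the disk within distance `t` of the complement. -/
def nearBoundary (rA t : ℝ) : Set Plane := {u | rA < ‖u‖ + t}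

lemma measurableSet_nearBoundary (rA t : ℝ) : MeasurableSet (nearBoundary rA t) :=
  measurableSet_lt measurable_const (measurable_norm.add_const t)

/-- The mean number of points of a Poisson process on a disk. -/
def meanCount (rA lam : ℝ) : ℝ := lam * (π * rA ^ 2)

lemma poissonNodes_disk {rA lam : ℝ} (hA : 0 < rA) :
    poissonNodes (Metric.closedBall 0 rA) lam =
      poissonLaw (uniformDisk rA) (meanCount rA lam).toNNReal := by
  rw [poissonNodes_eq, volume_real_closedBall _ hA.le]
  rfl

end Disk

/-! ### Bounds for the errors of the comparison -/

section Errors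

variable {rA lam : ℝ}

/-- By the Campbell-Mecke formula the other points again form the same Poisson process, so the law
of large numbers applies without correction. -/
lemma lintegral_node_error (hA : 0 < rA) (hl : 0 < lam) {C : ℝ} (hC : 0 ≤ C) :
    ∫⁻ c, palmSum (fun _ c => ENNReal.ofReal C *
      ENNReal.ofReal |configCount Set.univ c / meanCount rA lam - 1|) c
        ∂poissonNodes (Metric.closedBall 0 rA) lam ≤
      ENNReal.ofReal (meanCount rA lam * C * (1 / √(meanCount rA lam))) := by
  have := isProbabilityMeasure_uniformDisk hA
  have hr : 0 < meanCount rA lam := by unfold meanCount; positivity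
  have hm : Measurable fun c => ENNReal.ofReal |configCount Set.univ c / meanCount rA lam - 1| := by
    have h0 := measurable_configCount' MeasurableSet.univ
    exact ((h0.div_const _).sub_const 1).norm.ennreal_ofReal
  rw [poissonNodes_disk hA, lintegral_palmSum]
  · simp only [lintegral_const, measure_univ, mul_one]
    rw [lintegral_const_mul _ hm, ENNReal.ofReal_mul (by positivity), ENNReal.ofReal_mul hr.le,
      mul_assoc]
    gcongr
    · rfl
    · exact lintegral_configCount_div_sub_one _ _ MeasurableSet.univ hr
        (by rw [Real.coe_toNNReal _ hr.le, probReal_univ, mul_one])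
  · exact (hm.const_mul _).comp measurable_snd

/-- For `u` away from the boundary the half-disk has mean count exactly `lam π R² / 2`, and the law
of large numbers gives the first term. Sources near the boundary contribute at most `2` each, and
destinations within range have probability at most `R² / rA²`. -/
lemma lintegral_pair_error (hA : 0 < rA) (hl : 0 < lam) {C R t : ℝ} (hC : 0 ≤ C) (hR : 0 < R)
    (ht : R ≤ t) :
    ∫⁻ c, palmSum (fun u => palmSum fun v c => ENNReal.ofReal C * (if R < dist u v then
      ENNReal.ofReal |configCount (halfDisk R u v) c / (lam * (π * R ^ 2 / 2)) - 1| else 1)) c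
        ∂poissonNodes (Metric.closedBall 0 rA) lam ≤
      ENNReal.ofReal (meanCount rA lam ^ 2 * C * (1 / √(lam * (π * R ^ 2 / 2)) +
        2 * (uniformDisk rA).real (nearBoundary rA t) + R ^ 2 / rA ^ 2)) := by
  have := isProbabilityMeasure_uniformDisk hA
  have hr : 0 < meanCount rA lam := by unfold meanCount; positivity
  set h := lam * (π * R ^ 2 / 2) with hh
  have hpos : 0 < h := by positivity
  have hrh : meanCount rA lam * (R ^ 2 / (2 * rA ^ 2)) = h := by
    rw [hh, meanCount]
    field_simp
  have hm : Measurable fun p : (Plane × Plane) × Config => if R < dist p.1.1 p.1.2 then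
      ENNReal.ofReal |configCount (halfDisk R p.1.1 p.1.2) p.2 / h - 1| else 1 := by
    have h0 : Measurable fun p : (Plane × Plane) × Config =>
        configCount (halfDisk R p.1.1 p.1.2) p.2 :=
      measurable_configCount (s := fun b : Plane × Plane => halfDisk R b.1 b.2)
        (measurableSet_halfDisk R)
    refine Measurable.ite (measurableSet_lt measurable_const
      (measurable_fst.fst.dist measurable_fst.snd)) ?_ measurable_const
    exact ((h0.div_const _).sub_const 1).norm.ennreal_ofReal
  rw [poissonNodes_disk hA, lintegral_palmSum₂ _ _ (hm.const_mul _)]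
  have hE : ∀ u v, ∫⁻ c, ENNReal.ofReal C * (if R < dist u v then
      ENNReal.ofReal |configCount (halfDisk R u v) c / h - 1| else 1)
        ∂poissonLaw (uniformDisk rA) (meanCount rA lam).toNNReal ≤
      ENNReal.ofReal C * (ENNReal.ofReal (1 / √h) + 2 * (nearBoundary rA t).indicator 1 u +
        (Metric.closedBall u R).indicator 1 v) := by
    intro u v
    rw [lintegral_const_mul' _ _ ENNReal.ofReal_ne_top]
    gcongr
    by_cases hd : R < dist u v
    · simp only [hd, if_true]
      have huv : u ≠ v := fun he => by
        rw [he, dist_self] at hd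
        linarith
      refine le_trans ?_ le_self_add
      by_cases hu : u ∈ nearBoundary rA t
      · rw [Set.indicator_of_mem hu]
        refine (lintegral_configCount_div_sub_one_le _ _ (measurableSet_halfDisk' R u v) hpos
          ?_).trans (by simp)
        rw [Real.coe_toNNReal _ hr.le, ← hrh]
        exact mul_le_mul_of_nonneg_left (uniformDisk_real_halfDisk_le hA hR.le huv) hr.le
      · refine le_trans ?_ le_self_add
        refine lintegral_configCount_div_sub_one _ _ (measurableSet_halfDisk' R u v) hpos ?_
        rw [Real.coe_toNNReal _ hr.le, ← hrh, uniformDisk_real_halfDisk hA hR.le huv]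
        have : ‖u‖ + t ≤ rA := not_lt.1 hu
        linarith
    · simp only [hd, if_false, lintegral_const, measure_univ, mul_one]
      have : v ∈ Metric.closedBall u R := by
        rw [Metric.mem_closedBall, dist_comm]
        exact not_lt.1 hd
      rw [Set.indicator_of_mem this]
      exact le_add_self
  have hv : ∀ u, ∫⁻ v, (ENNReal.ofReal (1 / √h) + 2 * (nearBoundary rA t).indicator 1 u +
      (Metric.closedBall u R).indicator 1 v) ∂uniformDisk rA ≤
      ENNReal.ofReal (1 / √h) + 2 * (nearBoundary rA t).indicator 1 u +
        ENNReal.ofReal (R ^ 2 / rA ^ 2) := by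
    intro u
    rw [lintegral_add_left measurable_const, lintegral_const, measure_univ, mul_one,
      lintegral_indicator_one Metric.isClosed_closedBall.measurableSet]
    gcongr
    rw [← ofReal_measureReal]
    exact ENNReal.ofReal_le_ofReal (uniformDisk_real_closedBall_le hA hR.le u)
  have hbd : Measurable ((nearBoundary rA t).indicator (1 : Plane → ℝ≥0∞)) :=
    measurable_one.indicator (measurableSet_nearBoundary rA t)
  calc _ ≤ ((meanCount rA lam).toNNReal : ℝ≥0∞) ^ 2 * ∫⁻ u, ENNReal.ofReal C *
        (ENNReal.ofReal (1 / √h) + 2 * (nearBoundary rA t).indicator 1 u +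
        ENNReal.ofReal (R ^ 2 / rA ^ 2)) ∂uniformDisk rA := by
        gcongr with u
        refine (lintegral_mono fun v => hE u v).trans ?_
        rw [lintegral_const_mul' _ _ ENNReal.ofReal_ne_top]
        gcongr
        exact hv u
    _ = _ := by
        rw [lintegral_const_mul' _ _ ENNReal.ofReal_ne_top, lintegral_add_right _ measurable_const,
          lintegral_add_left measurable_const, lintegral_const_mul _ hbd,
          lintegral_indicator_one (measurableSet_nearBoundary rA t), lintegral_const,
          lintegral_const, measure_univ, mul_one, mul_one, ENNReal.ofReal_mul (by positivity),
          ENNReal.ofReal_mul (by positivity), ENNReal.ofReal_add (by positivity) (by positivity),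
          ENNReal.ofReal_add (by positivity) (by positivity), ENNReal.ofReal_mul zero_le_two,
          ENNReal.ofReal_pow hr.le, ofReal_measureReal, mul_assoc]
        simp [ENNReal.ofReal]

end Errors

/-! ### Sums over triples of nodes -/

section Triples

variable {rA lam : ℝ}

lemma measurable_relayRestrict (R : ℝ) {F : Plane → Plane → Plane → Config → ℝ≥0∞}
    (hF : Measurable fun p : ((Plane × Plane) × Plane) × Config => F p.1.1.1 p.1.1.2 p.1.2 p.2) :
    Measurable fun p : ((Plane × Plane) × Plane) × Config =>
      relayRestrict R F p.1.1.1 p.1.1.2 p.1.2 p.2 := by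
  unfold relayRestrict
  have h1 : MeasurableSet {p : ((Plane × Plane) × Plane) × Config | R < dist p.1.1.1 p.1.1.2} :=
    measurableSet_lt measurable_const (measurable_fst.fst.fst.dist measurable_fst.fst.snd)
  exact Measurable.ite (h1.inter (measurable_fst (measurableSet_halfDisk R))) hF measurable_const

/-- Campbell-Mecke for triples, with the bound `D` for interior sources and `C` near the boundary.
The half-disk restricts the third point to probability at most `R² / (2 rA²)`, which turns one of
the three factors `meanCount` into the mean number of next hops. -/
lemma lintegral_palmSum_relayRestrict_le (hA : 0 < rA) (hl : 0 < lam) {R t C D : ℝ} (hR : 0 < R)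
    (hC : 0 ≤ C) (hD : 0 ≤ D) {F : Plane → Plane → Plane → Config → ℝ≥0∞}
    (hF : Measurable fun p : ((Plane × Plane) × Plane) × Config => F p.1.1.1 p.1.1.2 p.1.2 p.2)
    (hgood : ∀ u v w, ‖u‖ + t ≤ rA → w ∈ halfDisk R u v →
      ∫⁻ c, F u v w c ∂poissonNodes (Metric.closedBall 0 rA) lam ≤ ENNReal.ofReal D)
    (hbad : ∀ u v w, rA < ‖u‖ + t → w ∈ halfDisk R u v →
      ∫⁻ c, F u v w c ∂poissonNodes (Metric.closedBall 0 rA) lam ≤ ENNReal.ofReal C) :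
    ∫⁻ c, palmSum (fun u => palmSum fun v => palmSum (relayRestrict R F u v)) c
        ∂poissonNodes (Metric.closedBall 0 rA) lam ≤
      ENNReal.ofReal (meanCount rA lam ^ 2 * (lam * (π * R ^ 2 / 2)) *
        (D + C * (uniformDisk rA).real (nearBoundary rA t))) := by
  have := isProbabilityMeasure_uniformDisk hA
  have hr : 0 < meanCount rA lam := by unfold meanCount; positivity
  rw [poissonNodes_disk hA] at hgood hbad ⊢
  rw [lintegral_palmSum₃ _ _ (measurable_relayRestrict R hF)]
  have hE : ∀ u v w, ∫⁻ c, relayRestrict R F u v w c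
      ∂poissonLaw (uniformDisk rA) (meanCount rA lam).toNNReal ≤
      (if R < dist u v then (ENNReal.ofReal D + ENNReal.ofReal C * (nearBoundary rA t).indicator 1 u)
        else 0) * (halfDisk R u v).indicator 1 w := by
    intro u v w
    unfold relayRestrict
    by_cases h1 : R < dist u v
    · by_cases h2 : w ∈ halfDisk R u v
      · simp only [h1, h2, and_self, if_true, Set.indicator_of_mem, Pi.one_apply, mul_one]
        by_cases hu : u ∈ nearBoundary rA t
        · rw [Set.indicator_of_mem hu]
          refine (hbad u v w hu h2).trans ?_
          simp
        · exact (hgood u v w (not_lt.1 hu) h2).trans le_self_add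
      · simp [h2]
    · simp [h1]
  have hw : ∀ u v, ∫⁻ w, (if R < dist u v then
      (ENNReal.ofReal D + ENNReal.ofReal C * (nearBoundary rA t).indicator 1 u)
        else 0) * (halfDisk R u v).indicator 1 w ∂uniformDisk rA ≤
      (ENNReal.ofReal D + ENNReal.ofReal C * (nearBoundary rA t).indicator 1 u) *
        ENNReal.ofReal (R ^ 2 / (2 * rA ^ 2)) := by
    intro u v
    rw [lintegral_const_mul _ (measurable_one.indicator (measurableSet_halfDisk' R u v)),
      lintegral_indicator_one (measurableSet_halfDisk' R u v)]
    split_ifs with h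
    · gcongr
      rw [← ofReal_measureReal]
      refine ENNReal.ofReal_le_ofReal (uniformDisk_real_halfDisk_le hA hR.le fun he => ?_)
      rw [he, dist_self] at h
      linarith
    · simp
  have hbd : Measurable ((nearBoundary rA t).indicator (1 : Plane → ℝ≥0∞)) :=
    measurable_one.indicator (measurableSet_nearBoundary rA t)
  calc _ ≤ ((meanCount rA lam).toNNReal : ℝ≥0∞) ^ 3 * ∫⁻ u,
        (ENNReal.ofReal D + ENNReal.ofReal C * (nearBoundary rA t).indicator 1 u) *
        ENNReal.ofReal (R ^ 2 / (2 * rA ^ 2)) ∂uniformDisk rA := by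
        gcongr with u
        refine (lintegral_mono fun v => (lintegral_mono fun w => hE u v w).trans (hw u v)).trans ?_
        rw [lintegral_const, measure_univ, mul_one]
    _ = ENNReal.ofReal (meanCount rA lam ^ 3 *
        ((D + C * (uniformDisk rA).real (nearBoundary rA t)) * (R ^ 2 / (2 * rA ^ 2)))) := by
        rw [lintegral_mul_const' _ _ ENNReal.ofReal_ne_top, lintegral_add_left measurable_const,
          lintegral_const_mul _ hbd, lintegral_indicator_one (measurableSet_nearBoundary rA t),
          lintegral_const, measure_univ, mul_one, ENNReal.ofReal_mul (by positivity),
          ENNReal.ofReal_mul (by positivity), ENNReal.ofReal_add hD (by positivity),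
          ENNReal.ofReal_mul hC, ENNReal.ofReal_pow hr.le, ofReal_measureReal]
        rfl
    _ = _ := by
        congr 1
        unfold meanCount
        field_simp

end Triples

/-! ### The second moment of the uncovered area as a function of the configuration -/

section CoverVariance

/-- The configuration enters only through products over its points, so their labelling does not
matter. -/
lemma coverVariance_congr (q RD p R : ℝ) (u w : Plane) {c c' : Config}
    (h : ∀ f, configProd f c = configProd f c') :
    coverVariance q RD p R u w c = coverVariance q RD p R u w c' := by
  unfold coverVariance pairUncovered
  simp_rw [h]

/-- With `u` added as an extra node this is the mean of a square; the factor `q` is the probability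
that `u` transmits. -/
lemma coverVariance_nonneg (q : unitInterval) (RD p R : ℝ) (u w : Plane) (c : Config) :
    0 ≤ q * coverVariance q RD p R u w c := by
  have h := expect_uncovered_area_sq q RD p R (Fin.cons u c.2 : Fin (c.1 + 1) → Plane) 0 w
  rw [Fin.cons_zero] at h
  have hc : (⟨c.1, Fin.removeNth 0 (Fin.cons u c.2 : Fin (c.1 + 1) → Plane)⟩ : Config) = c := by
    rw [Fin.removeNth_zero, Fin.tail_cons]
  rw [hc] at h
  rw [← h]
  exact expect_nonneg _ fun a => by split_ifs <;> positivity

/-- The domain of integration moves with the receiver; putting it into an indicator gives an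
integral of a jointly measurable function over a fixed space. -/
lemma measurable_coverVariance (q RD p R : ℝ) : Measurable
    fun b : ((Plane × Plane) × Plane) × Config =>
      coverVariance q RD p R b.1.1.1 b.1.2 (addPoint b.1.1.2 (addPoint b.1.2 b.2)) := by
  set I : (((Plane × Plane) × Plane) × Config) × (Plane × Plane) → ℝ := fun b =>
    if dist b.2.1 b.1.1.2 ≤ R ∧ dist b.2.2 b.1.1.2 ≤ R then
      pairUncovered q RD b.2 b.1.1.1.1 (addPoint b.1.1.1.2 (addPoint b.1.1.2 b.1.2)) -
      p * pairUncovered q RD (b.2.1, b.2.1) b.1.1.1.1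
        (addPoint b.1.1.1.2 (addPoint b.1.1.2 b.1.2)) -
      p * pairUncovered q RD (b.2.2, b.2.2) b.1.1.1.1
        (addPoint b.1.1.1.2 (addPoint b.1.1.2 b.1.2)) + p ^ 2 else 0 with hI
  have hIm : Measurable I := by
    have m0 : Measurable fun b : (((Plane × Plane) × Plane) × Config) × (Plane × Plane) =>
        (b.1.1.2, b.1.2) := by fun_prop
    have m1 : Measurable fun b : (((Plane × Plane) × Plane) × Config) × (Plane × Plane) =>
        addPoint b.1.1.2 b.1.2 := measurable_addPoint.comp m0
    have m2 : Measurable fun b : (((Plane × Plane) × Plane) × Config) × (Plane × Plane) =>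
        (b.1.1.1.2, addPoint b.1.1.2 b.1.2) :=
      (measurable_fst.fst.fst.snd).prodMk m1
    have m3 : Measurable fun b : (((Plane × Plane) × Plane) × Config) × (Plane × Plane) =>
        addPoint b.1.1.1.2 (addPoint b.1.1.2 b.1.2) := measurable_addPoint.comp m2
    have m4 : Measurable fun b : (((Plane × Plane) × Plane) × Config) × (Plane × Plane) =>
        ((b.2, b.1.1.1.1), addPoint b.1.1.1.2 (addPoint b.1.1.2 b.1.2)) :=
      (measurable_snd.prodMk measurable_fst.fst.fst.fst).prodMk m3
    have hp := (measurable_coverIntegrand q RD p).comp m4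
    have s1 : MeasurableSet {b : (((Plane × Plane) × Plane) × Config) × (Plane × Plane) |
        dist b.2.1 b.1.1.2 ≤ R} :=
      measurableSet_le (measurable_snd.fst.dist measurable_fst.fst.snd) measurable_const
    have s2 : MeasurableSet {b : (((Plane × Plane) × Plane) × Config) × (Plane × Plane) |
        dist b.2.2 b.1.1.2 ≤ R} :=
      measurableSet_le (measurable_snd.snd.dist measurable_fst.fst.snd) measurable_const
    exact Measurable.ite (s1.inter s2) hp measurable_const
  have h2 := (hIm.stronglyMeasurable.integral_prod_right' (ν := (volume : Measure (Plane × Plane)))).measurable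
  convert h2 using 2 with b
  unfold coverVariance
  rw [Measure.prod_restrict, ← integral_indicator (Metric.isClosed_closedBall.measurableSet.prod
    Metric.isClosed_closedBall.measurableSet), ← Measure.volume_eq_prod]
  refine integral_congr_ae (.of_forall fun z => ?_)
  simp only [hI, Set.indicator, Set.mem_prod, Metric.mem_closedBall]

lemma abs_coverVariance_le (q : unitInterval) (RD : ℝ) {p R : ℝ} (hp0 : 0 ≤ p) (hp1 : p ≤ 1)
    (hR : 0 ≤ R) (u w : Plane) (c : Config) :
    |coverVariance q RD p R u w c| ≤ 2 * (π * R ^ 2) ^ 2 := by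
  unfold coverVariance
  set μ : Measure Plane := volume.restrict (Metric.closedBall w R) with hμ
  have hμu : μ Set.univ = ENNReal.ofReal (π * R ^ 2) := by
    rw [hμ, Measure.restrict_apply_univ, ← volume_real_closedBall w hR, ofReal_measureReal
      measure_closedBall_lt_top.ne]
  have hfin : IsFiniteMeasure μ := ⟨by rw [hμu]; exact ENNReal.ofReal_lt_top⟩
  rw [← Real.norm_eq_abs]
  refine (norm_integral_le_of_norm_le_const (C := 2) (.of_forall fun z => ?_)).trans_eq ?_
  · exact abs_coverIntegrand_le q RD hp0 hp1 z u c
  rw [measureReal_def, ← Set.univ_prod_univ, Measure.prod_prod, hμu, ENNReal.toReal_mul,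
    ENNReal.toReal_ofReal (by positivity)]
  ring

end CoverVariance

/-! ### Effect of the secondary nodes on the hops -/

section Secondary

variable {rA lam : ℝ}

/-- The probability that no primary transmitter is detected at a location. -/
def idleProb (lam q RD : ℝ) : ℝ := rexp (-(lam * q * (π * RD ^ 2)))

lemma idleProb_pos (lam q RD : ℝ) : 0 < idleProb lam q RD := Real.exp_pos _

lemma idleProb_le_one {lam q : ℝ} (hl : 0 ≤ lam) (hq : 0 ≤ q) (RD : ℝ) : idleProb lam q RD ≤ 1 :=
  Real.exp_le_one_iff.2 (neg_nonpos.2 (by positivity))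

/-- The probability that no secondary node transmits in the interference range of a receiver, if
the secondary nodes have density `kap` and each of them transmits with probability `p`. -/
def silenceProb (kap p R : ℝ) : ℝ := rexp (-(kap * (p * (π * R ^ 2))))

/-- The mean number of next hops of a packet at an interior point. -/
def meanHops (lam R : ℝ) : ℝ := lam * (π * R ^ 2 / 2)

/-- A bound for the mean second moment of the uncovered area. -/
def coverBound (q RD R : ℝ) : ℝ := 4 * q * (π * R ^ 2) ^ 2 + 12 * (π * RD ^ 2) * (π * R ^ 2)

open Classical in
/-- A bound for the effect of the secondary nodes on the probability of a successful hop. -/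
def hopError (P : Params) (rA lam kap e t : ℝ) (u v w : Plane) (c : Config) : ℝ :=
  if ‖u‖ + t ≤ rA then P.qp * (e / 2) + kap ^ 2 / (2 * e) *
    (P.qp * coverVariance P.qp P.RD (idleProb lam P.qp P.RD) P.RIsp u w
      (addPoint v (addPoint w c))) else P.qp

lemma measurable_hopError (P : Params) (rA lam kap e t : ℝ) :
    Measurable fun p : ((Plane × Plane) × Plane) × Config =>
      hopError P rA lam kap e t p.1.1.1 p.1.1.2 p.1.2 p.2 := by
  have h1 : MeasurableSet {p : ((Plane × Plane) × Plane) × Config | ‖p.1.1.1‖ + t ≤ rA} :=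
    measurableSet_le (measurable_fst.fst.fst.norm.add_const t) measurable_const
  have h2 := measurable_coverVariance P.qp P.RD (idleProb lam P.qp P.RD) P.RIsp
  exact Measurable.ite h1 (((h2.const_mul _).const_mul _).const_add _) measurable_const

/-- If the source is at distance at least `t` from the boundary, the interference disk of the
receiver lies in the region. Otherwise both quantities lie in `[0, qp]`. -/
lemma abs_meanHopSuccess_sub_le_hopError (P : Params) {kap e t : ℝ} (hl : 0 ≤ lam) (hk : 0 ≤ kap)
    (he : 0 < e) (hRsp : 0 ≤ P.RIsp) (hRD : 0 ≤ P.RD) (ht : P.Rr + P.RIsp + P.RD ≤ t) {N : ℕ}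
    (x : Fin (N + 3) → Plane) (i : Fin (N + 3)) (k : Fin (N + 2)) (l : Fin (N + 1))
    (hj : x (i.succAbove (k.succAbove l)) ∈ halfDisk P.Rr (x i) (x (i.succAbove k))) :
    |meanHopSuccess P (Metric.closedBall 0 rA) kap x i (i.succAbove (k.succAbove l)) -
      silenceProb kap (idleProb lam P.qp P.RD) P.RIsp *
        meanHopSuccess P (Metric.closedBall 0 rA) 0 x i (i.succAbove (k.succAbove l))| ≤
      tripleApply (hopError P rA lam kap e t) x i k l := by
  set j := i.succAbove (k.succAbove l) with hjd
  unfold tripleApply hopError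
  have hp0 := (idleProb_pos lam P.qp P.RD).le
  have hp1 := idleProb_le_one hl P.qp.2.1 P.RD
  split_ifs with h
  · have hw : ‖x j‖ + P.RIsp + P.RD ≤ rA := by
      have h1 := norm_sub_norm_le (x j) (x i)
      rw [← dist_eq_norm] at h1
      have := hj.1
      linarith
    have hsub : Metric.closedBall (x j) P.RIsp ⊆ Metric.closedBall 0 rA :=
      closedBall_subset_disk (by linarith)
    have := abs_meanHopSuccess_sub_le P hk hp0 he x i j hsub
    rw [volume_real_closedBall _ hRsp] at this
    refine this.trans_eq ?_
    rw [mul_add, mul_left_comm]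
    congr 3
    -- Removing the source and listing destination and receiver first only relabels the remaining
    -- points.
    refine coverVariance_congr _ _ _ _ _ _ fun f => ?_
    rw [configProd_succ f (i.removeNth x) k, configProd_addPoint, configProd_addPoint,
      configProd_succ f (k.removeNth (i.removeNth x)) l, configProd_addPoint]
    rw [configProd_addPoint]
    rfl
  · have a0 := meanHopSuccess_nonneg P (Metric.closedBall 0 rA) kap x i j
    have a1 := meanHopSuccess_le P (Metric.closedBall 0 rA) hk x i j
    have b0 := meanHopSuccess_nonneg P (Metric.closedBall 0 rA) 0 x i j
    have b1 := meanHopSuccess_le P (Metric.closedBall 0 rA) le_rfl x i j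
    have s0 : 0 ≤ silenceProb kap (idleProb lam P.qp P.RD) P.RIsp := (Real.exp_pos _).le
    have s1 : silenceProb kap (idleProb lam P.qp P.RD) P.RIsp ≤ 1 :=
      Real.exp_le_one_iff.2 (neg_nonpos.2 (by positivity))
    have c0 := mul_nonneg s0 b0
    have c1 := mul_le_mul s1 b1 b0 zero_le_one
    rw [abs_le]
    constructor <;> linarith

lemma hopError_nonneg (P : Params) {kap e t : ℝ} (he : 0 < e) (u v w : Plane) (c : Config) :
    0 ≤ hopError P rA lam kap e t u v w c := by
  have hq := P.qp.2.1
  unfold hopError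
  split_ifs
  · have := coverVariance_nonneg P.qp P.RD (idleProb lam P.qp P.RD) P.RIsp u w
      (addPoint v (addPoint w c))
    positivity
  · exact hq

lemma lintegral_hopError_le (hA : 0 < rA) (hl : 0 ≤ lam) (P : Params) {kap e t : ℝ}
    (he : 0 < e) (hRsp : 0 ≤ P.RIsp) (hRD : 0 ≤ P.RD) (ht : P.Rr + P.RIsp + P.RD ≤ t)
    (u v w : Plane) (hu : ‖u‖ + t ≤ rA) (hw : w ∈ halfDisk P.Rr u v) :
    ∫⁻ c, ENNReal.ofReal (hopError P rA lam kap e t u v w c)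
      ∂poissonNodes (Metric.closedBall 0 rA) lam ≤
      ENNReal.ofReal (P.qp * (e / 2 + kap ^ 2 / (2 * e) * coverBound P.qp P.RD P.RIsp)) := by
  have hq := P.qp.2.1
  have := isProbabilityMeasure_uniformDisk hA
  have hpr : IsProbabilityMeasure (poissonNodes (Metric.closedBall 0 rA) lam) := by
    rw [poissonNodes_disk hA]; infer_instance
  have hp0 := (idleProb_pos lam P.qp P.RD).le
  have hp1 := idleProb_le_one hl P.qp.2.1 P.RD
  have hV : Integrable (fun c => coverVariance P.qp P.RD (idleProb lam P.qp P.RD) P.RIsp u w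
      (addPoint v (addPoint w c))) (poissonNodes (Metric.closedBall 0 rA) lam) := by
    refine Integrable.of_bound (C := 2 * (π * P.RIsp ^ 2) ^ 2) (Measurable.aestronglyMeasurable ?_)
      (.of_forall fun c => ?_)
    · have h1 : Measurable fun c : Config => (((u, v), w), c) := measurable_const.prodMk measurable_id
      exact (measurable_coverVariance P.qp P.RD (idleProb lam P.qp P.RD) P.RIsp).comp h1
    · exact abs_coverVariance_le P.qp P.RD hp0 hp1 hRsp u w _
  have hV2 : Integrable (fun c => kap ^ 2 / (2 * e) * (P.qp * coverVariance P.qp P.RD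
      (idleProb lam P.qp P.RD) P.RIsp u w (addPoint v (addPoint w c))))
      (poissonNodes (Metric.closedBall 0 rA) lam) := (hV.const_mul _).const_mul _
  have hE : (fun c => hopError P rA lam kap e t u v w c) = fun c => P.qp * (e / 2) +
      kap ^ 2 / (2 * e) * (P.qp * coverVariance P.qp P.RD (idleProb lam P.qp P.RD) P.RIsp u w
      (addPoint v (addPoint w c))) := by
    ext c
    exact if_pos hu
  have hI : Integrable (fun c => hopError P rA lam kap e t u v w c)
      (poissonNodes (Metric.closedBall 0 rA) lam) := by
    rw [hE]
    exact (integrable_const _).add hV2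
  rw [← ofReal_integral_eq_lintegral_ofReal hI (.of_forall fun c => hopError_nonneg P he u v w c),
    hE]
  refine ENNReal.ofReal_le_ofReal ?_
  rw [integral_add (integrable_const _) hV2, integral_const_mul, integral_const_mul,
    integral_const_mul, integral_const, probReal_univ, one_smul]
  have hb := integral_coverVariance_le (volume_closedBall_ne_zero 0 hA)
    (volume_closedBall_ne_top 0 rA) hl P.qp hRD hRsp u v w (fun z hz => closedBall_subset_disk (by
      have h1 := norm_sub_norm_le w u
      have h2 := norm_sub_norm_le z w
      rw [← dist_eq_norm] at h1 h2
      have h3 := hw.1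
      have h4 := Metric.mem_closedBall.1 hz
      linarith)) (p := idleProb lam P.qp P.RD) rfl
  have hk : 0 ≤ kap ^ 2 / (2 * e) := by positivity
  rw [mul_add, mul_left_comm (P.qp : ℝ) (kap ^ 2 / (2 * e))]
  exact add_le_add le_rfl (mul_le_mul_of_nonneg_left (mul_le_mul_of_nonneg_left hb hq) hk)

/-- The weight `Rr / (meanCount * meanHops)` cancels against the number of triples, so the total
error is the natural scale `meanCount * qp * Rr` times the relative error of one hop. -/
lemma lintegral_relay_error (hA : 0 < rA) (hl : 0 < lam) (P : Params) {kap e t : ℝ} (hk : 0 ≤ kap)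
    (he : 0 < e) (hR : 0 < P.Rr) (hRsp : 0 ≤ P.RIsp) (hRD : 0 ≤ P.RD)
    (ht : P.Rr + P.RIsp + P.RD ≤ t) :
    ∫⁻ c : Config, ENNReal.ofReal (relaySum P c.2 fun i _ j =>
      P.Rr / (meanCount rA lam * meanHops lam P.Rr) *
        |meanHopSuccess P (Metric.closedBall 0 rA) kap c.2 i j -
          silenceProb kap (idleProb lam P.qp P.RD) P.RIsp *
            meanHopSuccess P (Metric.closedBall 0 rA) 0 c.2 i j|)
        ∂poissonNodes (Metric.closedBall 0 rA) lam ≤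
      ENNReal.ofReal (meanCount rA lam * (P.qp * P.Rr) * (e / 2 + kap ^ 2 / (2 * e) *
        coverBound P.qp P.RD P.RIsp + (uniformDisk rA).real (nearBoundary rA t))) := by
  have hq := P.qp.2.1
  have := isProbabilityMeasure_uniformDisk hA
  have hpr : IsProbabilityMeasure (poissonNodes (Metric.closedBall 0 rA) lam) := by
    rw [poissonNodes_disk hA]; infer_instance
  have hr : 0 < meanCount rA lam := by unfold meanCount; positivity
  have hh : 0 < meanHops lam P.Rr := by unfold meanHops; positivity
  set C := P.Rr / (meanCount rA lam * meanHops lam P.Rr) with hC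
  have hC0 : 0 < C := by positivity
  have hb : 0 ≤ coverBound P.qp P.RD P.RIsp := by unfold coverBound; positivity
  set F : Plane → Plane → Plane → Config → ℝ≥0∞ := fun u v w c =>
    ENNReal.ofReal C * ENNReal.ofReal (hopError P rA lam kap e t u v w c) with hF
  have hFm : Measurable fun p : ((Plane × Plane) × Plane) × Config =>
      F p.1.1.1 p.1.1.2 p.1.2 p.2 :=
    (measurable_hopError P rA lam kap e t).ennreal_ofReal.const_mul _
  have hle : ∀ c : Config, ENNReal.ofReal (relaySum P c.2 fun i _ j =>
      C * |meanHopSuccess P (Metric.closedBall 0 rA) kap c.2 i j -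
          silenceProb kap (idleProb lam P.qp P.RD) P.RIsp *
            meanHopSuccess P (Metric.closedBall 0 rA) 0 c.2 i j|) ≤
      palmSum (fun u => palmSum fun v => palmSum (relayRestrict P.Rr F u v)) c := fun c => by
    refine ofReal_relaySum_le (P := P) (φ := fun n x i _ j =>
      C * |meanHopSuccess P (Metric.closedBall 0 rA) kap x i j -
          silenceProb kap (idleProb lam P.qp P.RD) P.RIsp *
            meanHopSuccess P (Metric.closedBall 0 rA) 0 x i j|) (F := F) ?_ ?_ c.2
    · intro n x i d j _ _
      positivity
    · intro N x i k l _ hj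
      rw [ENNReal.ofReal_mul hC0.le]
      exact mul_le_mul_right (ENNReal.ofReal_le_ofReal
        (abs_meanHopSuccess_sub_le_hopError P hl.le hk he hRsp hRD ht x i k l hj)) _
  refine (lintegral_mono hle).trans ?_
  refine (lintegral_palmSum_relayRestrict_le (t := t) (C := C * P.qp)
    (D := C * (P.qp * (e / 2 + kap ^ 2 / (2 * e) * coverBound P.qp P.RD P.RIsp))) hA hl hR
    (by positivity) (by positivity) hFm ?_ ?_).trans_eq ?_
  · intro u v w hu hw
    rw [lintegral_const_mul' _ _ ENNReal.ofReal_ne_top, ENNReal.ofReal_mul hC0.le]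
    exact mul_le_mul_right (lintegral_hopError_le hA hl.le P he hRsp hRD ht u v w hu hw) _
  · intro u v w hu hw
    rw [lintegral_const_mul' _ _ ENNReal.ofReal_ne_top, ENNReal.ofReal_mul hC0.le]
    refine mul_le_mul_right ?_ _
    have : ∀ c, hopError P rA lam kap e t u v w c = P.qp := fun c => if_neg (not_le.2 hu)
    simp_rw [this]
    rw [lintegral_const, measure_univ, mul_one]
  · congr 1
    rw [hC]
    unfold meanHops at hh ⊢
    field_simp

end Secondary

/-! ### The mean of a sum over triples of nodes -/

section Mean

variable {rA lam : ℝ}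

/-- The set of triples of points for which the second is outside the transmission range of the
first, and the third is in the half-disk. -/
def relayTriples (R : ℝ) : Set ((Plane × Plane) × Plane) :=
  {p | R < dist p.1.1 p.1.2 ∧ p.2 ∈ halfDisk R p.1.1 p.1.2}

lemma measurableSet_relayTriples (R : ℝ) : MeasurableSet (relayTriples R) :=
  MeasurableSet.inter (s₁ := {p : (Plane × Plane) × Plane | R < dist p.1.1 p.1.2})
    (measurableSet_lt measurable_const (measurable_fst.fst.dist measurable_fst.snd))
    (measurableSet_halfDisk R)

/-- The law of three independent uniformly distributed points. -/
def tripleLaw (rA : ℝ) : Measure ((Plane × Plane) × Plane) :=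
  ((uniformDisk rA).prod (uniformDisk rA)).prod (uniformDisk rA)

lemma isProbabilityMeasure_tripleLaw (hA : 0 < rA) : IsProbabilityMeasure (tripleLaw rA) := by
  have := isProbabilityMeasure_uniformDisk hA
  unfold tripleLaw
  infer_instance

/-- Passes through the lower integral, for which the Campbell-Mecke formula holds without
integrability. Nonnegativity is thus essential, and the bound `C` makes everything finite. -/
lemma integral_relaySum (hA : 0 < rA) (hl : 0 < lam) {P : Params} {C : ℝ}
    {φ : ∀ n, (Fin n → Plane) → Fin n → Fin n → Fin n → ℝ}
    {K : Plane → Plane → Plane → Config → ℝ}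
    (hKm : Measurable fun p : ((Plane × Plane) × Plane) × Config => K p.1.1.1 p.1.1.2 p.1.2 p.2)
    (hK0 : ∀ u v w c, ((u, v), w) ∈ relayTriples P.Rr → 0 ≤ K u v w c)
    (hKC : ∀ u v w c, ((u, v), w) ∈ relayTriples P.Rr → K u v w c ≤ C)
    (h0 : ∀ n x i d j, P.Rr < dist (x i) (x d) → x j ∈ halfDisk P.Rr (x i) (x d) → 0 ≤ φ n x i d j)
    (hK : ∀ N (x : Fin (N + 3) → Plane) i k l,
      φ (N + 3) x i (i.succAbove k) (i.succAbove (k.succAbove l)) = tripleApply K x i k l) :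
    Integrable (fun c : Config => relaySum P c.2 (φ c.1 c.2))
      (poissonNodes (Metric.closedBall 0 rA) lam) ∧
    ∫ c : Config, relaySum P c.2 (φ c.1 c.2) ∂poissonNodes (Metric.closedBall 0 rA) lam =
      meanCount rA lam ^ 3 * ∫ p, (relayTriples P.Rr).indicator
        (fun p => ∫ c, K p.1.1 p.1.2 p.2 c ∂poissonNodes (Metric.closedBall 0 rA) lam) p
        ∂tripleLaw rA ∧
    Integrable ((relayTriples P.Rr).indicator
        (fun p => ∫ c, K p.1.1 p.1.2 p.2 c ∂poissonNodes (Metric.closedBall 0 rA) lam))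
      (tripleLaw rA) := by
  classical
  have := isProbabilityMeasure_uniformDisk hA
  have := isProbabilityMeasure_tripleLaw hA
  have hr : 0 < meanCount rA lam := by unfold meanCount; positivity
  have hpr : IsProbabilityMeasure (poissonNodes (Metric.closedBall 0 rA) lam) := by
    rw [poissonNodes_disk hA]; infer_instance
  set μ := poissonNodes (Metric.closedBall 0 rA) lam with hμ
  set g : (Plane × Plane) × Plane → ℝ := (relayTriples P.Rr).indicator
    (fun p => ∫ c, K p.1.1 p.1.2 p.2 c ∂μ) with hg
  set F : Plane → Plane → Plane → Config → ℝ≥0∞ := fun u v w c => ENNReal.ofReal (K u v w c) with hF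
  have hFm : Measurable fun p : ((Plane × Plane) × Plane) × Config =>
      F p.1.1.1 p.1.1.2 p.1.2 p.2 := hKm.ennreal_ofReal
  have hgm : Measurable g :=
    (hKm.stronglyMeasurable.integral_prod_right' (ν := μ)).measurable.indicator
      (measurableSet_relayTriples _)
  have hg0 : ∀ p, 0 ≤ g p := fun p => by
    rw [hg, Set.indicator_apply]
    split_ifs with h
    · exact integral_nonneg fun c => hK0 _ _ _ _ h
    · rfl
  have hgC : ∀ p, g p ≤ max C 0 := fun p => by
    rw [hg, Set.indicator_apply]
    split_ifs with h
    · have := norm_integral_le_of_norm_le_const (μ := μ) (f := fun c => K p.1.1 p.1.2 p.2 c) (C := C)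
        (.of_forall fun c => by rw [Real.norm_of_nonneg (hK0 _ _ _ _ h)]; exact hKC _ _ _ _ h)
      rw [probReal_univ, mul_one] at this
      exact (le_abs_self _).trans (this.trans (le_max_left _ _))
    · exact le_max_right _ _
  have hH : ∀ u v w, ∫⁻ c, relayRestrict P.Rr F u v w c ∂μ = ENNReal.ofReal (g ((u, v), w)) := by
    intro u v w
    by_cases h : ((u, v), w) ∈ relayTriples P.Rr
    · have e1 : ∀ c, relayRestrict P.Rr F u v w c = ENNReal.ofReal (K u v w c) := fun c => if_pos h
      have e2 : g ((u, v), w) = ∫ c, K u v w c ∂μ := Set.indicator_of_mem h _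
      have hc : Measurable fun c : Config => (((u, v), w), c) := measurable_const.prodMk measurable_id
      have hKc : Measurable fun c : Config => K u v w c := hKm.comp hc
      simp_rw [e1, e2]
      refine (ofReal_integral_eq_lintegral_ofReal (Integrable.of_bound (C := C)
        hKc.aestronglyMeasurable (.of_forall fun c => ?_)) (.of_forall fun c => hK0 _ _ _ _ h)).symm
      rw [Real.norm_of_nonneg (hK0 _ _ _ _ h)]
      exact hKC _ _ _ _ h
    · have e1 : ∀ c, relayRestrict P.Rr F u v w c = 0 := fun c => if_neg h
      have e2 : g ((u, v), w) = 0 := Set.indicator_of_notMem h _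
      simp [e1, e2]
  have hnn : ∀ c : Config, 0 ≤ relaySum P c.2 (φ c.1 c.2) := fun c => by
    refine Finset.sum_nonneg fun i _ => Finset.sum_nonneg fun d _ => ?_
    split_ifs with h1 h2
    · rfl
    · exact Finset.sum_nonneg fun j hj => h0 _ _ _ _ _ h2 ((mem_nextHops_iff h2 j).1 hj).2
    · rfl
  have hof : ∀ c : Config, ENNReal.ofReal (relaySum P c.2 (φ c.1 c.2)) =
      palmSum (fun u => palmSum fun v => palmSum (relayRestrict P.Rr F u v)) c := fun c =>
    ofReal_relaySum_eq h0 (fun N x i k l _ _ => by rw [hK]; rfl) c.2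
  have hpm : Measurable fun c =>
      palmSum (fun u => palmSum fun v => palmSum (relayRestrict P.Rr F u v)) c := by
    have h1 : Measurable fun p : (Plane × Plane) × Config =>
        palmSum (relayRestrict P.Rr F p.1.1 p.1.2) p.2 :=
      measurable_palmSum (F := fun b : Plane × Plane => relayRestrict P.Rr F b.1 b.2)
        (measurable_relayRestrict P.Rr hFm)
    have h2 : Measurable fun p : Plane × Config =>
        palmSum (fun v => palmSum (relayRestrict P.Rr F p.1 v)) p.2 :=
      measurable_palmSum (F := fun u v => palmSum (relayRestrict P.Rr F u v)) h1
    exact measurable_palmSum' h2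
  have hm : Measurable fun c : Config => relaySum P c.2 (φ c.1 c.2) := by
    have : (fun c : Config => relaySum P c.2 (φ c.1 c.2)) = fun c => (palmSum (fun u =>
        palmSum fun v => palmSum (relayRestrict P.Rr F u v)) c).toReal := by
      ext c
      rw [← hof c, ENNReal.toReal_ofReal (hnn c)]
    rw [this]
    exact hpm.ennreal_toReal
  have hgi : Integrable g (tripleLaw rA) := Integrable.of_bound (C := max C 0)
    hgm.aestronglyMeasurable (.of_forall fun p => by
      rw [Real.norm_of_nonneg (hg0 p)]; exact hgC p)
  have hlin : ∫⁻ c : Config, ENNReal.ofReal (relaySum P c.2 (φ c.1 c.2)) ∂μ =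
      ENNReal.ofReal (meanCount rA lam ^ 3 * ∫ p, g p ∂tripleLaw rA) := by
    simp_rw [hof]
    rw [ENNReal.ofReal_mul (by positivity), ofReal_integral_eq_lintegral_ofReal hgi (.of_forall hg0),
      tripleLaw, lintegral_prod _ hgm.ennreal_ofReal.aemeasurable,
      lintegral_prod _ hgm.ennreal_ofReal.lintegral_prod_right'.aemeasurable]
    simp_rw [← hH]
    rw [hμ, poissonNodes_disk hA, lintegral_palmSum₃ _ _ (measurable_relayRestrict P.Rr hFm),
      ENNReal.ofReal_pow hr.le]
    rfl
  have hI0 : 0 ≤ ∫ p, g p ∂tripleLaw rA := integral_nonneg hg0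
  refine ⟨⟨hm.aestronglyMeasurable, ?_⟩, ?_, hgi⟩
  · rw [hasFiniteIntegral_iff_ofReal (.of_forall hnn), hlin]
    exact ENNReal.ofReal_lt_top
  · rw [integral_eq_lintegral_of_nonneg_ae (.of_forall hnn) hm.aestronglyMeasurable, hlin,
      ENNReal.toReal_ofReal (by positivity)]

end Mean

/-! ### The stand-alone network -/

section StandAlone

variable {rA lam : ℝ}

/-- The progress of a packet at `p.1.1` with destination `p.1.2` over a hop to `p.2`. -/
def relayGain (p : (Plane × Plane) × Plane) : ℝ := dist p.1.1 p.1.2 - dist p.2 p.1.2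

lemma measurable_relayGain : Measurable relayGain :=
  (measurable_fst.fst.dist measurable_fst.snd).sub (measurable_snd.dist measurable_fst.snd)

lemma abs_relayGain_le {R : ℝ} {p : (Plane × Plane) × Plane} (h : p ∈ relayTriples R) :
    |relayGain p| ≤ R :=
  (abs_dist_sub_le _ _ _).trans (by rw [dist_comm]; exact h.2.1)

/-- The mean gain in distance to the destination, for hops in the half-disk. -/
def relayIntegral (rA R : ℝ) : ℝ := ∫ p, (relayTriples R).indicator relayGain p ∂tripleLaw rA

/-- The probability that a hop to `w` is successful in the absence of secondary nodes, if the other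
nodes are at `v`, at `w` and at the points of `c`. -/
def clearKernel (P : Params) (v w : Plane) (c : Config) : ℝ :=
  P.qp * configProd (fun z => 1 - P.qp * (Metric.closedBall w P.RI).indicator 1 z)
    (addPoint v (addPoint w c))

lemma one_sub_indicator_mem (q : unitInterval) (S : Set Plane) (z : Plane) :
    1 - (q : ℝ) ≤ 1 - q * S.indicator 1 z ∧ 1 - (q : ℝ) * S.indicator 1 z ≤ 1 := by
  have hq := q.2.1
  by_cases h : z ∈ S <;> simp [h, hq]

lemma one_sub_indicator_nonneg (q : unitInterval) (S : Set Plane) (z : Plane) :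
    0 ≤ 1 - (q : ℝ) * S.indicator 1 z := (sub_nonneg.2 q.2.2).trans (one_sub_indicator_mem q S z).1

lemma clearKernel_nonneg (P : Params) (v w : Plane) (c : Config) : 0 ≤ clearKernel P v w c :=
  mul_nonneg P.qp.2.1 (configProd_nonneg (one_sub_indicator_nonneg _ _) _)

lemma clearKernel_le (P : Params) (v w : Plane) (c : Config) : clearKernel P v w c ≤ P.qp :=
  mul_le_of_le_one_right P.qp.2.1 (configProd_le_one (one_sub_indicator_nonneg _ _)
    (fun z => (one_sub_indicator_mem _ _ z).2) _)

lemma measurable_clearKernel (P : Params) : Measurable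
    fun p : ((Plane × Plane) × Plane) × Config => clearKernel P p.1.1.2 p.1.2 p.2 := by
  have hs : MeasurableSet {p : Plane × Plane | p.2 ∈ Metric.closedBall p.1 P.RI} :=
    measurableSet_le (measurable_snd.dist measurable_fst) measurable_const
  have h1 : Measurable fun p : Plane × Plane =>
      1 - (P.qp : ℝ) * (Metric.closedBall p.1 P.RI).indicator (1 : Plane → ℝ) p.2 :=
    ((measurable_one.indicator hs : Measurable ({p : Plane × Plane |
      p.2 ∈ Metric.closedBall p.1 P.RI}.indicator (1 : Plane × Plane → ℝ))).const_mul _).const_sub 1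
  have h2 : Measurable fun p : Plane × Config =>
      configProd (fun z => 1 - (P.qp : ℝ) * (Metric.closedBall p.1 P.RI).indicator 1 z) p.2 :=
    measurable_configProd (h := fun w z =>
      1 - (P.qp : ℝ) * (Metric.closedBall w P.RI).indicator (1 : Plane → ℝ) z) h1
  have m0 : Measurable fun p : ((Plane × Plane) × Plane) × Config => (p.1.2, p.2) :=
    measurable_fst.snd.prodMk measurable_snd
  have m1 : Measurable fun p : ((Plane × Plane) × Plane) × Config => addPoint p.1.2 p.2 :=
    measurable_addPoint.comp m0
  have m2 : Measurable fun p : ((Plane × Plane) × Plane) × Config => (p.1.1.2, addPoint p.1.2 p.2) :=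
    measurable_fst.fst.snd.prodMk m1
  have m3 : Measurable fun p : ((Plane × Plane) × Plane) × Config =>
      addPoint p.1.1.2 (addPoint p.1.2 p.2) := measurable_addPoint.comp m2
  have m4 : Measurable fun p : ((Plane × Plane) × Plane) × Config =>
      (p.1.2, addPoint p.1.1.2 (addPoint p.1.2 p.2)) := measurable_fst.snd.prodMk m3
  exact (h2.comp m4).const_mul _

lemma meanHopSuccess_zero_eq (P : Params) (A : Set Plane) {N : ℕ} (x : Fin (N + 3) → Plane)
    (i : Fin (N + 3)) (k : Fin (N + 2)) (l : Fin (N + 1)) :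
    meanHopSuccess P A 0 x i (i.succAbove (k.succAbove l)) =
      tripleApply (fun _ v w c => clearKernel P v w c) x i k l := by
  rw [meanHopSuccess_zero]
  simp only [tripleApply, clearKernel]
  rw [configProd_succ _ (i.removeNth x) k, configProd_addPoint, configProd_addPoint,
    configProd_succ _ (k.removeNth (i.removeNth x)) l, configProd_addPoint, configProd_addPoint]
  rfl

/-- The probability that no node transmits in the interference range of `w`, if there is a node
at `v` and at `w`. -/
def clearProb (P : Params) (A : Set Plane) (lam : ℝ) (v w : Plane) : ℝ :=
  (1 - P.qp * (Metric.closedBall w P.RI).indicator 1 v) *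
    ((1 - P.qp * (Metric.closedBall w P.RI).indicator 1 w) *
      rexp (-(lam * P.qp * volume.real (Metric.closedBall w P.RI ∩ A))))

lemma integral_clearKernel (hA : 0 < rA) (hl : 0 ≤ lam) (P : Params) (v w : Plane) :
    ∫ c, clearKernel P v w c ∂poissonNodes (Metric.closedBall 0 rA) lam =
      P.qp * clearProb P (Metric.closedBall 0 rA) lam v w := by
  unfold clearKernel clearProb
  simp_rw [configProd_addPoint]
  rw [integral_const_mul, integral_const_mul, integral_const_mul,
    integral_poissonNodes_prod (volume_closedBall_ne_zero 0 hA) (volume_closedBall_ne_top 0 rA) hl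
      P.qp Metric.isClosed_closedBall.measurableSet]

lemma clearProb_mem (hl : 0 ≤ lam) (P : Params) (A : Set Plane) (v w : Plane) :
    0 ≤ clearProb P A lam v w ∧ clearProb P A lam v w ≤ 1 := by
  have hq := P.qp.2.1
  have h1 := one_sub_indicator_nonneg P.qp (Metric.closedBall w P.RI)
  have h2 := fun z => (one_sub_indicator_mem P.qp (Metric.closedBall w P.RI) z).2
  have h3 : rexp (-(lam * P.qp * volume.real (Metric.closedBall w P.RI ∩ A))) ≤ 1 :=
    Real.exp_le_one_iff.2 (neg_nonpos.2 (by positivity))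
  have h4 := (Real.exp_pos (-(lam * P.qp * volume.real (Metric.closedBall w P.RI ∩ A)))).le
  exact ⟨mul_nonneg (h1 v) (mul_nonneg (h1 w) h4),
    mul_le_one₀ (h2 v) (mul_nonneg (h1 w) h4) (mul_le_one₀ (h2 w) h4 h3)⟩

/-- The destination and the receiver each multiply the void probability by a number in `[1 - qp,
1]`. -/
lemma abs_clearProb_sub_le (hl : 0 ≤ lam) (P : Params) (hRI : 0 ≤ P.RI) (v : Plane) {w : Plane}
    (hw : ‖w‖ + P.RI ≤ rA) :
    |clearProb P (Metric.closedBall 0 rA) lam v w - idleProb lam P.qp P.RI| ≤ 2 * P.qp := by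
  have hq := P.qp.2.1
  have h1 := one_sub_indicator_mem P.qp (Metric.closedBall w P.RI) v
  have h2 := one_sub_indicator_mem P.qp (Metric.closedBall w P.RI) w
  have n2 := one_sub_indicator_nonneg P.qp (Metric.closedBall w P.RI) w
  have n1 := one_sub_indicator_nonneg P.qp (Metric.closedBall w P.RI) v
  unfold clearProb
  rw [Set.inter_eq_left.2 (closedBall_subset_disk hw), volume_real_closedBall _ hRI]
  change |_ * (_ * idleProb lam P.qp P.RI) - _| ≤ _
  set a := 1 - (P.qp : ℝ) * (Metric.closedBall w P.RI).indicator 1 v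
  set b := 1 - (P.qp : ℝ) * (Metric.closedBall w P.RI).indicator 1 w
  have hab : 1 - 2 * (P.qp : ℝ) ≤ a * b := by
    have := mul_le_mul h1.1 h2.1 (sub_nonneg.2 P.qp.2.2) n1
    nlinarith
  have hab1 : a * b ≤ 1 := mul_le_one₀ h1.2 n2 h2.2
  have e0 := idleProb_pos lam P.qp P.RI
  have e1 := idleProb_le_one hl hq P.RI
  have : a * (b * idleProb lam P.qp P.RI) - idleProb lam P.qp P.RI =
      -((1 - a * b) * idleProb lam P.qp P.RI) := by ring
  rw [this, abs_neg, abs_of_nonneg (mul_nonneg (sub_nonneg.2 hab1) e0.le)]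
  calc (1 - a * b) * idleProb lam P.qp P.RI ≤ 2 * P.qp * 1 :=
        mul_le_mul (by linarith) e1 e0.le (by positivity)
    _ = _ := mul_one _

lemma relaySum_sub {n : ℕ} (P : Params) (x : Fin n → Plane) (φ ψ : Fin n → Fin n → Fin n → ℝ) :
    relaySum P x (fun i d j => φ i d j - ψ i d j) = relaySum P x φ - relaySum P x ψ := by
  unfold relaySum
  rw [← Finset.sum_sub_distrib]
  refine Finset.sum_congr rfl fun i _ => ?_
  rw [← Finset.sum_sub_distrib]
  refine Finset.sum_congr rfl fun d _ => ?_
  split_ifs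
  · simp
  · rw [Finset.sum_sub_distrib]
  · simp

/-- The gain can be negative: a relay at the edge of the half-disk may be farther from the
destination than the source. Adding `Rr` makes it nonnegative, so the formula for nonnegative
summands is used twice and subtracted. -/
lemma integral_relaySum_progress (hA : 0 < rA) (hl : 0 < lam) (P : Params) (hR : 0 < P.Rr) :
    Integrable (fun c : Config => relaySum P c.2 fun i d j =>
      progress c.2 i j d * meanHopSuccess P (Metric.closedBall 0 rA) 0 c.2 i j)
      (poissonNodes (Metric.closedBall 0 rA) lam) ∧
    ∫ c : Config, (relaySum P c.2 fun i d j =>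
      progress c.2 i j d * meanHopSuccess P (Metric.closedBall 0 rA) 0 c.2 i j)
      ∂poissonNodes (Metric.closedBall 0 rA) lam =
      meanCount rA lam ^ 3 * ∫ p, (relayTriples P.Rr).indicator (fun p => relayGain p *
        (P.qp * clearProb P (Metric.closedBall 0 rA) lam p.1.2 p.2)) p ∂tripleLaw rA ∧
    Integrable ((relayTriples P.Rr).indicator (fun p => relayGain p *
        (P.qp * clearProb P (Metric.closedBall 0 rA) lam p.1.2 p.2))) (tripleLaw rA) := by
  have hq := P.qp.2.1
  set A : Set Plane := Metric.closedBall 0 rA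
  have hm1 : Measurable fun p : ((Plane × Plane) × Plane) × Config =>
      (relayGain p.1 + P.Rr) * clearKernel P p.1.1.2 p.1.2 p.2 :=
    ((measurable_relayGain.comp measurable_fst).add_const P.Rr).mul (measurable_clearKernel P)
  have hm2 : Measurable fun p : ((Plane × Plane) × Plane) × Config =>
      P.Rr * clearKernel P p.1.1.2 p.1.2 p.2 := (measurable_clearKernel P).const_mul _
  obtain ⟨i1, e1, g1⟩ := integral_relaySum (C := 2 * P.Rr * P.qp)
    (φ := fun n x i d j => (progress x i j d + P.Rr) * meanHopSuccess P A 0 x i j)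
    (K := fun u v w c => (relayGain ((u, v), w) + P.Rr) * clearKernel P v w c) hA hl hm1
    (fun u v w c h => by
      have := (abs_le.1 (abs_relayGain_le h)).1
      exact mul_nonneg (by linarith) (clearKernel_nonneg _ _ _ _))
    (fun u v w c h => by
      have := abs_le.1 (abs_relayGain_le h)
      exact mul_le_mul (by linarith) (clearKernel_le _ _ _ _) (clearKernel_nonneg _ _ _ _)
        (by positivity))
    (fun n x i d j h1 h2 => by
      have h : ((x i, x d), x j) ∈ relayTriples P.Rr := ⟨h1, h2⟩
      have := (abs_le.1 (abs_relayGain_le h)).1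
      exact mul_nonneg (by change 0 ≤ relayGain ((x i, x d), x j) + P.Rr; linarith)
        (meanHopSuccess_nonneg _ _ _ _ _ _))
    (fun N x i k l => by rw [meanHopSuccess_zero_eq]; rfl)
  obtain ⟨i2, e2, g2⟩ := integral_relaySum (C := P.Rr * P.qp)
    (φ := fun n x i d j => P.Rr * meanHopSuccess P A 0 x i j)
    (K := fun u v w c => P.Rr * clearKernel P v w c) hA hl hm2
    (fun u v w c h => mul_nonneg hR.le (clearKernel_nonneg _ _ _ _))
    (fun u v w c h => mul_le_mul_of_nonneg_left (clearKernel_le _ _ _ _) hR.le)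
    (fun n x i d j h1 h2 => mul_nonneg hR.le (meanHopSuccess_nonneg _ _ _ _ _ _))
    (fun N x i k l => by rw [meanHopSuccess_zero_eq]; rfl)
  have hd : (fun c : Config => relaySum P c.2 fun i d j =>
      progress c.2 i j d * meanHopSuccess P A 0 c.2 i j) = fun c : Config =>
      (relaySum P c.2 fun i d j => (progress c.2 i j d + P.Rr) * meanHopSuccess P A 0 c.2 i j) -
      relaySum P c.2 fun i d j => P.Rr * meanHopSuccess P A 0 c.2 i j := by
    ext c
    rw [← relaySum_sub]
    congr 1
    ext i d j
    ring
  have hg : (relayTriples P.Rr).indicator (fun p => relayGain p *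
      (P.qp * clearProb P A lam p.1.2 p.2)) = fun p =>
      (relayTriples P.Rr).indicator (fun p => ∫ c, (relayGain ((p.1.1, p.1.2), p.2) + P.Rr) *
        clearKernel P p.1.2 p.2 c ∂poissonNodes A lam) p -
      (relayTriples P.Rr).indicator (fun p => ∫ c, P.Rr *
        clearKernel P p.1.2 p.2 c ∂poissonNodes A lam) p := by
    ext p
    by_cases h : p ∈ relayTriples P.Rr
    · simp only [Set.indicator_of_mem h]
      rw [integral_const_mul, integral_const_mul, integral_clearKernel hA hl.le]
      ring
    · simp only [Set.indicator_of_notMem h, sub_zero]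
  rw [hd, hg]
  refine ⟨i1.sub i2, ?_, g1.sub g2⟩
  rw [integral_sub i1 i2, e1, e2, ← mul_sub, ← integral_sub g1 g2]

lemma integral_relayTriples_le (hA : 0 < rA) {R t a : ℝ} (hR : 0 < R) (ha : 0 ≤ a) :
    Integrable ((relayTriples R).indicator (fun p => a + (nearBoundary rA t).indicator 1 p.1.1))
      (tripleLaw rA) ∧
    ∫ p, (relayTriples R).indicator (fun p => a + (nearBoundary rA t).indicator 1 p.1.1) p
      ∂tripleLaw rA ≤ (a + (uniformDisk rA).real (nearBoundary rA t)) * (R ^ 2 / (2 * rA ^ 2)) := by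
  have := isProbabilityMeasure_uniformDisk hA
  have := isProbabilityMeasure_tripleLaw hA
  have hnb : Measurable ((nearBoundary rA t).indicator (1 : Plane → ℝ)) :=
    measurable_one.indicator (measurableSet_nearBoundary rA t)
  have hn0 : ∀ u, 0 ≤ (nearBoundary rA t).indicator (1 : Plane → ℝ) u := indicator_one_nonneg _
  have hn1 : ∀ u, (nearBoundary rA t).indicator (1 : Plane → ℝ) u ≤ 1 := fun u =>
    Set.indicator_le_self' (fun _ _ => zero_le_one) u
  have hm : Measurable ((relayTriples R).indicator (fun p : (Plane × Plane) × Plane =>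
      a + (nearBoundary rA t).indicator (1 : Plane → ℝ) p.1.1)) :=
    ((hnb.comp measurable_fst.fst).const_add a).indicator (measurableSet_relayTriples R)
  have hi : Integrable ((relayTriples R).indicator (fun p : (Plane × Plane) × Plane =>
      a + (nearBoundary rA t).indicator (1 : Plane → ℝ) p.1.1)) (tripleLaw rA) := by
    refine Integrable.of_bound (C := a + 1) hm.aestronglyMeasurable (.of_forall fun p => ?_)
    have h0 := hn0 p.1.1
    have h1 := hn1 p.1.1
    by_cases hp : p ∈ relayTriples R
    · rw [Set.indicator_of_mem hp, Real.norm_of_nonneg (by positivity)]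
      linarith
    · rw [Set.indicator_of_notMem hp, norm_zero]
      positivity
  refine ⟨hi, ?_⟩
  rw [tripleLaw] at hi ⊢
  rw [integral_prod _ hi]
  have hw : ∀ b : Plane × Plane, ∫ w, (relayTriples R).indicator (fun p : (Plane × Plane) × Plane =>
      a + (nearBoundary rA t).indicator (1 : Plane → ℝ) p.1.1) (b, w) ∂uniformDisk rA ≤
      (a + (nearBoundary rA t).indicator 1 b.1) * (R ^ 2 / (2 * rA ^ 2)) := by
    intro b
    have hb := hn0 b.1
    by_cases h : R < dist b.1 b.2
    · have e : ∀ w, (relayTriples R).indicator (fun p : (Plane × Plane) × Plane =>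
          a + (nearBoundary rA t).indicator (1 : Plane → ℝ) p.1.1) (b, w) =
          (a + (nearBoundary rA t).indicator 1 b.1) * (halfDisk R b.1 b.2).indicator 1 w := by
        intro w
        by_cases h2 : w ∈ halfDisk R b.1 b.2
        · have h3 : (b, w) ∈ relayTriples R := ⟨h, h2⟩
          rw [Set.indicator_of_mem h3, Set.indicator_of_mem h2, Pi.one_apply, mul_one]
        · have h3 : (b, w) ∉ relayTriples R := fun h' => h2 h'.2
          rw [Set.indicator_of_notMem h3, Set.indicator_of_notMem h2, mul_zero]
      simp_rw [e]
      rw [integral_const_mul, integral_indicator_one (measurableSet_halfDisk' R _ _)]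
      refine mul_le_mul_of_nonneg_left (uniformDisk_real_halfDisk_le hA hR.le fun he => ?_)
        (by positivity)
      rw [he, dist_self] at h
      linarith
    · have e : ∀ w, (relayTriples R).indicator (fun p : (Plane × Plane) × Plane =>
          a + (nearBoundary rA t).indicator (1 : Plane → ℝ) p.1.1) (b, w) = 0 := fun w =>
        Set.indicator_of_notMem (fun h' => h h'.1) _
      simp_rw [e]
      rw [integral_zero]
      positivity
  have hj : Integrable (fun b : Plane × Plane => (nearBoundary rA t).indicator (1 : Plane → ℝ) b.1)
      ((uniformDisk rA).prod (uniformDisk rA)) :=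
    Integrable.of_bound (C := 1) (hnb.comp measurable_fst).aestronglyMeasurable
      (.of_forall fun b => by rw [Real.norm_of_nonneg (hn0 _)]; exact hn1 _)
  have hj2 : Integrable (fun b : Plane × Plane =>
      a + (nearBoundary rA t).indicator (1 : Plane → ℝ) b.1)
      ((uniformDisk rA).prod (uniformDisk rA)) := (integrable_const a).add hj
  refine (integral_mono hi.integral_prod_left (hj2.mul_const _) hw).trans_eq ?_
  rw [integral_mul_const, integral_add (integrable_const a) hj, integral_const, probReal_univ,
    one_smul]
  congr 2
  rw [integral_fun_fst (f := fun u => (nearBoundary rA t).indicator (1 : Plane → ℝ) u),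
    probReal_univ, one_smul, integral_indicator_one (measurableSet_nearBoundary rA t)]

/-- For interior sources the clear-channel probability is the constant `idleProb lam qp RI` up to `2
qp`; near the boundary the difference is at most `1`. A constant factors out and leaves the purely
geometric `relayIntegral`. -/
lemma abs_integral_relaySum_sub_le (hA : 0 < rA) (hl : 0 < lam) (P : Params) {t : ℝ}
    (hR : 0 < P.Rr) (hRI : 0 ≤ P.RI) (ht : P.Rr + P.RI ≤ t) :
    |(meanCount rA lam * meanHops lam P.Rr)⁻¹ * (∫ c : Config, (relaySum P c.2 fun i d j =>
      progress c.2 i j d * meanHopSuccess P (Metric.closedBall 0 rA) 0 c.2 i j)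
      ∂poissonNodes (Metric.closedBall 0 rA) lam) -
      meanCount rA lam * (P.qp * P.Rr) * (idleProb lam P.qp P.RI *
        (2 * rA ^ 2 / P.Rr ^ 3 * relayIntegral rA P.Rr))| ≤
      meanCount rA lam * (P.qp * P.Rr) * (2 * P.qp + (uniformDisk rA).real (nearBoundary rA t)) := by
  have hq := P.qp.2.1
  have := isProbabilityMeasure_uniformDisk hA
  have := isProbabilityMeasure_tripleLaw hA
  have hr : 0 < meanCount rA lam := by unfold meanCount; positivity
  set A : Set Plane := Metric.closedBall 0 rA with hAd
  have hnb : Measurable ((nearBoundary rA t).indicator (1 : Plane → ℝ)) :=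
    measurable_one.indicator (measurableSet_nearBoundary rA t)
  have hk : (meanCount rA lam * meanHops lam P.Rr)⁻¹ * meanCount rA lam ^ 3 =
      meanCount rA lam * (2 * rA ^ 2 / P.Rr ^ 2) := by
    unfold meanCount meanHops
    field_simp
  obtain ⟨-, e, hi⟩ := integral_relaySum_progress hA hl P hR
  obtain ⟨ht1, ht2⟩ := integral_relayTriples_le (t := t) hA hR (by positivity : 0 ≤ 2 * (P.qp : ℝ))
  have hpt : ∀ p : (Plane × Plane) × Plane, ‖(relayTriples P.Rr).indicator (fun p => relayGain p *
      (P.qp * clearProb P A lam p.1.2 p.2)) p - P.qp * idleProb lam P.qp P.RI *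
        (relayTriples P.Rr).indicator relayGain p‖ ≤ P.qp * P.Rr * (relayTriples P.Rr).indicator
        (fun p => 2 * (P.qp : ℝ) + (nearBoundary rA t).indicator 1 p.1.1) p := by
    intro p
    rw [Real.norm_eq_abs]
    by_cases h : p ∈ relayTriples P.Rr
    · simp only [Set.indicator_of_mem h]
      have h1 : relayGain p * (P.qp * clearProb P A lam p.1.2 p.2) -
          P.qp * idleProb lam P.qp P.RI * relayGain p =
        P.qp * relayGain p * (clearProb P A lam p.1.2 p.2 - idleProb lam P.qp P.RI) := by ring
      rw [h1, abs_mul, abs_mul, abs_of_nonneg hq]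
      refine mul_le_mul (mul_le_mul_of_nonneg_left (abs_relayGain_le h) hq) ?_ (abs_nonneg _)
        (by positivity)
      by_cases hu : p.1.1 ∈ nearBoundary rA t
      · rw [Set.indicator_of_mem hu, Pi.one_apply]
        have c1 := clearProb_mem hl.le P A p.1.2 p.2
        have c2 := idleProb_pos lam P.qp P.RI
        have c3 := idleProb_le_one hl.le hq P.RI
        rw [abs_le]
        constructor <;> linarith
      · rw [Set.indicator_of_notMem hu, add_zero]
        refine abs_clearProb_sub_le hl.le P hRI _ ?_
        have h2 : ‖p.1.1‖ + t ≤ rA := not_lt.1 hu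
        have h3 := norm_sub_norm_le p.2 p.1.1
        rw [← dist_eq_norm] at h3
        have h4 := h.2.1
        linarith
    · simp only [Set.indicator_of_notMem h, mul_zero, sub_zero, abs_zero, le_refl]
  have hgi : Integrable ((relayTriples P.Rr).indicator relayGain) (tripleLaw rA) := by
    refine Integrable.of_bound (C := P.Rr) (measurable_relayGain.indicator
      (measurableSet_relayTriples _)).aestronglyMeasurable (.of_forall fun p => ?_)
    by_cases hp : p ∈ relayTriples P.Rr
    · rw [Set.indicator_of_mem hp]
      exact abs_relayGain_le hp
    · rw [Set.indicator_of_notMem hp, norm_zero]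
      exact hR.le
  have key := norm_integral_le_of_norm_le (ht1.const_mul (P.qp * P.Rr)) (.of_forall hpt)
  rw [integral_sub hi (hgi.const_mul _), integral_const_mul, integral_const_mul,
    Real.norm_eq_abs] at key
  have key2 := key.trans (mul_le_mul_of_nonneg_left ht2 (by positivity))
  rw [e, ← mul_assoc, hk]
  set I := ∫ p, (relayTriples P.Rr).indicator (fun p => relayGain p *
      (P.qp * clearProb P A lam p.1.2 p.2)) p ∂tripleLaw rA
  change |I - P.qp * idleProb lam P.qp P.RI * relayIntegral rA P.Rr| ≤ _ at key2
  have hfac : meanCount rA lam * (2 * rA ^ 2 / P.Rr ^ 2) * I - meanCount rA lam * (P.qp * P.Rr) *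
      (idleProb lam P.qp P.RI * (2 * rA ^ 2 / P.Rr ^ 3 * relayIntegral rA P.Rr)) =
      meanCount rA lam * (2 * rA ^ 2 / P.Rr ^ 2) *
        (I - P.qp * idleProb lam P.qp P.RI * relayIntegral rA P.Rr) := by
    field_simp
  rw [hfac, abs_mul, abs_of_nonneg (by positivity)]
  refine (mul_le_mul_of_nonneg_left key2 (by positivity)).trans_eq ?_
  field_simp

end StandAlone

/-! ### The mean gain for a vanishing transmission range -/

section Gain

variable {rA : ℝ}

/-- The relative gain `relayGain / R` for a hop from `p.1.1` to `p.1.1 + R • p.2`. -/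
def scaledGain (rA R : ℝ) (p : (Plane × Plane) × Plane) : ℝ :=
  (relayTriples R ∩ {p | ‖p.2‖ ≤ rA}).indicator relayGain (p.1, p.1.1 + R • p.2) / R

/-- The limit of the relative gain. -/
def limitGain (p : (Plane × Plane) × Plane) : ℝ :=
  max 0 (inner ℝ p.2 (p.1.2 - p.1.1)) / ‖p.1.2 - p.1.1‖

/-- The uniform law of two points of the disk, times the Lebesgue measure on the unit disk. -/
def hopMeasure (rA : ℝ) : Measure ((Plane × Plane) × Plane) :=
  ((uniformDisk rA).prod (uniformDisk rA)).prod (volume.restrict (Metric.closedBall 0 1))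

/-- The limit of the mean relative gain. -/
def meanGain (rA : ℝ) : ℝ := 2 / π * ∫ p, limitGain p ∂hopMeasure rA

lemma isFiniteMeasure_hopMeasure (hA : 0 < rA) : IsFiniteMeasure (hopMeasure rA) := by
  have := isProbabilityMeasure_uniformDisk hA
  have : IsFiniteMeasure (volume.restrict (Metric.closedBall (0 : Plane) 1)) := ⟨by
    rw [Measure.restrict_apply_univ]; exact measure_closedBall_lt_top⟩
  unfold hopMeasure
  infer_instance

lemma measurable_scaledGain (rA R : ℝ) : Measurable (scaledGain rA R) := by
  have h1 : Measurable fun p : (Plane × Plane) × Plane => (p.1, p.1.1 + R • p.2) :=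
    measurable_fst.prodMk (measurable_fst.fst.add (measurable_snd.const_smul R))
  have h2 : MeasurableSet (relayTriples R ∩ {p | ‖p.2‖ ≤ rA}) :=
    (measurableSet_relayTriples R).inter (measurableSet_le measurable_snd.norm measurable_const)
  exact ((measurable_relayGain.indicator h2).comp h1).div_const R

lemma abs_scaledGain_le {R : ℝ} (hR : 0 < R) (p : (Plane × Plane) × Plane) :
    |scaledGain rA R p| ≤ 1 := by
  unfold scaledGain
  rw [abs_div, abs_of_pos hR, div_le_one hR]
  by_cases h : (p.1, p.1.1 + R • p.2) ∈ relayTriples R ∩ {p | ‖p.2‖ ≤ rA}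
  · rw [Set.indicator_of_mem h]
    exact abs_relayGain_le h.1
  · rw [Set.indicator_of_notMem h, abs_zero]
    exact hR.le

lemma integral_uniformDisk (hA : 0 < rA) (f : Plane → ℝ) :
    ∫ w, f w ∂uniformDisk rA = (π * rA ^ 2)⁻¹ * ∫ w, (Metric.closedBall 0 rA).indicator f w := by
  rw [uniformDisk, ProbabilityTheory.cond, integral_smul_measure,
    integral_indicator Metric.isClosed_closedBall.measurableSet, ENNReal.toReal_inv,
    ← measureReal_def, volume_real_closedBall _ hA.le, smul_eq_mul]

/-- Substitution `w = u + R ζ` for the relay: the Jacobian gives `R²`, the gain is of size `R`, and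
the uniform density is `1 / (π rA²)`. -/
lemma relayIntegral_eq (hA : 0 < rA) {R : ℝ} (hR : 0 < R) :
    2 * rA ^ 2 / R ^ 3 * relayIntegral rA R = 2 / π * ∫ p, scaledGain rA R p ∂hopMeasure rA := by
  have := isProbabilityMeasure_uniformDisk hA
  have := isProbabilityMeasure_tripleLaw hA
  have hfin := isFiniteMeasure_hopMeasure hA
  have : IsFiniteMeasure (volume.restrict (Metric.closedBall (0 : Plane) 1)) := ⟨by
    rw [Measure.restrict_apply_univ]; exact measure_closedBall_lt_top⟩
  have hgi : Integrable ((relayTriples R).indicator relayGain) (tripleLaw rA) := by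
    refine Integrable.of_bound (C := R) (measurable_relayGain.indicator
      (measurableSet_relayTriples _)).aestronglyMeasurable (.of_forall fun p => ?_)
    by_cases hp : p ∈ relayTriples R
    · rw [Set.indicator_of_mem hp]
      exact abs_relayGain_le hp
    · rw [Set.indicator_of_notMem hp, norm_zero]
      exact hR.le
  have hsi : Integrable (scaledGain rA R) (hopMeasure rA) :=
    Integrable.of_bound (C := 1) (measurable_scaledGain rA R).aestronglyMeasurable
      (.of_forall fun p => abs_scaledGain_le hR p)
  unfold relayIntegral
  rw [tripleLaw] at hgi ⊢
  rw [hopMeasure] at hsi ⊢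
  rw [integral_prod _ hgi, integral_prod _ hsi, ← integral_const_mul, ← integral_const_mul]
  refine integral_congr_ae (.of_forall fun b => ?_)
  simp only
  -- Relays are within distance `R`, so the integrand vanishes outside the unit disk.
  have h1 : ∫ ζ in Metric.closedBall (0 : Plane) 1, scaledGain rA R (b, ζ) =
      ∫ ζ, scaledGain rA R (b, ζ) := by
    refine setIntegral_eq_integral_of_forall_compl_eq_zero fun ζ hζ => ?_
    unfold scaledGain
    rw [Set.indicator_of_notMem, zero_div]
    rintro ⟨⟨-, h, -⟩, -⟩
    refine hζ ?_
    rw [Metric.mem_closedBall, dist_zero_right]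
    simp only [dist_self_add_left, norm_smul, Real.norm_of_nonneg hR.le] at h
    exact le_of_mul_le_mul_left (by rwa [mul_one]) hR
  have h2 : ∀ ζ, scaledGain rA R (b, ζ) = R⁻¹ * (fun w => (Metric.closedBall 0 rA).indicator
      (fun w => (relayTriples R).indicator relayGain (b, w)) (b.1 + w)) (R • ζ) := by
    intro ζ
    unfold scaledGain
    rw [div_eq_inv_mul]
    congr 1
    simp only [Set.indicator, Metric.mem_closedBall, dist_zero_right, Set.mem_inter_iff,
      Set.mem_ofPred_eq]
    by_cases h3 : (b, b.1 + R • ζ) ∈ relayTriples R <;> by_cases h4 : ‖b.1 + R • ζ‖ ≤ rA <;>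
      simp [h3, h4]
  rw [h1, integral_uniformDisk hA]
  simp_rw [funext h2]
  rw [integral_const_mul, Measure.integral_comp_smul volume (fun w => (Metric.closedBall 0 rA).indicator
      (fun w => (relayTriples R).indicator relayGain (b, w)) (b.1 + w)), integral_add_left_eq_self (fun w =>
    (Metric.closedBall 0 rA).indicator (fun w => (relayTriples R).indicator relayGain (b, w)) w),
    finrank_euclideanSpace_fin, abs_of_pos (by positivity), smul_eq_mul]
  have := Real.pi_pos
  field_simp

/-- The directional derivative of the norm, obtained by multiplying with the conjugate `‖a‖ + ‖a - R
• ζ‖`. -/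
lemma tendsto_norm_sub_div {a ζ : Plane} (ha : a ≠ 0) :
    Tendsto (fun R : ℝ => (‖a‖ - ‖a - R • ζ‖) / R) (𝓝[>] 0) (𝓝 (inner ℝ ζ a / ‖a‖)) := by
  have ha' : 0 < ‖a‖ := norm_pos_iff.2 ha
  have hc : ContinuousAt (fun R : ℝ => (2 * inner ℝ ζ a - R * ‖ζ‖ ^ 2) / (‖a‖ + ‖a - R • ζ‖)) 0 := by
    refine ContinuousAt.div (by fun_prop) (by fun_prop) ?_
    simp [ha]
  have ht := hc.tendsto.mono_left (nhdsWithin_le_nhds (s := Set.Ioi 0))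
  have h0 : (2 * inner ℝ ζ a - 0 * ‖ζ‖ ^ 2) / (‖a‖ + ‖a - (0 : ℝ) • ζ‖) = inner ℝ ζ a / ‖a‖ := by
    rw [zero_smul, sub_zero]
    field_simp
    ring
  rw [h0] at ht
  refine ht.congr' ?_
  filter_upwards [self_mem_nhdsWithin] with R hR
  have hR' : (0 : ℝ) < R := hR
  have hs : ‖a - R • ζ‖ ^ 2 = ‖a‖ ^ 2 - 2 * (R * inner ℝ ζ a) + (R * ‖ζ‖) ^ 2 := by
    rw [norm_sub_sq_real, inner_smul_right, norm_smul, Real.norm_of_nonneg hR'.le,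
      real_inner_comm]
  have hpos : 0 < ‖a‖ + ‖a - R • ζ‖ := by positivity
  rw [div_eq_div_iff hpos.ne' hR'.ne']
  linear_combination hs

/-- For small `R` the relay stays in the region and the destination is out of range, so only the
sign of the inner product decides whether `ζ` is in the half-disk. -/
lemma tendsto_scaledGain {u v ζ : Plane} (hu : ‖u‖ < rA) (huv : u ≠ v) (hζ : ‖ζ‖ ≤ 1) :
    Tendsto (fun R => scaledGain rA R ((u, v), ζ)) (𝓝[>] 0) (𝓝 (limitGain ((u, v), ζ))) := by
  have hd : 0 < dist u v := dist_pos.2 huv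
  have hpos : ∀ᶠ R : ℝ in 𝓝[>] 0, 0 < R := self_mem_nhdsWithin
  have hlt : ∀ᶠ R : ℝ in 𝓝[>] 0, R < dist u v :=
    nhdsWithin_le_nhds (Iio_mem_nhds hd)
  have hin : ∀ᶠ R : ℝ in 𝓝[>] 0, ‖u + R • ζ‖ ≤ rA := by
    have hc : ContinuousAt (fun R : ℝ => ‖u + R • ζ‖) 0 := by fun_prop
    have : ∀ᶠ R : ℝ in 𝓝 0, ‖u + R • ζ‖ < rA := hc.eventually_lt continuousAt_const (by simpa)
    filter_upwards [nhdsWithin_le_nhds this] with R h using h.le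
  unfold limitGain
  by_cases hi : 0 ≤ inner ℝ ζ (v - u)
  · rw [max_eq_right hi]
    refine (tendsto_norm_sub_div (sub_ne_zero.2 huv.symm)).congr' ?_
    filter_upwards [hpos, hlt, hin] with R h1 h2 h3
    have hm : ((u, v), u + R • ζ) ∈ relayTriples R ∩ {p | ‖p.2‖ ≤ rA} := by
      refine ⟨⟨h2, ?_, ?_⟩, h3⟩
      · simp only [dist_self_add_left, norm_smul, Real.norm_of_nonneg h1.le]
        exact mul_le_of_le_one_right h1.le hζ
      · simp only [add_sub_cancel_left, inner_smul_left]
        exact mul_nonneg h1.le hi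
    unfold scaledGain
    rw [Set.indicator_of_mem hm, relayGain, dist_comm, dist_comm _ v, dist_eq_norm, dist_eq_norm,
      sub_add_eq_sub_sub]
  · rw [max_eq_left (not_le.1 hi).le, zero_div]
    refine tendsto_const_nhds.congr' ?_
    filter_upwards [hpos] with R h1
    unfold scaledGain
    rw [Set.indicator_of_notMem, zero_div]
    rintro ⟨⟨-, -, h⟩, -⟩
    simp only [add_sub_cancel_left, inner_smul_left] at h
    exact hi (nonneg_of_mul_nonneg_right h h1)

lemma ae_uniformDisk_norm_lt (rA : ℝ) : ∀ᵐ u ∂uniformDisk rA, ‖u‖ < rA := by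
  have h1 : ∀ᵐ u ∂uniformDisk rA, u ∈ Metric.closedBall (0 : Plane) rA :=
    ae_cond_mem Metric.isClosed_closedBall.measurableSet
  have h2 : ∀ᵐ u ∂uniformDisk rA, u ∉ Metric.sphere (0 : Plane) rA := by
    refine cond_absolutelyContinuous.ae_le ?_
    exact measure_eq_zero_iff_ae_notMem.1 (Measure.addHaar_sphere volume 0 rA)
  filter_upwards [h1, h2] with u hu hu'
  rw [Metric.mem_closedBall, dist_zero_right] at hu
  rw [mem_sphere_zero_iff_norm] at hu'
  exact lt_of_le_of_ne hu hu'

lemma ae_hopMeasure (hA : 0 < rA) : ∀ᵐ p ∂hopMeasure rA,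
    ‖p.1.1‖ < rA ∧ p.1.1 ≠ p.1.2 ∧ ‖p.2‖ ≤ 1 := by
  have := isProbabilityMeasure_uniformDisk hA
  have h1 : ∀ᵐ b ∂(uniformDisk rA).prod (uniformDisk rA), ‖b.1‖ < rA ∧ b.1 ≠ b.2 := by
    have hm : MeasurableSet {b : Plane × Plane | ‖b.1‖ < rA ∧ b.1 ≠ b.2} :=
      (measurableSet_lt measurable_fst.norm measurable_const).inter
        (measurableSet_eq_fun measurable_fst measurable_snd).compl
    rw [Measure.ae_prod_iff_ae_ae hm]
    filter_upwards [ae_uniformDisk_norm_lt rA] with u hu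
    have : ∀ᵐ v ∂uniformDisk rA, v ∉ ({u} : Set Plane) := by
      refine cond_absolutelyContinuous.ae_le ?_
      exact measure_eq_zero_iff_ae_notMem.1 (measure_singleton u)
    filter_upwards [this] with v hv
    exact ⟨hu, fun h => hv h.symm⟩
  have h2 : ∀ᵐ ζ ∂volume.restrict (Metric.closedBall (0 : Plane) 1), ‖ζ‖ ≤ 1 := by
    filter_upwards [ae_restrict_mem Metric.isClosed_closedBall.measurableSet] with ζ hζ
    simpa using hζ
  unfold hopMeasure
  filter_upwards [Measure.quasiMeasurePreserving_fst.ae h1, Measure.quasiMeasurePreserving_snd.ae h2]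
    with p hp hp2
  exact ⟨hp.1, hp.2, hp2⟩

/-- Dominated convergence: the relative gain is at most `1` on a finite measure space. -/
lemma tendsto_relayIntegral (hA : 0 < rA) :
    Tendsto (fun R => 2 * rA ^ 2 / R ^ 3 * relayIntegral rA R) (𝓝[>] 0) (𝓝 (meanGain rA)) := by
  have hfin := isFiniteMeasure_hopMeasure hA
  have h : Tendsto (fun R => ∫ p, scaledGain rA R p ∂hopMeasure rA) (𝓝[>] 0)
      (𝓝 (∫ p, limitGain p ∂hopMeasure rA)) := by
    refine tendsto_integral_filter_of_dominated_convergence (fun _ => 1)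
      (.of_forall fun R => (measurable_scaledGain rA R).aestronglyMeasurable) ?_
      (integrable_const _) ?_
    · filter_upwards [self_mem_nhdsWithin] with R hR
      exact .of_forall fun p => abs_scaledGain_le hR p
    · filter_upwards [ae_hopMeasure hA] with p hp
      exact tendsto_scaledGain hp.1 hp.2.1 hp.2.2
  refine (h.const_mul (2 / π)).congr' ?_
  filter_upwards [self_mem_nhdsWithin] with R hR
  exact (relayIntegral_eq hA hR).symm

lemma uniformDisk_ne_zero_of_isOpen {U : Set Plane} (hU : IsOpen U) {z : Plane}
    (hz : z ∈ U) (hz' : ‖z‖ < rA) : uniformDisk rA U ≠ 0 := by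
  rw [uniformDisk, cond_apply Metric.isClosed_closedBall.measurableSet]
  refine mul_ne_zero (ENNReal.inv_ne_zero.2 (volume_closedBall_ne_top 0 rA)) ?_
  have h1 : (Metric.ball (0 : Plane) rA ∩ U).Nonempty := ⟨z, by simpa using hz', hz⟩
  have h2 := (Metric.isOpen_ball.inter hU).measure_pos volume h1
  exact (h2.trans_le (measure_mono (Set.inter_subset_inter_left _ Metric.ball_subset_closedBall))).ne'

lemma limitGain_nonneg (p : (Plane × Plane) × Plane) : 0 ≤ limitGain p := by
  unfold limitGain
  positivity

lemma abs_limitGain_le {p : (Plane × Plane) × Plane} (h : ‖p.2‖ ≤ 1) : |limitGain p| ≤ 1 := by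
  rw [abs_of_nonneg (limitGain_nonneg p), limitGain]
  refine div_le_one_of_le₀ (max_le (norm_nonneg _) ?_) (norm_nonneg _)
  exact (real_inner_le_norm _ _).trans (mul_le_of_le_one_left (norm_nonneg _) h)

lemma measurable_limitGain : Measurable limitGain := by
  unfold limitGain
  have h1 : Measurable fun p : (Plane × Plane) × Plane => p.1.2 - p.1.1 :=
    measurable_fst.snd.sub measurable_fst.fst
  exact (measurable_const.max (measurable_snd.inner (𝕜 := ℝ) h1)).div h1.norm

lemma meanGain_pos (hA : 0 < rA) : 0 < meanGain rA := by
  have hfin := isFiniteMeasure_hopMeasure hA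
  have := isProbabilityMeasure_uniformDisk hA
  refine mul_pos (by have := Real.pi_pos; positivity) ?_
  have hi : Integrable limitGain (hopMeasure rA) := Integrable.of_bound (C := 1)
    measurable_limitGain.aestronglyMeasurable
    ((ae_hopMeasure hA).mono fun p hp => abs_limitGain_le hp.2.2)
  rw [integral_pos_iff_support_of_nonneg limitGain_nonneg hi]
  set e : Plane := EuclideanSpace.single 0 1 with he
  have hen : ‖e‖ = 1 := by simp [he]
  set S : Set ((Plane × Plane) × Plane) := {p | 0 < inner ℝ p.2 (p.1.2 - p.1.1)} with hS
  have hSo : IsOpen S := isOpen_lt continuous_const (by fun_prop)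
  -- A source at the centre, a destination at `(rA / 2) e` and a step in the same direction: the
  -- gain is positive in a neighbourhood of this triple, which has positive measure.
  have hmem : (((0 : Plane), (rA / 2) • e), (1 / 2 : ℝ) • e) ∈ S := by
    simp only [hS, Set.mem_ofPred_eq, sub_zero, inner_smul_left, inner_smul_right,
      real_inner_self_eq_norm_sq, hen]
    simp
    positivity
  obtain ⟨U, W, hU, hbU, hW, hζW, hUW⟩ := mem_nhds_prod_iff'.1 (hSo.mem_nhds hmem)
  obtain ⟨U₁, U₂, hU₁, h1, hU₂, h2, hU12⟩ := mem_nhds_prod_iff'.1 (hU.mem_nhds hbU)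
  have hsub : (U₁ ×ˢ U₂) ×ˢ W ⊆ Function.support limitGain := by
    intro p hp
    have hpS : 0 < inner ℝ p.2 (p.1.2 - p.1.1) := hUW ⟨hU12 hp.1, hp.2⟩
    have hne : p.1.2 - p.1.1 ≠ 0 := fun h0 => by
      rw [h0, inner_zero_right] at hpS
      exact lt_irrefl _ hpS
    have : 0 < limitGain p := div_pos (lt_max_of_lt_right hpS) (norm_pos_iff.2 hne)
    exact this.ne'
  refine lt_of_lt_of_le (pos_iff_ne_zero.2 ?_) (measure_mono hsub)
  rw [hopMeasure, Measure.prod_prod, Measure.prod_prod]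
  refine mul_ne_zero (mul_ne_zero (uniformDisk_ne_zero_of_isOpen hU₁ h1 (by simpa using hA))
    (uniformDisk_ne_zero_of_isOpen hU₂ h2 ?_)) ?_
  · rw [norm_smul, hen, Real.norm_of_nonneg (by positivity)]
    linarith
  · rw [Measure.restrict_apply hW.measurableSet]
    have h3 : (W ∩ Metric.ball (0 : Plane) 1).Nonempty := ⟨_, hζW, by
      rw [mem_ball_zero_iff, norm_smul, hen]; norm_num⟩
    have h4 := (hW.inter Metric.isOpen_ball).measure_pos volume h3
    exact (h4.trans_le (measure_mono (Set.inter_subset_inter_right _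
      Metric.ball_subset_closedBall))).ne'

/-! ### The area near the boundary -/

lemma uniformDisk_real_nearBoundary (hA : 0 < rA) {t : ℝ} (ht0 : 0 ≤ t) (ht : t ≤ rA) :
    (uniformDisk rA).real (nearBoundary rA t) = 1 - ((rA - t) / rA) ^ 2 := by
  have := isProbabilityMeasure_uniformDisk hA
  have hc : (nearBoundary rA t)ᶜ = Metric.closedBall (0 : Plane) (rA - t) := by
    ext u
    simp only [nearBoundary, Set.mem_compl_iff, Set.mem_ofPred_eq, not_lt, Metric.mem_closedBall,
      dist_zero_right]
    constructor <;> intro h <;> linarith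
  have h1 := probReal_compl_eq_one_sub (μ := uniformDisk rA) (measurableSet_nearBoundary rA t)
  rw [hc, uniformDisk_real hA Metric.isClosed_closedBall.measurableSet,
    Set.inter_eq_right.2 (Metric.closedBall_subset_closedBall (by linarith)),
    volume_real_closedBall _ (by linarith)] at h1
  have h2 : (π * rA ^ 2)⁻¹ * (π * (rA - t) ^ 2) = ((rA - t) / rA) ^ 2 := by
    have := Real.pi_pos
    field_simp
  linarith

lemma tendsto_nearBoundary (hA : 0 < rA) {ι : Type*} {l : Filter ι} {t : ι → ℝ}
    (h0 : ∀ᶠ i in l, 0 ≤ t i) (ht : Tendsto t l (𝓝 0)) :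
    Tendsto (fun i => (uniformDisk rA).real (nearBoundary rA (t i))) l (𝓝 0) := by
  have h1 : Tendsto (fun i => 1 - ((rA - t i) / rA) ^ 2) l (𝓝 (1 - ((rA - 0) / rA) ^ 2)) :=
    tendsto_const_nhds.sub (((tendsto_const_nhds.sub ht).div_const rA).pow 2)
  rw [sub_zero, div_self hA.ne', one_pow, sub_self] at h1
  refine h1.congr' ?_
  filter_upwards [h0, ht.eventually_le_const hA] with i hi hi'
  exact (uniformDisk_real_nearBoundary hA hi hi').symm

end Gain

/-! ### The throughput and the mean progress in the first slot -/

section Throughput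

variable {rA lam lams : ℝ}

lemma isProbabilityMeasure_poissonNodes (hA : 0 < rA) (lam : ℝ) :
    IsProbabilityMeasure (poissonNodes (Metric.closedBall 0 rA) lam) := by
  have := isProbabilityMeasure_uniformDisk hA
  rw [poissonNodes_disk hA]
  infer_instance

lemma configCount_univ (c : Config) : configCount Set.univ c = c.1 := by
  simp [configCount]

lemma lintegral_card (hA : 0 < rA) (lam : ℝ) :
    ∫⁻ c : Config, ENNReal.ofReal (c.1 : ℝ) ∂poissonNodes (Metric.closedBall 0 rA) lam =
      ENNReal.ofReal (meanCount rA lam) := by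
  have := isProbabilityMeasure_uniformDisk hA
  rw [poissonNodes_disk hA]
  simp_rw [← configCount_univ]
  rw [lintegral_configCount _ _ MeasurableSet.univ, measure_univ, mul_one]
  rfl

lemma measurable_card : Measurable fun c : Config => (c.1 : ℝ) := by
  simp_rw [← configCount_univ]
  exact measurable_configCount' MeasurableSet.univ

lemma integrable_card (hA : 0 < rA) (lam : ℝ) :
    Integrable (fun c : Config => (c.1 : ℝ)) (poissonNodes (Metric.closedBall 0 rA) lam) := by
  refine ⟨measurable_card.aestronglyMeasurable, ?_⟩
  rw [hasFiniteIntegral_iff_ofReal (.of_forall fun c => Nat.cast_nonneg _), lintegral_card hA]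
  exact ENNReal.ofReal_lt_top

lemma integral_card (hA : 0 < rA) (hl : 0 ≤ lam) :
    ∫ c : Config, (c.1 : ℝ) ∂poissonNodes (Metric.closedBall 0 rA) lam = meanCount rA lam := by
  rw [integral_eq_lintegral_of_nonneg_ae (.of_forall fun c => Nat.cast_nonneg _)
    measurable_card.aestronglyMeasurable, lintegral_card hA, ENNReal.toReal_ofReal]
  unfold meanCount
  positivity

lemma integrable_meanProgress (hA : 0 < rA) (lam lams : ℝ) (P : Params) (hR : 0 ≤ P.Rr) (t : ℕ) :
    Integrable (fun c : Config × Config => meanProgress P c.1.2 c.2.2 t)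
      ((poissonNodes (Metric.closedBall 0 rA) lam).prod
        (poissonNodes (Metric.closedBall 0 rA) lams)) := by
  have := isProbabilityMeasure_poissonNodes hA lam
  have := isProbabilityMeasure_poissonNodes hA lams
  refine Integrable.mono' (((integrable_card hA lam).comp_fst
    (poissonNodes (Metric.closedBall 0 rA) lams)).mul_const (P.qp * P.Rr))
    (measurable_meanProgress_config P t).aestronglyMeasurable (.of_forall fun c => ?_)
  exact abs_meanProgress_le P c.1.2 c.2.2 t hR

/-- Averages the bound for fixed locations; the mean number of primary nodes is `meanCount`. -/
lemma abs_throughput_sub_le (hA : 0 < rA) (hl : 0 ≤ lam) (lams : ℝ) (P : Params) (hR : 0 ≤ P.Rr)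
    (t : ℕ) :
    |throughput (Metric.closedBall 0 rA) lam lams P t -
      throughput (Metric.closedBall 0 rA) lam lams P 0| ≤
      meanCount rA lam * (P.qp * P.Rr) * (2 * (t * P.qp)) := by
  have := isProbabilityMeasure_poissonNodes hA lam
  have := isProbabilityMeasure_poissonNodes hA lams
  unfold throughput
  rw [← integral_sub (integrable_meanProgress hA lam lams P hR t)
    (integrable_meanProgress hA lam lams P hR 0), ← Real.norm_eq_abs]
  refine (norm_integral_le_of_norm_le (((integrable_card hA lam).comp_fst
    (poissonNodes (Metric.closedBall 0 rA) lams)).mul_const (2 * (P.qp * P.Rr) * (t * P.qp)))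
    (.of_forall fun c => abs_meanProgress_sub_le P c.1.2 c.2.2 t hR)).trans_eq ?_
  rw [integral_mul_const, integral_fun_fst (f := fun c : Config => (c.1 : ℝ)), probReal_univ,
    one_smul, integral_card hA hl]
  ring

lemma ae_poissonNodes_zero (hA : 0 < rA) :
    ∀ᵐ c ∂poissonNodes (Metric.closedBall 0 rA) 0, c.1 = 0 := by
  have h := lintegral_card hA 0
  rw [meanCount, zero_mul, ENNReal.ofReal_zero,
    lintegral_eq_zero_iff measurable_card.ennreal_ofReal] at h
  filter_upwards [h] with c hc
  have : (c.1 : ℝ) ≤ 0 := ENNReal.ofReal_eq_zero.1 hc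
  exact_mod_cast le_antisymm this (Nat.cast_nonneg _)

/-- A Poisson process of density zero is almost surely empty. The stand-alone network thus becomes a
special case of the overlaid one. -/
lemma singleThroughput_eq (hA : 0 < rA) (lam : ℝ) (P : Params) (hR : 0 ≤ P.Rr) (t : ℕ) :
    singleThroughput (Metric.closedBall 0 rA) lam P t =
      throughput (Metric.closedBall 0 rA) lam 0 P t := by
  have := isProbabilityMeasure_poissonNodes hA lam
  have := isProbabilityMeasure_poissonNodes hA 0
  unfold throughput singleThroughput
  rw [integral_prod _ (integrable_meanProgress hA lam 0 P hR t)]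
  refine integral_congr_ae (.of_forall fun x => ?_)
  have h : (fun c : Config => meanProgress P x.2 c.2 t) =ᵐ[poissonNodes (Metric.closedBall 0 rA) 0]
      fun _ => meanProgress P x.2 (Fin.elim0 : Fin 0 → Plane) t := by
    filter_upwards [ae_poissonNodes_zero hA] with c hc
    obtain ⟨n, y⟩ := c
    obtain rfl : n = 0 := hc
    rw [Subsingleton.elim y (Fin.elim0 : Fin 0 → Plane)]
  simp only
  rw [integral_congr_ae h, integral_const, probReal_univ, one_smul]

/-- The mean progress in the first slot, if the secondary nodes that would transmit over an idle
channel have density `kap`. -/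
def firstProgress (rA lam kap : ℝ) (P : Params) : ℝ :=
  ∫ c : Config, sourceProgress P c.2 (meanHopSuccess P (Metric.closedBall 0 rA) kap c.2)
    ∂poissonNodes (Metric.closedBall 0 rA) lam

/-- Fubini, integrating over the secondary nodes first. -/
lemma throughput_zero (hA : 0 < rA) (lam : ℝ) (hls : 0 ≤ lams) (P : Params) (hR : 0 ≤ P.Rr) :
    Integrable (fun c : Config => sourceProgress P c.2
      (meanHopSuccess P (Metric.closedBall 0 rA) (lams * P.qs) c.2))
      (poissonNodes (Metric.closedBall 0 rA) lam) ∧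
    throughput (Metric.closedBall 0 rA) lam lams P 0 = firstProgress rA lam (lams * P.qs) P := by
  have := isProbabilityMeasure_poissonNodes hA lam
  have := isProbabilityMeasure_poissonNodes hA lams
  have h := integrable_meanProgress hA lam lams P hR 0
  have he := fun x : Config => integral_meanProgress_zero (volume_closedBall_ne_zero 0 hA)
    (volume_closedBall_ne_top 0 rA) hls P x.2
  unfold throughput firstProgress
  rw [integral_prod _ h]
  have hi := h.integral_prod_left
  simp only [he] at hi ⊢
  exact ⟨hi, trivial⟩

/-- Without secondary nodes the ranges `RIsp` and `RD` have no effect and may be set to zero. -/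
lemma firstProgress_zero_congr {P P' : Params} (h1 : P'.Rr = P.Rr) (h2 : P'.RI = P.RI)
    (h3 : P'.qp = P.qp) : firstProgress rA lam 0 P' = firstProgress rA lam 0 P := by
  refine integral_congr_ae (.of_forall fun c => ?_)
  have hT : meanHopSuccess P' (Metric.closedBall 0 rA) 0 c.2 =
      meanHopSuccess P (Metric.closedBall 0 rA) 0 c.2 := by
    ext i j
    simp only [meanHopSuccess, PrimaryClear, h2, h3, zero_mul]
  have hN : ∀ i d, nextHops P' c.2 i d = nextHops P c.2 i d := fun i d => by
    unfold nextHops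
    rw [h1]
  simp only [hT, sourceProgress, hN]

/-- A bound for the relative error of the approximation of the mean progress. -/
def relativeError (rA lam kap e t : ℝ) (P : Params) : ℝ :=
  1 / √(meanCount rA lam) + (1 / √(meanHops lam P.Rr) +
    2 * (uniformDisk rA).real (nearBoundary rA t) + P.Rr ^ 2 / rA ^ 2) +
  (e / 2 + kap ^ 2 / (2 * e) * coverBound P.qp P.RD P.RIsp +
    (uniformDisk rA).real (nearBoundary rA t)) +
  (2 * P.qp + (uniformDisk rA).real (nearBoundary rA t))

lemma abs_integral_sub_le {μ : Measure Config} {f g : Config → ℝ} (hf : Integrable f μ)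
    (hg : Integrable g μ) {F₁ F₂ F₃ : Config → ℝ≥0∞} {a₁ a₂ a₃ : ℝ} (h1 : 0 ≤ a₁) (h2 : 0 ≤ a₂)
    (h3 : 0 ≤ a₃) (hm1 : Measurable F₁) (hm2 : Measurable F₂)
    (h : ∀ c, ENNReal.ofReal |f c - g c| ≤ F₁ c + F₂ c + F₃ c)
    (e1 : ∫⁻ c, F₁ c ∂μ ≤ ENNReal.ofReal a₁) (e2 : ∫⁻ c, F₂ c ∂μ ≤ ENNReal.ofReal a₂)
    (e3 : ∫⁻ c, F₃ c ∂μ ≤ ENNReal.ofReal a₃) :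
    |∫ c, f c ∂μ - ∫ c, g c ∂μ| ≤ a₁ + a₂ + a₃ := by
  have hi : Integrable (fun c => |f c - g c|) μ := (hf.sub hg).abs
  rw [← integral_sub hf hg]
  refine (abs_integral_le_integral_abs).trans ?_
  rw [← ENNReal.ofReal_le_ofReal_iff (by positivity),
    ofReal_integral_eq_lintegral_ofReal hi (.of_forall fun _ => abs_nonneg _),
    ENNReal.ofReal_add (by positivity) h3, ENNReal.ofReal_add h1 h2]
  refine (lintegral_mono h).trans ?_
  have hm12 : Measurable fun c => F₁ c + F₂ c := hm1.add hm2
  rw [lintegral_add_left hm12, lintegral_add_left hm1]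
  gcongr

/-- Replaces, up to small relative errors, the random denominators by their means, the secondary
interference by the constant factor `silenceProb`, and the clear-channel probability by `idleProb
lam qp RI`. -/
lemma abs_firstProgress_sub_le (hA : 0 < rA) (hl : 0 < lam) (hls : 0 ≤ lams) {e t : ℝ} (he : 0 < e)
    (P : Params) (hR : 0 < P.Rr) (hRI : 0 ≤ P.RI) (hRsp : 0 ≤ P.RIsp) (hRD : 0 ≤ P.RD)
    (ht : P.Rr + P.RI + P.RIsp + P.RD ≤ t) :
    |firstProgress rA lam (lams * P.qs) P - meanCount rA lam * (P.qp * P.Rr) *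
      (silenceProb (lams * P.qs) (idleProb lam P.qp P.RD) P.RIsp * (idleProb lam P.qp P.RI *
        (2 * rA ^ 2 / P.Rr ^ 3 * relayIntegral rA P.Rr)))| ≤
      meanCount rA lam * (P.qp * P.Rr) * relativeError rA lam (lams * P.qs) e t P := by
  classical
  have hq := P.qp.2.1
  have hk : 0 ≤ lams * P.qs := mul_nonneg hls P.qs.2.1
  have hr : 0 < meanCount rA lam := by unfold meanCount; positivity
  have hh : 0 < meanHops lam P.Rr := by unfold meanHops; positivity
  set A : Set Plane := Metric.closedBall 0 rA with hAd
  set kap := lams * P.qs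
  set s := silenceProb kap (idleProb lam P.qp P.RD) P.RIsp with hs
  have hp0 := (idleProb_pos lam P.qp P.RD).le
  have s0 : 0 ≤ s := (Real.exp_pos _).le
  have s1 : s ≤ 1 := Real.exp_le_one_iff.2 (neg_nonpos.2 (by positivity))
  have hf := (throughput_zero hA lam hls P hR.le).1
  obtain ⟨hg, -, -⟩ := integral_relaySum_progress hA hl P hR
  have hb : 0 ≤ coverBound P.qp P.RD P.RIsp := by unfold coverBound; positivity
  have hm1 : Measurable fun c => ENNReal.ofReal |configCount Set.univ c / meanCount rA lam - 1| := by
    have h0 := measurable_configCount' MeasurableSet.univ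
    exact ((h0.div_const _).sub_const 1).norm.ennreal_ofReal
  have hM1 : Measurable (palmSum fun _ c => ENNReal.ofReal (P.qp * P.Rr) *
      ENNReal.ofReal |configCount Set.univ c / meanCount rA lam - 1|) :=
    measurable_palmSum' ((hm1.const_mul _).comp measurable_snd)
  have hm2 : Measurable fun p : (Plane × Plane) × Config => ENNReal.ofReal
      (P.qp * P.Rr / meanCount rA lam) * if P.Rr < dist p.1.1 p.1.2 then ENNReal.ofReal
        |configCount (halfDisk P.Rr p.1.1 p.1.2) p.2 / meanHops lam P.Rr - 1| else 1 := by
    have h0 : Measurable fun p : (Plane × Plane) × Config =>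
        configCount (halfDisk P.Rr p.1.1 p.1.2) p.2 :=
      measurable_configCount (s := fun b : Plane × Plane => halfDisk P.Rr b.1 b.2)
        (measurableSet_halfDisk P.Rr)
    refine (Measurable.ite (measurableSet_lt measurable_const
      (measurable_fst.fst.dist measurable_fst.snd)) ?_ measurable_const).const_mul _
    exact ((h0.div_const _).sub_const 1).norm.ennreal_ofReal
  have hM2 : Measurable (palmSum fun u => palmSum fun v c => ENNReal.ofReal
      (P.qp * P.Rr / meanCount rA lam) * if P.Rr < dist u v then ENNReal.ofReal
        |configCount (halfDisk P.Rr u v) c / meanHops lam P.Rr - 1| else 1) :=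
    measurable_palmSum' (measurable_palmSum (F := fun u v c => ENNReal.ofReal
      (P.qp * P.Rr / meanCount rA lam) * if P.Rr < dist u v then ENNReal.ofReal
        |configCount (halfDisk P.Rr u v) c / meanHops lam P.Rr - 1| else 1) hm2)
  have key := abs_integral_sub_le hf (hg.const_mul (s * (meanCount rA lam * meanHops lam P.Rr)⁻¹))
    (a₁ := meanCount rA lam * (P.qp * P.Rr) * (1 / √(meanCount rA lam)))
    (a₂ := meanCount rA lam ^ 2 * (P.qp * P.Rr / meanCount rA lam) * (1 / √(meanHops lam P.Rr) +
      2 * (uniformDisk rA).real (nearBoundary rA t) + P.Rr ^ 2 / rA ^ 2))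
    (a₃ := meanCount rA lam * (P.qp * P.Rr) * (e / 2 + kap ^ 2 / (2 * e) *
        coverBound P.qp P.RD P.RIsp + (uniformDisk rA).real (nearBoundary rA t)))
    (by positivity) (by positivity) (by positivity) hM1 hM2 (fun c => ?_)
    (lintegral_node_error hA hl (by positivity))
    (lintegral_pair_error hA hl (by positivity) hR (by linarith))
    (lintegral_relay_error hA hl P hk he hR hRsp hRD (by linarith))
  · rw [integral_const_mul] at key
    have key2 := abs_integral_relaySum_sub_le hA hl P hR hRI (t := t) (by linarith)
    set I := ∫ c : Config, (relaySum P c.2 fun i d j =>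
      progress c.2 i j d * meanHopSuccess P A 0 c.2 i j) ∂poissonNodes A lam
    set L := meanCount rA lam * (P.qp * P.Rr) with hL
    set G := idleProb lam P.qp P.RI * (2 * rA ^ 2 / P.Rr ^ 3 * relayIntegral rA P.Rr)
    -- The first bracket compares with the sum over triples; the second, multiplied by `s ≤ 1`, is
    -- the error for the stand-alone network.
    have e1 : firstProgress rA lam kap P - L * (s * G) =
        (firstProgress rA lam kap P - s * (meanCount rA lam * meanHops lam P.Rr)⁻¹ * I) +
        s * ((meanCount rA lam * meanHops lam P.Rr)⁻¹ * I - L * G) := by ring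
    have e2 : meanCount rA lam ^ 2 * (P.qp * P.Rr / meanCount rA lam) = L := by
      rw [hL]
      field_simp
    rw [e2] at key
    have e3 : |s * ((meanCount rA lam * meanHops lam P.Rr)⁻¹ * I - L * G)| ≤
        L * (2 * P.qp + (uniformDisk rA).real (nearBoundary rA t)) := by
      rw [abs_mul, abs_of_nonneg s0]
      exact (mul_le_of_le_one_left (abs_nonneg _) s1).trans key2
    rw [e1]
    refine (abs_add_le _ _).trans ((add_le_add key e3).trans_eq ?_)
    rw [relativeError]
    ring
  · obtain ⟨n, x⟩ := c
    rw [← ofReal_node_sum x (by positivity : 0 ≤ P.qp * P.Rr),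
      ← ofReal_pair_sum P x (by positivity : 0 ≤ P.qp * P.Rr / meanCount rA lam)]
    refine (ENNReal.ofReal_le_ofReal (abs_sourceProgress_sub_le hR.le
      (fun i j => meanHopSuccess_nonneg P A kap x i j) (fun i j => meanHopSuccess_le P A hk x i j)
      hr hh (T₀ := meanHopSuccess P A 0 x) (s := s))).trans ?_
    exact ENNReal.ofReal_add_le.trans (add_le_add ENNReal.ofReal_add_le le_rfl)

end Throughput

/-! ### Asymptotics -/

section Asymptotics

variable {rA : ℝ}

lemma tendsto_div_of_abs_sub_le {C L G E f : ℝ → ℝ} {K g : ℝ}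
    (h : ∀ᶠ lam in atTop, |C lam - L lam * G lam| ≤ L lam * E lam)
    (hf : ∀ᶠ lam in atTop, 0 < f lam) (hL : Tendsto (fun lam => L lam / f lam) atTop (𝓝 K))
    (hG : Tendsto G atTop (𝓝 g)) (hE : Tendsto E atTop (𝓝 0)) :
    Tendsto (fun lam => C lam / f lam) atTop (𝓝 (K * g)) := by
  have h1 : Tendsto (fun lam => L lam / f lam * G lam) atTop (𝓝 (K * g)) := hL.mul hG
  have h2 : Tendsto (fun lam => L lam / f lam * E lam) atTop (𝓝 0) := by
    simpa using hL.mul hE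
  have h3 : Tendsto (fun lam => C lam / f lam - L lam / f lam * G lam) atTop (𝓝 0) := by
    refine squeeze_zero_norm' ?_ h2
    filter_upwards [h, hf] with lam ha hb
    have : C lam / f lam - L lam / f lam * G lam = (C lam - L lam * G lam) / f lam := by ring
    rw [this, Real.norm_eq_abs, abs_div, abs_of_pos hb, div_mul_eq_mul_div]
    gcongr
  simpa using h3.add h1

lemma isAMG_of_tendsto {C f : ℝ → ℝ} {χ : ℝ} (hχ : χ ≠ 0)
    (h : Tendsto (fun lam => C lam / f lam) atTop (𝓝 χ)) : IsAMG C f χ :=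
  ⟨(isTheta_of_div_tendsto_nhds_ne_zero h hχ).symm, h⟩

/-- The sum `e / 2 + b / (2 e)`, with `b = kap² * coverBound`, is smallest at `e = √b`. The summand
`lam⁻¹` keeps `e` positive when `b = 0`, as it is without secondary nodes. -/
lemma tendsto_relativeError (hA : 0 < rA) {kap : ℝ → ℝ} {P : ℝ → Params}
    (hRr0 : ∀ᶠ lam in atTop, 0 < (P lam).Rr) (hRI0 : ∀ᶠ lam in atTop, 0 ≤ (P lam).RI)
    (hRsp0 : ∀ᶠ lam in atTop, 0 ≤ (P lam).RIsp) (hRD0 : ∀ᶠ lam in atTop, 0 ≤ (P lam).RD)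
    (hRr : Tendsto (fun lam => (P lam).Rr) atTop (𝓝 0))
    (hRI : Tendsto (fun lam => (P lam).RI) atTop (𝓝 0))
    (hRsp : Tendsto (fun lam => (P lam).RIsp) atTop (𝓝 0))
    (hRD : Tendsto (fun lam => (P lam).RD) atTop (𝓝 0))
    (hq : Tendsto (fun lam => ((P lam).qp : ℝ)) atTop (𝓝 0))
    (hh : Tendsto (fun lam => meanHops lam (P lam).Rr) atTop atTop)
    (hb : Tendsto (fun lam => kap lam ^ 2 * coverBound (P lam).qp (P lam).RD (P lam).RIsp)
      atTop (𝓝 0)) :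
    Tendsto (fun lam => relativeError rA lam (kap lam)
      (√(kap lam ^ 2 * coverBound (P lam).qp (P lam).RD (P lam).RIsp) + lam⁻¹)
      ((P lam).Rr + (P lam).RI + (P lam).RIsp + (P lam).RD) (P lam)) atTop (𝓝 0) := by
  set b : ℝ → ℝ := fun lam => kap lam ^ 2 * coverBound (P lam).qp (P lam).RD (P lam).RIsp with hbd
  have hr : Tendsto (fun lam => meanCount rA lam) atTop atTop :=
    tendsto_id.atTop_mul_const (by positivity)
  have e1 : Tendsto (fun lam => 1 / √(meanCount rA lam)) atTop (𝓝 0) :=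
    tendsto_const_nhds.div_atTop (tendsto_sqrt_atTop.comp hr)
  have e2 : Tendsto (fun lam => 1 / √(meanHops lam (P lam).Rr)) atTop (𝓝 0) :=
    tendsto_const_nhds.div_atTop (tendsto_sqrt_atTop.comp hh)
  have et : Tendsto (fun lam => (P lam).Rr + (P lam).RI + (P lam).RIsp + (P lam).RD) atTop (𝓝 0) := by
    simpa using ((hRr.add hRI).add hRsp).add hRD
  have e3 := tendsto_nearBoundary hA (t := fun lam =>
    (P lam).Rr + (P lam).RI + (P lam).RIsp + (P lam).RD) (by
      filter_upwards [hRr0, hRI0, hRsp0, hRD0] with lam h1 h2 h3 h4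
      positivity) et
  have e4 : Tendsto (fun lam => (P lam).Rr ^ 2 / rA ^ 2) atTop (𝓝 0) := by
    simpa using (hRr.pow 2).div_const (rA ^ 2)
  have es : Tendsto (fun lam => √(b lam)) atTop (𝓝 0) := by
    simpa [Function.comp_def] using (Real.continuous_sqrt.tendsto 0).comp hb
  have ee : Tendsto (fun lam => √(b lam) + lam⁻¹) atTop (𝓝 0) := by
    simpa using es.add tendsto_inv_atTop_zero
  have e5 : Tendsto (fun lam => (√(b lam) + lam⁻¹) / 2 + kap lam ^ 2 / (2 * (√(b lam) + lam⁻¹)) *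
      coverBound (P lam).qp (P lam).RD (P lam).RIsp) atTop (𝓝 0) := by
    -- Since `e ≥ √b`, the quotient `b / (2 e)` is at most `√b / 2`.
    have hz : Tendsto (fun lam => (√(b lam) + lam⁻¹) / 2 + √(b lam) / 2) atTop (𝓝 0) := by
      simpa using (ee.div_const 2).add (es.div_const 2)
    have hb0 : ∀ lam, 0 ≤ coverBound (P lam).qp (P lam).RD (P lam).RIsp := fun lam => by
      have := (P lam).qp.2.1
      unfold coverBound
      positivity
    refine squeeze_zero' ?_ ?_ hz
    · filter_upwards [eventually_gt_atTop 0] with lam hl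
      have := hb0 lam
      positivity
    · filter_upwards [eventually_gt_atTop 0] with lam hl
      refine add_le_add le_rfl ?_
      have h1 : kap lam ^ 2 / (2 * (√(b lam) + lam⁻¹)) *
          coverBound (P lam).qp (P lam).RD (P lam).RIsp = b lam / (2 * (√(b lam) + lam⁻¹)) := by
        rw [hbd]
        ring
      have h2 : 0 ≤ b lam := mul_nonneg (sq_nonneg _) (hb0 lam)
      have h3 : 0 < lam⁻¹ := inv_pos.2 hl
      have h4 := Real.sqrt_nonneg (b lam)
      rw [h1, div_le_div_iff₀ (by positivity) two_pos]
      nlinarith [Real.sq_sqrt h2]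
  have := (((e1.add ((e2.add (e3.const_mul 2)).add e4)).add (e5.add e3)).add ((hq.const_mul 2).add e3))
  simpa [relativeError] using this

/-- The limit has one factor per mechanism: `K` for the scale, `exp (-σ)` for silent secondary
nodes, `exp (-c)` for silent primary nodes, and `meanGain` for the geometry of a hop. -/
lemma tendsto_throughput_div (hA : 0 < rA) {c σ K : ℝ} {C f lams : ℝ → ℝ} {P : ℝ → Params} {t : ℕ}
    (hls : ∀ᶠ lam in atTop, 0 ≤ lams lam)
    (hC : ∀ᶠ lam in atTop, |C lam - firstProgress rA lam (lams lam * (P lam).qs) (P lam)| ≤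
      meanCount rA lam * ((P lam).qp * (P lam).Rr) * (2 * (t * (P lam).qp)))
    (hf : ∀ᶠ lam in atTop, 0 < f lam)
    (hL : Tendsto (fun lam => meanCount rA lam * ((P lam).qp * (P lam).Rr) / f lam) atTop (𝓝 K))
    (hRr0 : ∀ᶠ lam in atTop, 0 < (P lam).Rr) (hRI0 : ∀ᶠ lam in atTop, 0 ≤ (P lam).RI)
    (hRsp0 : ∀ᶠ lam in atTop, 0 ≤ (P lam).RIsp) (hRD0 : ∀ᶠ lam in atTop, 0 ≤ (P lam).RD)
    (hRr : Tendsto (fun lam => (P lam).Rr) atTop (𝓝 0))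
    (hRI : Tendsto (fun lam => (P lam).RI) atTop (𝓝 0))
    (hRsp : Tendsto (fun lam => (P lam).RIsp) atTop (𝓝 0))
    (hRD : Tendsto (fun lam => (P lam).RD) atTop (𝓝 0))
    (hq : Tendsto (fun lam => ((P lam).qp : ℝ)) atTop (𝓝 0))
    (hh : Tendsto (fun lam => meanHops lam (P lam).Rr) atTop atTop)
    (hc : Tendsto (fun lam => lam * (P lam).qp * (π * (P lam).RI ^ 2)) atTop (𝓝 c))
    (hσ : Tendsto (fun lam => lams lam * (P lam).qs *
      (idleProb lam (P lam).qp (P lam).RD * (π * (P lam).RIsp ^ 2))) atTop (𝓝 σ))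
    (hb : Tendsto (fun lam => (lams lam * (P lam).qs) ^ 2 *
      coverBound (P lam).qp (P lam).RD (P lam).RIsp) atTop (𝓝 0)) :
    Tendsto (fun lam => C lam / f lam) atTop
      (𝓝 (K * (rexp (-σ) * (rexp (-c) * meanGain rA)))) := by
  have hE := (tendsto_relativeError hA hRr0 hRI0 hRsp0 hRD0 hRr hRI hRsp hRD hq hh hb).add
    ((hq.const_mul (t : ℝ)).const_mul 2)
  simp only [mul_zero, add_zero] at hE
  have hJ : Tendsto (fun lam => 2 * rA ^ 2 / (P lam).Rr ^ 3 * relayIntegral rA (P lam).Rr) atTop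
      (𝓝 (meanGain rA)) :=
    (tendsto_relayIntegral hA).comp (tendsto_nhdsWithin_iff.2 ⟨hRr, hRr0⟩)
  have hG : Tendsto (fun lam => silenceProb (lams lam * (P lam).qs)
      (idleProb lam (P lam).qp (P lam).RD) (P lam).RIsp * (idleProb lam (P lam).qp (P lam).RI *
        (2 * rA ^ 2 / (P lam).Rr ^ 3 * relayIntegral rA (P lam).Rr))) atTop
      (𝓝 (rexp (-σ) * (rexp (-c) * meanGain rA))) :=
    ((Real.continuous_exp.tendsto _).comp hσ.neg).mul
      (((Real.continuous_exp.tendsto _).comp hc.neg).mul hJ)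
  refine tendsto_div_of_abs_sub_le ?_ hf hL hG hE
  filter_upwards [hls, hC, hRr0, hRI0, hRsp0, hRD0, eventually_gt_atTop 0] with lam h1 h2 h3 h4 h5
    h6 hl
  have h7 := abs_firstProgress_sub_le hA hl h1 (e := √((lams lam * (P lam).qs) ^ 2 *
    coverBound (P lam).qp (P lam).RD (P lam).RIsp) + lam⁻¹)
    (add_pos_of_nonneg_of_pos (Real.sqrt_nonneg _) (inv_pos.2 hl)) (P lam) h3 h4 h5 h6 le_rfl
  refine (abs_sub_le _ (firstProgress rA lam (lams lam * (P lam).qs) (P lam)) _).trans ?_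
  refine (add_le_add h2 h7).trans_eq ?_
  ring

end Asymptotics

/-! ### Asymptotics of the ranges and of the access probabilities. -/

section Ranges

lemma log_div_pos {lam : ℝ} (h : 1 < lam) : 0 < log lam / lam :=
  div_pos (Real.log_pos h) (by linarith)

lemma txRange_sq (K : ℝ) {lam : ℝ} (h : 1 < lam) : txRange K lam ^ 2 = K ^ 2 * (log lam / lam) := by
  rw [txRange, mul_pow, Real.sq_sqrt (log_div_pos h).le]

lemma intfRange_sq (K : ℝ) {l lam : ℝ} (hl : 0 ≤ l) (h : 1 < lam) :
    intfRange K l lam ^ 2 = (1 + l) * (K ^ 2 * (log lam / lam)) := by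
  rw [intfRange, mul_pow, Real.sq_sqrt (by linarith), txRange_sq K h]

lemma txRange_pos {K lam : ℝ} (hK : 0 < K) (h : 1 < lam) : 0 < txRange K lam :=
  mul_pos hK (Real.sqrt_pos.2 (log_div_pos h))

lemma intfRange_nonneg {K : ℝ} (hK : 0 < K) (l lam : ℝ) : 0 ≤ intfRange K l lam := by
  unfold intfRange txRange
  positivity

lemma tendsto_txRange (K : ℝ) : Tendsto (txRange K) atTop (𝓝 0) := by
  have h1 : Tendsto (fun lam : ℝ => log lam / lam) atTop (𝓝 0) :=
    isLittleO_log_id_atTop.tendsto_div_nhds_zero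
  have h2 := ((Real.continuous_sqrt.tendsto 0).comp h1).const_mul K
  rw [Real.sqrt_zero, mul_zero] at h2
  exact h2

lemma tendsto_intfRange (K l : ℝ) : Tendsto (intfRange K l) atTop (𝓝 0) := by
  have := (tendsto_txRange K).const_mul (√(1 + l))
  rw [mul_zero] at this
  exact this

lemma tendsto_meanHops {K : ℝ} (hK : 0 < K) :
    Tendsto (fun lam => meanHops lam (txRange K lam)) atTop atTop := by
  have h : Tendsto (fun lam : ℝ => π * K ^ 2 / 2 * log lam) atTop atTop :=
    Real.tendsto_log_atTop.const_mul_atTop (by have := Real.pi_pos; positivity)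
  refine h.congr' ?_
  filter_upwards [eventually_gt_atTop 1] with lam hl
  rw [meanHops, txRange_sq K hl]
  field_simp

variable {K l c : ℝ} {q : ℝ → unitInterval}

/-- The quantity in `hq` is `π (1 + l) K² q log lam`, so `q` is of order at most `1 / log lam`. -/
lemma tendsto_access (hK : 0 < K) (hl : 0 ≤ l)
    (hq : Tendsto (fun lam : ℝ => lam * q lam * (π * intfRange K l lam ^ 2)) atTop (𝓝 c)) :
    Tendsto (fun lam => (q lam : ℝ)) atTop (𝓝 0) := by
  have h := hq.div_atTop (Real.tendsto_log_atTop.const_mul_atTop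
    (by have := Real.pi_pos; positivity : 0 < π * ((1 + l) * K ^ 2)))
  refine h.congr' ?_
  filter_upwards [eventually_gt_atTop 1] with lam h1
  have := Real.log_pos h1
  rw [intfRange_sq K hl h1]
  field_simp

/-- The normalisation `√(lam / log lam)` is the inverse of `√(log lam / lam)`, so dividing by it
supplies the second factor of the transmission range that `hq` contains. -/
lemma tendsto_scale {rA : ℝ} (hK : 0 < K) (hl : 0 ≤ l)
    (hq : Tendsto (fun lam : ℝ => lam * q lam * (π * intfRange K l lam ^ 2)) atTop (𝓝 c)) :
    Tendsto (fun lam => meanCount rA lam * (q lam * txRange K lam) / √(lam / log lam)) atTop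
      (𝓝 (rA ^ 2 / ((1 + l) * K) * c)) := by
  refine (hq.const_mul (rA ^ 2 / ((1 + l) * K))).congr' ?_
  filter_upwards [eventually_gt_atTop 1] with lam h1
  have hs := log_div_pos h1
  have h2 : √(lam / log lam) = (√(log lam / lam))⁻¹ := by rw [← Real.sqrt_inv, inv_div]
  rw [intfRange_sq K hl h1, h2, div_inv_eq_mul, meanCount, txRange]
  have h3 : lam * (π * rA ^ 2) * (q lam * (K * √(log lam / lam))) * √(log lam / lam) =
      lam * (π * rA ^ 2) * (q lam * K) * (√(log lam / lam) * √(log lam / lam)) := by ring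
  rw [h3, Real.mul_self_sqrt hs.le]
  field_simp

/-- The separation of scales: the logarithms cancel up to the constant `β`, and the ratio is a
multiple of `lam ^ (β - 1)`. This uses `β < 1`. -/
lemma tendsto_txRange_sq_div {K' l' β ρ : ℝ} (hK' : 0 < K') (hl' : 0 ≤ l') (hβ0 : 0 < β)
    (hβ1 : β < 1) (hρ : 1 ≤ ρ) :
    Tendsto (fun lam => txRange K lam ^ 2 / (ρ * intfRange K' l' (lam ^ β)) ^ 2) atTop (𝓝 0) := by
  have h := (tendsto_rpow_neg_atTop (sub_pos.2 hβ1)).const_mul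
    (K ^ 2 / (ρ ^ 2 * ((1 + l') * K' ^ 2) * β))
  rw [mul_zero] at h
  refine h.congr' ?_
  filter_upwards [eventually_gt_atTop 1] with lam h1
  have hl0 : 0 < lam := by linarith
  have hb : 1 < lam ^ β := Real.one_lt_rpow h1 hβ0
  have hlog := Real.log_pos h1
  rw [txRange_sq K h1, mul_pow, intfRange_sq K' hl' hb, Real.log_rpow hl0, neg_sub,
    Real.rpow_sub hl0, Real.rpow_one]
  have hb0 : 0 < lam ^ β := by linarith
  field_simp

/-- Write `S` for the secondary interference range and `Y` for the secondary access density times `π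
S²`. The quantity equals `4 q Y² + 12 (RD / S)² Y²`; here `Y` is bounded, `q → 0`, and `RD / S → 0`
by the separation of scales. -/
lemma tendsto_coverBound (hl : 0 ≤ l) {K' l' β ρ : ℝ} (hK : 0 < K) (hK' : 0 < K')
    (hl' : 0 ≤ l') (hβ0 : 0 < β) (hβ1 : β < 1) (hρ : 1 ≤ ρ)
    (hq : Tendsto (fun lam : ℝ => lam * q lam * (π * intfRange K l lam ^ 2)) atTop (𝓝 c))
    {RD : ℝ → ℝ} (hRD0 : ∀ lam, 0 ≤ RD lam) (hRD : RD =O[atTop] fun lam => txRange K lam)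
    {qs : ℝ → unitInterval} {σ : ℝ}
    (hσ : Tendsto (fun lam => lam ^ β * qs lam * (idleProb lam (q lam) (RD lam) *
      (π * (ρ * intfRange K' l' (lam ^ β)) ^ 2))) atTop (𝓝 σ)) :
    Tendsto (fun lam => (lam ^ β * qs lam) ^ 2 *
      coverBound (q lam) (RD lam) (ρ * intfRange K' l' (lam ^ β))) atTop (𝓝 0) := by
  obtain ⟨B, hB0, hB⟩ := hRD.exists_nonneg
  rw [IsBigOWith] at hB
  -- The hypothesis bounds `Y` only after multiplication by the idle probability. As the detection
  -- range is at most `B` times the transmission range, the exponent in the idle probability is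
  -- eventually at most `B² (c + 1)`, so dividing by it costs a bounded factor.
  set M := (σ + 1) * rexp (B ^ 2 * (c + 1)) with hM
  have hz : Tendsto (fun lam => 4 * (q lam : ℝ) * M ^ 2 + 12 * (B ^ 2 *
      (txRange K lam ^ 2 / (ρ * intfRange K' l' (lam ^ β)) ^ 2)) * M ^ 2) atTop (𝓝 0) := by
    have := (((tendsto_access hK hl hq).const_mul 4).mul_const (M ^ 2)).add
      ((((tendsto_txRange_sq_div (K := K) hK' hl' hβ0 hβ1 hρ).const_mul (B ^ 2)).const_mul
        12).mul_const (M ^ 2))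
    simpa using this
  have hq0 := fun lam => (q lam).2.1
  refine squeeze_zero' (.of_forall fun lam => ?_) ?_ hz
  · have := hq0 lam
    unfold coverBound
    positivity
  filter_upwards [hB, eventually_gt_atTop 1, hq.eventually_le_const (lt_add_one c),
    hσ.eventually_le_const (lt_add_one σ)] with lam h1 hlam h2 h3
  have hl0 : 0 < lam := by linarith
  have hb : 1 < lam ^ β := Real.one_lt_rpow hlam hβ0
  have hlog := Real.log_pos hlam
  have hR0 := txRange_pos hK hlam
  set S := ρ * intfRange K' l' (lam ^ β) with hS
  have hS0 : 0 < S ^ 2 := by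
    rw [hS, mul_pow, intfRange_sq K' hl' hb]
    have := log_div_pos hb
    positivity
  have hRDB : RD lam ^ 2 ≤ B ^ 2 * txRange K lam ^ 2 := by
    rw [← mul_pow]
    rw [Real.norm_of_nonneg (hRD0 lam), Real.norm_of_nonneg hR0.le] at h1
    exact pow_le_pow_left₀ (hRD0 lam) h1 2
  have hY : lam ^ β * qs lam * (π * S ^ 2) ≤ M := by
    have e1 : lam ^ β * qs lam * (π * S ^ 2) = lam ^ β * qs lam *
        (idleProb lam (q lam) (RD lam) * (π * S ^ 2)) *
        rexp (lam * q lam * (π * RD lam ^ 2)) := by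
      have : idleProb lam (q lam) (RD lam) * rexp (lam * q lam * (π * RD lam ^ 2)) = 1 := by
        rw [idleProb, ← Real.exp_add, neg_add_cancel, Real.exp_zero]
      linear_combination -(lam ^ β * qs lam * (π * S ^ 2)) * this
    have e2 : lam * q lam * (π * RD lam ^ 2) ≤ B ^ 2 * (c + 1) := by
      have hI : txRange K lam ^ 2 ≤ intfRange K l lam ^ 2 := by
        rw [intfRange_sq K hl hlam, ← txRange_sq K hlam]
        nlinarith [sq_nonneg (txRange K lam)]
      have hlq : 0 ≤ lam * q lam := mul_nonneg hl0.le (hq0 lam)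
      calc lam * q lam * (π * RD lam ^ 2) ≤ lam * q lam * (π * (B ^ 2 * intfRange K l lam ^ 2)) := by
            gcongr
            exact hRDB.trans (mul_le_mul_of_nonneg_left hI (sq_nonneg B))
        _ = B ^ 2 * (lam * q lam * (π * intfRange K l lam ^ 2)) := by ring
        _ ≤ _ := mul_le_mul_of_nonneg_left h2 (sq_nonneg B)
    have hσ0 : 0 ≤ lam ^ β * qs lam * (idleProb lam (q lam) (RD lam) * (π * S ^ 2)) := by
      have := (qs lam).2.1
      have := (idleProb_pos lam (q lam) (RD lam)).le
      positivity
    rw [e1, hM]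
    exact mul_le_mul h3 (Real.exp_le_exp.2 e2) (Real.exp_pos _).le (hσ0.trans h3)
  have hY0 : 0 ≤ lam ^ β * qs lam * (π * S ^ 2) := by
    have := (qs lam).2.1
    positivity
  have e3 : (lam ^ β * qs lam) ^ 2 * coverBound (q lam) (RD lam) S =
      4 * q lam * (lam ^ β * qs lam * (π * S ^ 2)) ^ 2 +
      12 * (RD lam ^ 2 / S ^ 2) * (lam ^ β * qs lam * (π * S ^ 2)) ^ 2 := by
    unfold coverBound
    field_simp
  have hq0' := hq0 lam
  rw [e3, ← mul_div_assoc (B ^ 2)]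
  gcongr

end Ranges

end OverlaidAloha

end

/-! ### The main theorem. -/

open OverlaidAloha in
theorem mainTheorem3
    -- radius of the circular region, constants of the transmission and interference ranges
    (rA Kp Ks lp ls : ℝ) (hrA : 0 < rA) (hKp : 0 < Kp) (hKs : 0 < Ks) (hlp : 0 ≤ lp) (hls : 0 ≤ ls)
    -- the secondary density is `lam ^ β`; `ρ` is the constant ratio of the interference ranges
    -- from secondary transmitters to primary and to secondary receivers
    (β ρ : ℝ) (hβ0 : 0 < β) (hβ1 : β < 1) (hρ : 1 ≤ ρ)
    -- the ALOHA parameter of the primary network, of exact order `1 / log lam`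
    (qp : ℝ → unitInterval) (c : ℝ) (hc : 0 < c)
    (hqp : Tendsto (fun lam : ℝ => lam * qp lam * (π * intfRange Kp lp lam ^ 2)) atTop (𝓝 c)) :
    ∃ χ χ' : ℝ, 0 < χ ∧ χ' / χ = exp (-ρ ^ 2) ∧
      ∀ t : ℕ,
        -- the stand-alone primary network
        (∀ RIsp RD : ℝ → ℝ, ∀ qs : ℝ → unitInterval,
          IsAMG
            (fun lam => singleThroughput (Metric.closedBall 0 rA) lam
              ⟨txRange Kp lam, intfRange Kp lp lam, RIsp lam, RD lam, qp lam, qs lam⟩ t)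
            (fun lam => √(lam / log lam)) χ) ∧
        -- the overlaid primary network, for every detection range (including no sensing)
        ∀ RD : ℝ → ℝ, (∀ lam, 0 ≤ RD lam) → RD =O[atTop] (fun lam => txRange Kp lam) →
          ∀ qs : ℝ → unitInterval,
            Tendsto (fun lam : ℝ => lam ^ β * effectiveAccess (qs lam) (qp lam) lam (RD lam) *
              (π * intfRange Ks ls (lam ^ β) ^ 2)) atTop (𝓝 1) →
            IsAMG
              (fun lam => throughput (Metric.closedBall 0 rA) lam (lam ^ β)
                ⟨txRange Kp lam, intfRange Kp lp lam, ρ * intfRange Ks ls (lam ^ β), RD lam,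
                  qp lam, qs lam⟩ t)
              (fun lam => √(lam / log lam)) χ' := by
  have hpi := Real.pi_pos
  have hmg := meanGain_pos hrA
  have hf : ∀ᶠ lam in atTop, 0 < √(lam / log lam) := by
    filter_upwards [eventually_gt_atTop 1] with lam hl
    exact Real.sqrt_pos.2 (div_pos (by linarith) (Real.log_pos hl))
  have hRr0 : ∀ᶠ lam in atTop, 0 < txRange Kp lam :=
    (eventually_gt_atTop 1).mono fun lam hl => txRange_pos hKp hl
  have hq := tendsto_access hKp hlp hqp
  have hscale := tendsto_scale (rA := rA) hKp hlp hqp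
  set K₀ := rA ^ 2 / ((1 + lp) * Kp) * c with hK₀
  have hK₀pos : 0 < K₀ := by positivity
  -- Both constants are the limit in `tendsto_throughput_div`, with `σ = 0` in the stand-alone case
  -- and `σ = ρ ^ 2` in the overlaid one.
  refine ⟨K₀ * (rexp (-0) * (rexp (-c) * meanGain rA)),
    K₀ * (rexp (-(ρ ^ 2)) * (rexp (-c) * meanGain rA)), by positivity, ?_, fun t => ⟨?_, ?_⟩⟩
  · have h1 := Real.exp_pos (-c)
    rw [neg_zero, Real.exp_zero, one_mul]
    field_simp
  · intro RIsp RD qs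
    refine isAMG_of_tendsto (by positivity) ?_
    -- The given `RIsp` and `RD` are arbitrary and need not tend to zero; they are replaced by `0`,
    -- which does not change the mean progress at secondary density zero.
    refine tendsto_throughput_div (t := t) (lams := fun _ => 0) (P := fun lam =>
      ⟨txRange Kp lam, intfRange Kp lp lam, 0, 0, qp lam, qs lam⟩) hrA (.of_forall fun _ => le_rfl)
      ?_ hf hscale hRr0 (.of_forall fun lam => intfRange_nonneg hKp lp lam)
      (.of_forall fun _ => le_rfl) (.of_forall fun _ => le_rfl) (tendsto_txRange Kp)
      (tendsto_intfRange Kp lp) tendsto_const_nhds tendsto_const_nhds hq (tendsto_meanHops hKp) hqp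
      ?_ ?_
    · filter_upwards [eventually_gt_atTop 0, hRr0] with lam hl hR
      have h1 := abs_throughput_sub_le hrA hl.le 0
        ⟨txRange Kp lam, intfRange Kp lp lam, RIsp lam, RD lam, qp lam, qs lam⟩ hR.le t
      rw [(throughput_zero hrA lam le_rfl _ hR.le).2, ← singleThroughput_eq hrA lam _ hR.le,
        zero_mul] at h1
      rw [zero_mul, firstProgress_zero_congr
        (P' := ⟨txRange Kp lam, intfRange Kp lp lam, 0, 0, qp lam, qs lam⟩)
        (P := ⟨txRange Kp lam, intfRange Kp lp lam, RIsp lam, RD lam, qp lam, qs lam⟩) rfl rfl rfl]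
      exact h1
    · simp
    · simp
  · intro RD hRD0 hRD qs hqs
    refine isAMG_of_tendsto (by positivity) ?_
    have hβ : Tendsto (fun lam : ℝ => lam ^ β) atTop atTop := tendsto_rpow_atTop hβ0
    -- The idle probability times `qs` is the effective access probability, so the normalisation
    -- gives `1` for the secondary interference range, and the larger radius contributes the factor
    -- `ρ ^ 2`.
    have hσ : Tendsto (fun lam => lam ^ β * qs lam * (idleProb lam (qp lam) (RD lam) *
        (π * (ρ * intfRange Ks ls (lam ^ β)) ^ 2))) atTop (𝓝 (ρ ^ 2)) := by
      have := hqs.const_mul (ρ ^ 2)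
      rw [mul_one] at this
      refine this.congr fun lam => ?_
      rw [effectiveAccess, idleProb]
      ring
    have hsp : Tendsto (fun lam : ℝ => ρ * intfRange Ks ls (lam ^ β)) atTop (𝓝 0) := by
      have := ((tendsto_intfRange Ks ls).comp hβ).const_mul ρ
      rw [mul_zero] at this
      exact this
    refine tendsto_throughput_div (t := t) (lams := fun lam => lam ^ β) (P := fun lam =>
      ⟨txRange Kp lam, intfRange Kp lp lam, ρ * intfRange Ks ls (lam ^ β), RD lam, qp lam, qs lam⟩)
      hrA ?_ ?_ hf hscale hRr0 (.of_forall fun lam => intfRange_nonneg hKp lp lam)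
      (.of_forall fun lam => mul_nonneg (by linarith) (intfRange_nonneg hKs ls _))
      (.of_forall hRD0) (tendsto_txRange Kp) (tendsto_intfRange Kp lp) hsp
      (hRD.trans_tendsto (tendsto_txRange Kp)) hq (tendsto_meanHops hKp) hqp hσ
      (tendsto_coverBound hlp hKp hKs hls hβ0 hβ1 hρ hqp hRD0 hRD hσ)
    · filter_upwards [eventually_gt_atTop 0] with lam hl
      positivity
    · filter_upwards [eventually_gt_atTop 0, hRr0] with lam hl hR
      have h1 := abs_throughput_sub_le hrA hl.le (lam ^ β)
        ⟨txRange Kp lam, intfRange Kp lp lam, ρ * intfRange Ks ls (lam ^ β), RD lam, qp lam, qs lam⟩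
        hR.le t
      rw [(throughput_zero hrA lam (Real.rpow_nonneg hl.le β) _ hR.le).2] at h1
      exact h1
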